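/- Let $\mathcal H=L^2(\mathbb R^3)^3\times L^2(\mathbb R^3)^3$ and $\mathcal V=H_{\rm curl}(\mathbb R^3)\times H_{\rm curl}(\mathbb R^3)$ (real-valued fields), and for $v=(E,H)\in\mathcal V$ put $\mathbb A v=(\operatorname{curl}H,-\operatorname{curl}E)$. Let $\varepsilon,\mu$ be real symmetric $3\times3$ matrix fields on $\mathbb R^3$ with $L^\infty(\mathbb R^3)$ entries which are uniformly elliptic, i.e. for some $c>0$, $\varepsilon(x)\xi\cdot\xi\ge c|\xi|^2$ and $\mu(x)\xi\cdot\xi\ge c|\xi|^2$ for a.e. $x\in\mathbb R^3$ and all $\xi\in\mathbb R^3$, and let $M=\operatorname{diag}(\varepsilon,\mu)$. Let $\Lambda:\mathbb R\to\mathcal M_6(L^\infty(\mathbb R^3))$ be a kernel with values in the real $6\times6$ matrices with $L^\infty(\mathbb R^3)$ entries, such that $\Lambda\in L^1_{loc}(\mathbb R;\mathcal M_6(L^\infty(\mathbb R^3)))$ (so that $\Lambda\in L^1(0,T;\mathcal M_6(L^\infty(\mathbb R^3)))$ for every $T$), and such that $\Lambda$ is tempered as a distribution in time and its temporal Fourier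 transform $\widehat\Lambda(\omega,x)=\frac1{\sqrt{2\pi}}\int_{\mathbb R}\Lambda(t,x)e^{i\omega t}\,dt$, taken in the sense of tempered distributions, also belongs to $L^1_{loc}$ in $\omega$ with values in the complex $6\times 6$ matrices with $L^\infty(\mathbb R^3)$ entries. Assume * (causality) $\Lambda(t)=0$ for a.e. $t<0$; * (passivity) for a.e. $\omega\in\mathbb R$, a.e. $x\in\mathbb R^3$ and all $X\in\mathbb C^6$, $\operatorname{Re}\big(\widehat\Lambda(\omega,x)X\cdot\overline X\big)\ge0$. Let $T\in(0,\infty)$, $u_0\in\mathcal H$ and $f\in L^1(0,T;\mathcal H)$. For $u\in L^\infty(0,T;\mathcal H)$ put $(\Lambda\star u)(t)=\int_0^t\Lambda(t-\tau)u(\tau)\,d\tau$. A weak solution on $(0,T)$ of $$M\partial_t u+\Lambda\star u=\mathbb A u+f,\qquad u(0)=u_0,$$ is a function $u\in L^\infty(0,T;\mathcal H)$ such that for every $v\in\mathcal V$ $$\frac{d}{dt}\langle Mu(t),v\rangle_{\mathcal H}+\langle(\Lambda\star u)(t),v\rangle_{\mathcal H}=\langle u(t),\mathbb A v\rangle_{\mathcal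 H}+\langle f(t),v\rangle_{\mathcal H}$$ in the sense of distributions on $(0,T)$, and such that the continuous representative on $[0,T]$ of $t\mapsto\langle Mu(t),v\rangle_{\mathcal H}$ takes the value $\langle Mu_0,v\rangle_{\mathcal H}$ at $t=0$. Then there exists a unique weak solution $u\in L^\infty(0,T;\mathcal H)$ (unique up to equality for a.e. $t\in(0,T)$). Moreover, there is a constant $C>0$ depending only on the coercivity constant $c$ such that, for a.e. $t\in(0,T)$, $$\langle Mu(t),u(t)\rangle_{\mathcal H}\le\Big(\langle Mu_0,u_0\rangle_{\mathcal H}^{1/2}+C\int_0^t\|f(s)\|_{\mathcal H}\,ds\Big)^2 .$$ -/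

import Mathlib

open MeasureTheory Set
open scoped ENNReal ContDiff SchwartzMap

noncomputable section

namespace DispersiveMaxwell

/-- Physical space `ℝ³`. -/
abbrev E3 : Type := EuclideanSpace ℝ (Fin 3)

/-- The scalar space `L^∞(ℝ³)` (with real or complex values). -/
abbrev Linf (𝕜 : Type) [RCLike 𝕜] : Type := Lp 𝕜 ∞ (volume : Measure E3)

/-- The real scalar space `L²(ℝ³)`. -/
abbrev L2 : Type := Lp ℝ 2 (volume : Measure E3)

/-- Index set of the six components of an electromagnetic field: `Sum.inl` numbers the electric
components, `Sum.inr` the magnetic ones. -/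
abbrev Idx : Type := Fin 3 ⊕ Fin 3

/-- The Hilbert space `𝓗 = L²(ℝ³)³ × L²(ℝ³)³` with its standard inner product. -/
abbrev H : Type := PiLp 2 (fun _ : Idx => L2)

/-- Electric part of a field. -/
def elec (u : H) : Fin 3 → L2 := fun i => u (Sum.inl i)

/-- Magnetic part of a field. -/
def magn (u : H) : Fin 3 → L2 := fun i => u (Sum.inr i)

/-- Pointwise multiplication of a field by a matrix with bounded measurable entries:
`(A u)(x) = A(x) u(x)`. -/
def mulField (A : Matrix Idx Idx (Linf ℝ)) (u : H) : H :=
  WithLp.toLp 2 (fun i => ∑ j, ((A i j • u j : L2)))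

/-- The partial derivative `∂ᵢ g` of a scalar function. -/
def partialDeriv (i : Fin 3) (g : E3 → ℝ) (x : E3) : ℝ :=
  fderiv ℝ g x (EuclideanSpace.single i 1)

/-- Classical curl of a vector field. -/
def curl (φ : E3 → Fin 3 → ℝ) (x : E3) : Fin 3 → ℝ :=
  ![partialDeriv 1 (fun y => φ y 2) x - partialDeriv 2 (fun y => φ y 1) x,
    partialDeriv 2 (fun y => φ y 0) x - partialDeriv 0 (fun y => φ y 2) x,
    partialDeriv 0 (fun y => φ y 1) x - partialDeriv 1 (fun y => φ y 0) x]

/-- `w ∈ H_curl(ℝ³)` and `z = curl w ∈ L²(ℝ³)³`, in the sense of distributions. -/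
def HasWeakCurl (w z : Fin 3 → L2) : Prop :=
  ∀ φ : E3 → Fin 3 → ℝ, ContDiff ℝ ∞ φ → HasCompactSupport φ →
    ∫ x, ∑ i, z i x * φ x i = ∫ x, ∑ i, w i x * curl φ x i

/-- `v ∈ 𝓥 = H_curl(ℝ³) × H_curl(ℝ³)` and `w = 𝔸 v`, where `𝔸 (E, H) = (curl H, - curl E)`. -/
def HasMaxwell (v w : H) : Prop :=
  HasWeakCurl (magn v) (elec w) ∧ HasWeakCurl (elec v) (-magn w)

/-- A real symmetric `3 × 3` matrix field with `L^∞(ℝ³)` entries that is uniformly elliptic with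
coercivity constant `c` (the upper ellipticity bound is the boundedness of the entries). -/
def IsElliptic (c : ℝ) (A : Matrix (Fin 3) (Fin 3) (Linf ℝ)) : Prop :=
  A.IsSymm ∧ ∀ᵐ x : E3, ∀ ξ : Fin 3 → ℝ, c * ∑ i, ξ i ^ 2 ≤ ∑ i, ∑ j, A i j x * ξ j * ξ i

/-- The block-diagonal matrix `M = diag(ε, μ)`. -/
def blockM (ε μ : Matrix (Fin 3) (Fin 3) (Linf ℝ)) : Matrix Idx Idx (Linf ℝ) :=
  Matrix.fromBlocks ε 0 0 μ

/-- A real bounded function regarded as a complex one. -/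
def toComplex (g : Linf ℝ) : Linf ℂ := Complex.ofRealCLM.compLp g

/-- `lamHat` is the Fourier transform in time of `lam`, with the convention
`lamHat ξ = (2π)^(-1/2) ∫ lam t e^{iξt} dt`. The kernels are only locally integrable, so this is
meant in the sense of tempered distributions: `lam` is (extends to) a tempered distribution `S`
with values in `L^∞(ℝ³)`, and `lamHat` represents the Fourier transform of `S`,
which is defined by duality. -/
def IsTimeFourier (lam : ℝ → Linf ℝ) (lamHat : ℝ → Linf ℂ) : Prop :=
  ∃ S : 𝓢(ℝ, ℂ) →L[ℂ] Linf ℂ,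
    (∀ φ : 𝓢(ℝ, ℂ), HasCompactSupport φ → S φ = ∫ t, φ t • toComplex (lam t)) ∧
    (∀ φ ψ : 𝓢(ℝ, ℂ), HasCompactSupport ψ →
      (∀ t : ℝ, φ t = ((Real.sqrt (2 * Real.pi))⁻¹ : ℂ) *
        ∫ ξ : ℝ, ψ ξ * Complex.exp (Complex.I * ξ * t)) →
      S φ = ∫ ξ, ψ ξ • lamHat ξ)

/-- Causality: the kernel vanishes for negative times. -/
def IsCausal (Λ : ℝ → Matrix Idx Idx (Linf ℝ)) : Prop :=
  ∀ᵐ t : ℝ, t < 0 → Λ t = 0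

/-- Passivity, `Re (Λ̂(ξ, x) X · X̄) ≥ 0` for all `X ∈ ℂ⁶`, a.e. in `(ξ, x)`, expressed through
the Fourier transform `Λ̂` of the kernel. -/
def IsPassive (ΛHat : ℝ → Matrix Idx Idx (Linf ℂ)) : Prop :=
  ∀ᵐ ξ : ℝ, ∀ᵐ x : E3, ∀ X : Idx → ℂ,
    0 ≤ (∑ i, ∑ j, ΛHat ξ i j x * X j * (starRingEnd ℂ) (X i)).re

/-- The truncated time convolution `(Λ ⋆ u)(t) = ∫₀ᵗ Λ(t - τ) u(τ) dτ`, an integral in `𝓗`. -/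
def truncConv (Λ : ℝ → Matrix Idx Idx (Linf ℝ)) (u : ℝ → H) (t : ℝ) : H :=
  ∫ τ in (0 : ℝ)..t, mulField (Λ (t - τ)) (u τ)

/-- `u ∈ L^∞(0, T; 𝓗)` is a weak solution on `(0, T)` of
`M ∂ₜ u + Λ ⋆ u = 𝔸 u + f`, `u(0) = u₀`. -/
structure IsWeakSolution (T : ℝ) (M : Matrix Idx Idx (Linf ℝ)) (Λ : ℝ → Matrix Idx Idx (Linf ℝ))
    (f : ℝ → H) (u₀ : H) (u : ℝ → H) : Prop where
  memLp : MemLp u ∞ (volume.restrict (Ioo 0 T))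
  /-- `d/dt ⟨M u, v⟩ + ⟨Λ ⋆ u, v⟩ = ⟨u, 𝔸 v⟩ + ⟨f, v⟩` for all `v ∈ 𝓥`,
  as distributions on `(0, T)` -/
  equation : ∀ v w : H, HasMaxwell v w →
    ∀ φ : ℝ → ℝ, ContDiff ℝ ∞ φ → HasCompactSupport φ → tsupport φ ⊆ Ioo 0 T →
      -(∫ t in Ioo 0 T, deriv φ t * inner ℝ (mulField M (u t)) v)
        + ∫ t in Ioo 0 T, φ t * inner ℝ (truncConv Λ u t) v
      = ∫ t in Ioo 0 T, φ t * (inner ℝ (u t) w + inner ℝ (f t) v)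
  /-- `⟨M u(0), v⟩ = ⟨M u₀, v⟩` for all `v ∈ 𝓥`, the left-hand side being the value at `0` of the
  continuous representative of `⟨M u(·), v⟩` -/
  initial : ∀ v w : H, HasMaxwell v w →
    ∃ g : ℝ → ℝ, ContinuousOn g (Icc 0 T) ∧
      (∀ᵐ t ∂(volume.restrict (Ioo 0 T)), g t = inner ℝ (mulField M (u t)) v) ∧
      g 0 = inner ℝ (mulField M u₀) v

end DispersiveMaxwell

end

open DispersiveMaxwell

/-!
# Well-posedness of Maxwell's equations with a passive, causal memory term

Write the problem as `M u' + K ⋆ u + A u = f` in the Hilbert space `𝓗`, with `A` the Maxwell operator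
(the weak formulation pairs `u` with `𝔸 v`, and `𝔸` is skew) and `K(t)` the multiplication by `Λ(t)`.
Three facts drive the proof.

* The Maxwell operator is skew-adjoint (`isSkewAdjointGraph_maxwellGraph`). The point is the symmetry
  of the weak curl on its maximal domain (`HasWeakCurl.integral_symm`), which follows by mollification
  and by cutting off test fields at infinity.
* A passive kernel is positive: `∫₀ᵀ ⟨K ⋆ a, a⟩ ≥ 0` (`isPositiveKernel_kernelOp`). For finite sums
  `a = ∑ φ_k e_k` the double integral is the kernel tested with the correlations of the `φ_k`. Their
  Fourier transforms are the products `z_k * conj z_l`, so on the frequency side the sum is the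
  integral of the quadratic form of `Λ̂`. As `Λ̂` is only locally integrable, frequencies are truncated,
  using that `χ(·/n) h → h` in the Schwartz space (`tendsto_truncate`). Such sums are dense in `L²`.
* Multiplication by `diag(ε, μ)` is symmetric and coercive (`isSymmCoercive_mulOp`).

Uniqueness (`eq_zero_of_integrated_equation`) holds even for integrable solutions: the primitive `W`
of a solution `w` of the homogeneous problem satisfies `M W' + K ⋆ W = -A W` with `W` in the domain of
`A`, and the energy identity for `W` gives `⟨M W, W⟩ ≤ 0`.

Existence is deduced from uniqueness by duality. For functions that are smooth in time with values in
the domain of `A`, positivity of `K` gives the a priori estimate with constant `2 / √c`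
(`IsRegular.sqrt_energy_le`). Their data `(u(0), M u' + K ⋆ u + A u)` are dense in `𝓗 × L²(0, T; 𝓗)`:
after reflection of time, an element orthogonal to all of them is a solution of the homogeneous
problem for the adjoint kernel and `-A`, which has the same structure, and so it vanishes
(`eq_zero_of_orthogonal_regular`). Hence solutions for arbitrary data are uniform limits of regular
functions, and the estimate passes to the limit (`exists_continuous_solution`).
-/

noncomputable section

namespace DispersiveMaxwell

/-! ### Operator kernels on a time interval -/

/-- Lebesgue measure on the time interval `(0, T)`. -/
abbrev timeMeasure (T : ℝ) : Measure ℝ := volume.restrict (Ioo 0 T)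

section Kernel

lemma measurePreserving_timeReflection (T : ℝ) :
    MeasurePreserving (MeasurableEquiv.subLeft T) (timeMeasure T) (timeMeasure T) := by
  have h := (Measure.measurePreserving_sub_left (volume : Measure ℝ) T).restrict_preimage
    (s := Ioo 0 T) measurableSet_Ioo
  have h2 : (fun x => T - x) ⁻¹' Ioo 0 T = Ioo 0 T := by
    ext x
    simp only [mem_preimage, mem_Ioo]
    constructor <;> rintro ⟨h, h'⟩ <;> constructor <;> linarith
  rw [h2] at h
  exact h

lemma integrable_kernel_mul_right {k : ℝ → ℝ} (hk : Integrable k) {T : ℝ} {b : ℝ → ℝ}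
    (hb : Integrable b (timeMeasure T)) :
    Integrable (fun p : ℝ × ℝ => k (p.1 - p.2) * b p.2)
      ((timeMeasure T).prod (timeMeasure T)) := by
  have hb' : Integrable ((Ioo 0 T).indicator b) := (integrable_indicator_iff measurableSet_Ioo).2 hb
  have h := (hb'.convolution_integrand (ContinuousLinearMap.mul ℝ ℝ) hk).restrict
    (s := Ioo 0 T ×ˢ Ioo 0 T)
  rw [← Measure.prod_restrict] at h
  refine h.congr ?_
  rw [Measure.prod_restrict]
  filter_upwards [ae_restrict_mem (measurableSet_Ioo.prod measurableSet_Ioo)] with p hp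
  simp [indicator_of_mem hp.2, mul_comm]

lemma integrable_kernel_mul_left {k : ℝ → ℝ} (hk : Integrable k) {T : ℝ} {b : ℝ → ℝ}
    (hb : Integrable b (timeMeasure T)) :
    Integrable (fun p : ℝ × ℝ => k (p.1 - p.2) * b p.1)
      ((timeMeasure T).prod (timeMeasure T)) := by
  have h := (integrable_kernel_mul_right (k := fun x => k (-x)) hk.comp_neg hb).swap
  refine h.congr (Filter.Eventually.of_forall fun p => ?_)
  simp

variable {X : Type*} [NormedAddCommGroup X] [InnerProductSpace ℝ X]

lemma aestronglyMeasurable_kernel_sub {Y : Type*} [TopologicalSpace Y]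
    [TopologicalSpace.PseudoMetrizableSpace Y] {K : ℝ → Y}
    (hK : AEStronglyMeasurable K volume) (T : ℝ) :
    AEStronglyMeasurable (fun p : ℝ × ℝ => K (p.1 - p.2))
      ((timeMeasure T).prod (timeMeasure T)) := by
  have h : AEStronglyMeasurable (fun p : ℝ × ℝ => K (p.1 - p.2)) (volume.prod volume) :=
    hK.comp_quasiMeasurePreserving (quasiMeasurePreserving_sub _ _)
  rw [Measure.prod_restrict]
  exact h.restrict

lemma aestronglyMeasurable_kernel_apply {K : ℝ → X →L[ℝ] X} (hK : AEStronglyMeasurable K volume)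
    {T : ℝ} {a : ℝ → X} (ha : AEStronglyMeasurable a (timeMeasure T)) :
    AEStronglyMeasurable (fun p : ℝ × ℝ => K (p.1 - p.2) (a p.2))
      ((timeMeasure T).prod (timeMeasure T)) :=
  isBoundedBilinearMap_apply.continuous.comp_aestronglyMeasurable
    ((aestronglyMeasurable_kernel_sub hK T).prodMk ha.comp_snd)

lemma aestronglyMeasurable_kernel_inner {K : ℝ → X →L[ℝ] X} (hK : AEStronglyMeasurable K volume)
    {T : ℝ} {a b : ℝ → X} (ha : AEStronglyMeasurable a (timeMeasure T))
    (hb : AEStronglyMeasurable b (timeMeasure T)) :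
    AEStronglyMeasurable (fun p : ℝ × ℝ => inner ℝ (K (p.1 - p.2) (a p.2)) (b p.1))
      ((timeMeasure T).prod (timeMeasure T)) :=
  (aestronglyMeasurable_kernel_apply hK ha).inner hb.comp_fst

lemma integrable_kernel_apply {K : ℝ → X →L[ℝ] X} (hK : Integrable K) {T : ℝ} {a : ℝ → X}
    (ha : Integrable a (timeMeasure T)) :
    Integrable (fun p : ℝ × ℝ => K (p.1 - p.2) (a p.2))
      ((timeMeasure T).prod (timeMeasure T)) := by
  refine (integrable_kernel_mul_right hK.norm ha.norm).mono'
    (aestronglyMeasurable_kernel_apply hK.1 ha.1) (Filter.Eventually.of_forall fun p => ?_)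
  exact ContinuousLinearMap.le_opNorm _ _

lemma norm_inner_apply_le (L : X →L[ℝ] X) (x y : X) : ‖inner ℝ (L x) y‖ ≤ ‖L‖ * ‖x‖ * ‖y‖ :=
  (norm_inner_le_norm _ _).trans (by gcongr; exact L.le_opNorm x)

lemma integrable_kernel_inner_of_bdd_right {K : ℝ → X →L[ℝ] X} (hK : Integrable K) {T : ℝ}
    {a b : ℝ → X} (ha : Integrable a (timeMeasure T)) (hb : MemLp b ∞ (timeMeasure T)) :
    Integrable (fun p : ℝ × ℝ => inner ℝ (K (p.1 - p.2) (a p.2)) (b p.1))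
      ((timeMeasure T).prod (timeMeasure T)) := by
  refine ((integrable_kernel_mul_right hK.norm ha.norm).mul_const
    (lpNorm b ∞ (timeMeasure T))).mono'
    (aestronglyMeasurable_kernel_inner hK.1 ha.1 hb.1) ?_
  filter_upwards [Measure.quasiMeasurePreserving_fst.ae (ae_le_lpNorm_exponent_top hb)] with p hp
  refine (norm_inner_apply_le _ _ _).trans ?_
  gcongr

lemma integrable_kernel_inner_of_bdd_left {K : ℝ → X →L[ℝ] X} (hK : Integrable K) {T : ℝ}
    {a b : ℝ → X} (ha : MemLp a ∞ (timeMeasure T)) (hb : Integrable b (timeMeasure T)) :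
    Integrable (fun p : ℝ × ℝ => inner ℝ (K (p.1 - p.2) (a p.2)) (b p.1))
      ((timeMeasure T).prod (timeMeasure T)) := by
  refine ((integrable_kernel_mul_left hK.norm hb.norm).const_mul
    (lpNorm a ∞ (timeMeasure T))).mono'
    (aestronglyMeasurable_kernel_inner hK.1 ha.1 hb.1) ?_
  filter_upwards [Measure.quasiMeasurePreserving_snd.ae (ae_le_lpNorm_exponent_top ha)] with p hp
  refine (norm_inner_apply_le _ _ _).trans ?_
  rw [mul_comm ‖K _‖, mul_assoc]
  gcongr

lemma integrable_kernel_inner_of_memLp_two {K : ℝ → X →L[ℝ] X} (hK : Integrable K) {T : ℝ}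
    {a b : ℝ → X} (ha : MemLp a 2 (timeMeasure T)) (hb : MemLp b 2 (timeMeasure T)) :
    Integrable (fun p : ℝ × ℝ => inner ℝ (K (p.1 - p.2) (a p.2)) (b p.1))
      ((timeMeasure T).prod (timeMeasure T)) := by
  refine ((integrable_kernel_mul_right hK.norm ha.norm.integrable_sq).add
    (integrable_kernel_mul_left hK.norm hb.norm.integrable_sq)).mono'
    (aestronglyMeasurable_kernel_inner hK.1 ha.1 hb.1) (Filter.Eventually.of_forall fun p => ?_)
  refine (norm_inner_apply_le _ _ _).trans ?_
  simp only [Pi.add_apply]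
  rw [← mul_add, mul_assoc]
  gcongr
  nlinarith [sq_nonneg (‖a p.2‖ - ‖b p.1‖), sq_nonneg (‖a p.2‖), sq_nonneg ‖b p.1‖]

/-- The convolution `(K ⋆ a)(t) = ∫₀ᵀ K(t - s) a(s) ds` of an operator kernel with a function
on `(0, T)`. For a causal kernel only the values `s < t` contribute. -/
def convOn (K : ℝ → X →L[ℝ] X) (T : ℝ) (a : ℝ → X) (t : ℝ) : X :=
  ∫ s in Ioo 0 T, K (t - s) (a s)

lemma integrable_convOn {K : ℝ → X →L[ℝ] X} (hK : Integrable K) {T : ℝ} {a : ℝ → X}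
    (ha : Integrable a (timeMeasure T)) : Integrable (convOn K T a) (timeMeasure T) :=
  (integrable_kernel_apply hK ha).integral_prod_left

lemma integrable_convOn_integrand {K : ℝ → X →L[ℝ] X} (hK : Integrable K) {T : ℝ} {a : ℝ → X}
    (ha : MemLp a ∞ (timeMeasure T)) (t : ℝ) :
    Integrable (fun s => K (t - s) (a s)) (timeMeasure T) := by
  have hKt : Integrable (fun s => K (t - s)) (timeMeasure T) := (hK.comp_sub_left t).restrict
  refine (hKt.norm.mul_const (lpNorm a ∞ (timeMeasure T))).mono'
    (isBoundedBilinearMap_apply.continuous.comp_aestronglyMeasurable (hKt.1.prodMk ha.1)) ?_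
  filter_upwards [ae_le_lpNorm_exponent_top ha] with s hs
  exact (ContinuousLinearMap.le_opNorm _ _).trans (by gcongr)

lemma norm_convOn_le {K : ℝ → X →L[ℝ] X} (hK : Integrable K) {T : ℝ} {a : ℝ → X} {C : ℝ}
    (hC : 0 ≤ C) (ha : ∀ᵐ s ∂timeMeasure T, ‖a s‖ ≤ C) (t : ℝ) :
    ‖convOn K T a t‖ ≤ (∫ s, ‖K s‖) * C := by
  have hKt : Integrable (fun s => K (t - s)) volume := hK.comp_sub_left t
  calc ‖convOn K T a t‖ ≤ ∫ s in Ioo 0 T, ‖K (t - s)‖ * C := by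
        refine norm_integral_le_of_norm_le (hKt.restrict.norm.mul_const C) ?_
        filter_upwards [ha] with s hs
        exact (ContinuousLinearMap.le_opNorm _ _).trans (by gcongr)
    _ ≤ ∫ s, ‖K (t - s)‖ * C :=
        setIntegral_le_integral (hKt.norm.mul_const C)
          (Filter.Eventually.of_forall fun s => by positivity)
    _ = (∫ s, ‖K s‖) * C := by
        rw [integral_mul_const, integral_sub_left_eq_self (fun s => ‖K s‖)]

lemma memLp_top_convOn {K : ℝ → X →L[ℝ] X} (hK : Integrable K) {T : ℝ} {a : ℝ → X}
    (ha : MemLp a ∞ (timeMeasure T)) : MemLp (convOn K T a) ∞ (timeMeasure T) :=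
  memLp_top_of_bound (integrable_convOn hK (ha.integrable le_top)).1 _
    (Filter.Eventually.of_forall
      (norm_convOn_le hK lpNorm_nonneg (ae_le_lpNorm_exponent_top ha)))

lemma convOn_sub {K : ℝ → X →L[ℝ] X} (hK : Integrable K) {T : ℝ} {a b : ℝ → X}
    (ha : MemLp a ∞ (timeMeasure T)) (hb : MemLp b ∞ (timeMeasure T)) (t : ℝ) :
    convOn K T (fun s => a s - b s) t = convOn K T a t - convOn K T b t := by
  simp only [convOn, map_sub]
  exact integral_sub (integrable_convOn_integrand hK ha t) (integrable_convOn_integrand hK hb t)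

lemma convOn_add {K : ℝ → X →L[ℝ] X} (hK : Integrable K) {T : ℝ} {a b : ℝ → X}
    (ha : MemLp a ∞ (timeMeasure T)) (hb : MemLp b ∞ (timeMeasure T)) (t : ℝ) :
    convOn K T (fun s => a s + b s) t = convOn K T a t + convOn K T b t := by
  simp only [convOn, map_add]
  exact integral_add (integrable_convOn_integrand hK ha t) (integrable_convOn_integrand hK hb t)

lemma convOn_smul (K : ℝ → X →L[ℝ] X) (T : ℝ) (a : ℝ → X) (r t : ℝ) :
    convOn K T (fun s => r • a s) t = r • convOn K T a t := by
  simp only [convOn, map_smul]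
  exact integral_smul _ _

lemma integral_inner_convOn [CompleteSpace X] {K : ℝ → X →L[ℝ] X} (hK : Integrable K) {T : ℝ}
    {a b : ℝ → X} (ha : Integrable a (timeMeasure T))
    (hab : Integrable (fun p : ℝ × ℝ => inner ℝ (K (p.1 - p.2) (a p.2)) (b p.1))
      ((timeMeasure T).prod (timeMeasure T))) :
    ∫ t, inner ℝ (convOn K T a t) (b t) ∂timeMeasure T =
      ∫ p, inner ℝ (K (p.1 - p.2) (a p.2)) (b p.1) ∂(timeMeasure T).prod (timeMeasure T) := by
  rw [integral_prod _ hab]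
  refine integral_congr_ae ?_
  filter_upwards [(integrable_kernel_apply hK ha).prod_right_ae] with t ht
  rw [real_inner_comm, convOn, ← integral_inner ht]
  simp only [real_inner_comm]

/-- A causal kernel does not see the values of the function after time `t`. -/
lemma convOn_congr_of_causal {K : ℝ → X →L[ℝ] X} (hc : ∀ᵐ t, t < 0 → K t = 0) {T : ℝ}
    {a b : ℝ → X} {t : ℝ} (hab : ∀ s, s ≤ t → a s = b s) : convOn K T a t = convOn K T b t := by
  refine integral_congr_ae (ae_restrict_of_ae ?_)
  have h := (Measure.measurePreserving_sub_left (volume : Measure ℝ) t).quasiMeasurePreserving.ae hc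
  filter_upwards [h] with s hs
  rcases le_or_gt s t with h1 | h1
  · rw [hab s h1]
  · simp [hs (by linarith)]

/-- Positivity of the convolution with `K` on the time interval `(0, T)`:
`∫₀ᵀ ⟨(K ⋆ a)(t), a(t)⟩ dt ≥ 0` for all bounded measurable `a`. It is written as a double integral
over the square, in which form it is visibly invariant under time reflection combined with passing
to the adjoint kernel. -/
def IsPositiveKernel (K : ℝ → X →L[ℝ] X) (T : ℝ) : Prop :=
  ∀ a : ℝ → X, MemLp a ∞ (timeMeasure T) →
    0 ≤ ∫ p, inner ℝ (K (p.1 - p.2) (a p.2)) (a p.1) ∂(timeMeasure T).prod (timeMeasure T)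

lemma IsPositiveKernel.setIntegral_nonneg [CompleteSpace X] {K : ℝ → X →L[ℝ] X} {T : ℝ}
    (hpos : IsPositiveKernel K T)
    (hK : Integrable K) (hc : ∀ᵐ t, t < 0 → K t = 0) {a : ℝ → X}
    (ha : MemLp a ∞ (timeMeasure T)) {τ : ℝ} (hτ : τ ≤ T) :
    0 ≤ ∫ t in Ioo 0 τ, inner ℝ (convOn K T a t) (a t) := by
  set b := (Ioo 0 τ).indicator a with hb
  have hbm : MemLp b ∞ (timeMeasure T) := ha.indicator measurableSet_Ioo
  have h := hpos b hbm
  rw [← integral_inner_convOn hK (hbm.integrable le_top)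
    (integrable_kernel_inner_of_bdd_right hK (hbm.integrable le_top) hbm)] at h
  have h2 : (fun t => inner ℝ (convOn K T b t) (b t)) =
      (Ioo 0 τ).indicator (fun t => inner ℝ (convOn K T b t) (b t)) := by
    ext t
    by_cases ht : t ∈ Ioo 0 τ <;> simp [ht, hb]
  rw [h2, setIntegral_indicator measurableSet_Ioo,
    inter_eq_right.2 (Ioo_subset_Ioo_right hτ)] at h
  convert h using 1
  refine setIntegral_congr_fun measurableSet_Ioo fun t ht => ?_
  have hbt : b t = a t := indicator_of_mem ht _
  simp only [hbt]
  congr 1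
  -- on `(0, t]` the two functions agree up to the point `s ≤ 0`, which is outside the domain
  have : convOn K T a t = convOn K T ((Ioi 0).indicator a) t := by
    refine setIntegral_congr_fun measurableSet_Ioo fun s hs => ?_
    simp [indicator_of_mem (show s ∈ Ioi (0:ℝ) from hs.1)]
  rw [this]
  refine convOn_congr_of_causal hc fun s hs => ?_
  by_cases h0 : 0 < s
  · simp [hb, h0, lt_of_le_of_lt hs ht.2]
  · simp [hb, h0]

lemma integral_prod_timeReflection {E : Type*} [NormedAddCommGroup E] [NormedSpace ℝ E] (T : ℝ)
    (F : ℝ × ℝ → E) :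
    ∫ p, F (T - p.2, T - p.1) ∂(timeMeasure T).prod (timeMeasure T) =
      ∫ p, F p ∂(timeMeasure T).prod (timeMeasure T) := by
  have h1 := (measurePreserving_timeReflection T).prod (measurePreserving_timeReflection T)
  rw [← integral_prod_swap F,
    ← h1.integral_comp ((MeasurableEquiv.subLeft T).prodCongr
      (MeasurableEquiv.subLeft T)).measurableEmbedding]
  have e : ∀ x, MeasurableEquiv.subLeft T x = T - x := fun _ => rfl
  simp [Prod.swap, e]

lemma Integrable.adjoint_kernel [CompleteSpace X] {K : ℝ → X →L[ℝ] X} (hK : Integrable K) :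
    Integrable (fun t => ContinuousLinearMap.adjoint (K t)) :=
  hK.norm.mono' (ContinuousLinearMap.adjoint.continuous.comp_aestronglyMeasurable hK.1)
    (Filter.Eventually.of_forall fun t => by simp)

/-- Positivity is invariant under passing to the adjoint kernel, because time reflection turns the
quadratic form of `K` into that of the adjoint. -/
lemma IsPositiveKernel.adjoint [CompleteSpace X] {K : ℝ → X →L[ℝ] X} {T : ℝ}
    (hpos : IsPositiveKernel K T) :
    IsPositiveKernel (fun t => ContinuousLinearMap.adjoint (K t)) T := by
  intro a ha
  rw [← integral_prod_timeReflection]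
  have h := hpos (fun t => a (T - t))
    (ha.comp_measurePreserving (measurePreserving_timeReflection T))
  convert h using 3 with p
  rw [ContinuousLinearMap.adjoint_inner_left, real_inner_comm]
  simp

end Kernel

/-! ### Primitives of integrable functions -/

section Primitive

variable {X : Type*} [NormedAddCommGroup X] [InnerProductSpace ℝ X]

lemma integral_prod_triangle {E : Type*} [NormedAddCommGroup E] [NormedSpace ℝ E] {T : ℝ}
    {F : ℝ → ℝ → E}
    (hF : Integrable (fun p : ℝ × ℝ => F p.1 p.2) ((timeMeasure T).prod (timeMeasure T))) :
    ∫ t in Ioo 0 T, ∫ s in Ioo 0 t, F t s = ∫ s in Ioo 0 T, ∫ t in Ioo s T, F t s := by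
  have hm : MeasurableSet {p : ℝ × ℝ | p.2 < p.1} := measurableSet_lt measurable_snd measurable_fst
  have h := integral_integral_swap (f := fun t s => {p : ℝ × ℝ | p.2 < p.1}.indicator
    (fun p : ℝ × ℝ => F p.1 p.2) (t, s)) (hF.indicator hm)
  convert h using 1
  · refine setIntegral_congr_fun measurableSet_Ioo fun t ht => ?_
    have : (fun s => {p : ℝ × ℝ | p.2 < p.1}.indicator (fun p : ℝ × ℝ => F p.1 p.2) (t, s)) =
        (Iio t).indicator (fun s => F t s) := by
      ext s; simp [indicator]
    simp only [this]
    rw [setIntegral_indicator measurableSet_Iio, Ioo_inter_Iio, min_eq_right ht.2.le]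
  · refine setIntegral_congr_fun measurableSet_Ioo fun s hs => ?_
    have : (fun t => {p : ℝ × ℝ | p.2 < p.1}.indicator (fun p : ℝ × ℝ => F p.1 p.2) (t, s)) =
        (Ioi s).indicator (fun t => F t s) := by
      ext s; simp [indicator]
    simp only [this]
    rw [setIntegral_indicator measurableSet_Ioi, Ioo_inter_Ioi, max_eq_right hs.1.le]

lemma integrable_inner_prod {T : ℝ} {F G : ℝ → X} (hF : Integrable F (timeMeasure T))
    (hG : Integrable G (timeMeasure T)) :
    Integrable (fun p : ℝ × ℝ => inner ℝ (F p.1) (G p.2))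
      ((timeMeasure T).prod (timeMeasure T)) :=
  (hF.norm.mul_prod hG.norm).mono' (hF.1.comp_fst.inner hG.1.comp_snd)
    (Filter.Eventually.of_forall fun _ => norm_inner_le_norm _ _)

/-- Integration by parts for primitives of integrable functions, as Fubini on a triangle. -/
lemma integral_inner_primitive [CompleteSpace X] {T : ℝ} {F G : ℝ → X}
    (hF : Integrable F (timeMeasure T)) (hG : Integrable G (timeMeasure T)) :
    ∫ t in Ioo 0 T, inner ℝ (F t) (∫ s in Ioo 0 t, G s) =
      ∫ s in Ioo 0 T, inner ℝ (∫ t in Ioo s T, F t) (G s) := by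
  have h := integral_prod_triangle (F := fun t s => inner ℝ (F t) (G s))
    (integrable_inner_prod hF hG)
  convert h using 1
  · refine setIntegral_congr_fun measurableSet_Ioo fun t ht => ?_
    have hG' : IntegrableOn G (Ioo 0 t) := IntegrableOn.mono_set hG (Ioo_subset_Ioo_right ht.2.le)
    rw [integral_inner hG']
  · refine setIntegral_congr_fun measurableSet_Ioo fun s hs => ?_
    have hF' : IntegrableOn F (Ioo s T) := IntegrableOn.mono_set hF (Ioo_subset_Ioo_left hs.1.le)
    rw [real_inner_comm, ← integral_inner hF']
    simp only [real_inner_comm]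

lemma setIntegral_Ioo_sub {E : Type*} [NormedAddCommGroup E] [NormedSpace ℝ E] {T s t : ℝ}
    {w : ℝ → E} (hw : Integrable w (timeMeasure T))
    (hs : 0 ≤ s) (hst : s ≤ t) (ht : t ≤ T) :
    ∫ r in Ioo s t, w r = (∫ r in Ioo 0 t, w r) - ∫ r in Ioo 0 s, w r := by
  have hT : IntervalIntegrable w volume 0 T := by
    rw [intervalIntegrable_iff_integrableOn_Ioo_of_le (hs.trans (hst.trans ht))]; exact hw
  have h : ∀ {a b}, 0 ≤ a → a ≤ b → b ≤ T → IntervalIntegrable w volume a b := by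
    intro a b ha hab hb
    refine hT.mono_set ?_
    rw [uIcc_of_le hab, uIcc_of_le (ha.trans (hab.trans hb))]
    exact Icc_subset_Icc ha hb
  simp only [← integral_Ioc_eq_integral_Ioo]
  rw [← intervalIntegral.integral_of_le hst, ← intervalIntegral.integral_of_le hs,
    ← intervalIntegral.integral_of_le (hs.trans hst),
    intervalIntegral.integral_interval_sub_left (h le_rfl (hs.trans hst) ht)
      (h le_rfl hs (hst.trans ht))]

lemma continuousOn_primitive_Ioo {E : Type*} [NormedAddCommGroup E] [NormedSpace ℝ E] {T : ℝ}
    {w : ℝ → E} (hw : Integrable w (timeMeasure T)) :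
    ContinuousOn (fun t => ∫ r in Ioo 0 t, w r) (Icc 0 T) := by
  have h : IntegrableOn w (Icc 0 T) := by rwa [integrableOn_Icc_iff_integrableOn_Ioo]
  simpa only [integral_Ioc_eq_integral_Ioo] using intervalIntegral.continuousOn_primitive h

lemma norm_primitive_le {E : Type*} [NormedAddCommGroup E] [NormedSpace ℝ E] {T : ℝ}
    {w : ℝ → E} (hw : Integrable w (timeMeasure T)) {t : ℝ} (ht : t ≤ T) :
    ‖∫ r in Ioo 0 t, w r‖ ≤ ∫ r in Ioo 0 T, ‖w r‖ :=
  (norm_integral_le_integral_norm _).trans (setIntegral_mono_set hw.norm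
    (Filter.Eventually.of_forall fun _ => norm_nonneg _)
    (Ioo_subset_Ioo_right ht).eventuallyLE)

lemma memLp_top_primitive {E : Type*} [NormedAddCommGroup E] [NormedSpace ℝ E] {T : ℝ}
    {w : ℝ → E} (hw : Integrable w (timeMeasure T)) :
    MemLp (fun t => ∫ r in Ioo 0 t, w r) ∞ (timeMeasure T) := by
  refine memLp_top_of_bound (((continuousOn_primitive_Ioo hw).mono
    Ioo_subset_Icc_self).aestronglyMeasurable measurableSet_Ioo) (∫ r in Ioo 0 T, ‖w r‖) ?_
  filter_upwards [ae_restrict_mem measurableSet_Ioo] with t ht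
  exact norm_primitive_le hw ht.2.le

/-- The chain rule for `⟨M W, W⟩` with `W = ∫ w` and `w` merely integrable. -/
lemma integral_inner_self_primitive [CompleteSpace X] {M : X →L[ℝ] X}
    (hM : ∀ x y, inner ℝ (M x) y = inner ℝ x (M y)) {T : ℝ} {w : ℝ → X}
    (hw : Integrable w (timeMeasure T)) :
    2 * ∫ t in Ioo 0 T, inner ℝ (M (w t)) (∫ s in Ioo 0 t, w s) =
      inner ℝ (M (∫ s in Ioo 0 T, w s)) (∫ s in Ioo 0 T, w s) := by
  have hMw : Integrable (fun t => M (w t)) (timeMeasure T) := M.integrable_comp hw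
  have h := integral_inner_primitive hMw hw
  set W : ℝ → X := fun t => ∫ s in Ioo 0 t, w s with hW
  have h3 : ∀ s ∈ Ioo 0 T, inner ℝ (∫ t in Ioo s T, M (w t)) (w s) =
      inner ℝ (M (W T)) (w s) - inner ℝ (M (w s)) (W s) := by
    intro s hs
    have hw' : IntegrableOn w (Ioo s T) := IntegrableOn.mono_set hw (Ioo_subset_Ioo_left hs.1.le)
    rw [M.integral_comp_comm hw', setIntegral_Ioo_sub hw hs.1.le hs.2.le le_rfl, map_sub,
      inner_sub_left, hM (W s), real_inner_comm (W s)]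
  rw [setIntegral_congr_fun measurableSet_Ioo h3] at h
  have hi1 : Integrable (fun s => inner ℝ (M (W T)) (w s)) (timeMeasure T) :=
    (innerSL ℝ (M (W T))).integrable_comp hw
  have hi2 : Integrable (fun s => inner ℝ (M (w s)) (W s)) (timeMeasure T) := by
    refine (hMw.norm.mul_const (∫ r in Ioo 0 T, ‖w r‖)).mono'
      (hMw.1.inner (memLp_top_primitive hw).1) ?_
    filter_upwards [ae_restrict_mem measurableSet_Ioo] with t ht
    exact (norm_inner_le_norm _ _).trans (by gcongr; exact norm_primitive_le hw ht.2.le)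
  rw [integral_sub hi1 hi2, integral_inner hw] at h
  have h4 : inner ℝ (M (W T)) (∫ s in Ioo 0 T, w s) = inner ℝ (M (W T)) (W T) := rfl
  change 2 * ∫ t in Ioo 0 T, inner ℝ (M (w t)) (W t) = inner ℝ (M (W T)) (W T)
  change ∫ t in Ioo 0 T, inner ℝ (M (w t)) (W t) = _ at h
  linarith

lemma integral_causal_kernel_shift {E : Type*} [NormedAddCommGroup E] [NormedSpace ℝ E]
    {K : ℝ → E} (hK : Integrable K) (hc : ∀ᵐ t, t < 0 → K t = 0) {T r t : ℝ}
    (hr : r ∈ Ioo 0 T) (ht : t ∈ Icc 0 T) :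
    ∫ s in Ioo 0 t, K (s - r) = ∫ s in Ioo r T, K (t - s) := by
  rw [← integral_Ioc_eq_integral_Ioo, ← integral_Ioc_eq_integral_Ioo,
    ← intervalIntegral.integral_of_le ht.1, ← intervalIntegral.integral_of_le hr.2.le,
    intervalIntegral.integral_comp_sub_right K r, intervalIntegral.integral_comp_sub_left K t]
  have hI : ∀ a b, IntervalIntegrable K volume a b := fun a b => hK.intervalIntegrable
  rw [← sub_eq_zero, zero_sub, intervalIntegral.integral_interval_sub_interval_comm' (hI _ _)
    (hI _ _)
    (hI _ _), intervalIntegral.integral_same, zero_sub, neg_eq_zero]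
  refine intervalIntegral.integral_zero_ae ?_
  filter_upwards [hc, Measure.ae_ne volume (0 : ℝ)] with x hx hx0 hmem
  refine hx (lt_of_le_of_ne (hmem.2.trans ?_) hx0)
  exact max_le (by linarith [ht.2]) (by linarith [hr.1])

lemma convOn_primitive [CompleteSpace X] {K : ℝ → X →L[ℝ] X} (hK : Integrable K)
    (hc : ∀ᵐ t, t < 0 → K t = 0) {T : ℝ} {w : ℝ → X} (hw : Integrable w (timeMeasure T))
    {t : ℝ} (ht : t ∈ Icc 0 T) :
    convOn K T (fun t => ∫ s in Ioo 0 t, w s) t = ∫ s in Ioo 0 t, convOn K T w s := by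
  have hKt : Integrable (fun s => K (t - s)) (timeMeasure T) := (hK.comp_sub_left t).restrict
  have h1 : Integrable (fun p : ℝ × ℝ => K (t - p.1) (w p.2))
      ((timeMeasure T).prod (timeMeasure T)) :=
    (hKt.norm.mul_prod hw.norm).mono'
      (isBoundedBilinearMap_apply.continuous.comp_aestronglyMeasurable (hKt.1.comp_fst.prodMk hw.1.comp_snd))
      (Filter.Eventually.of_forall fun _ => ContinuousLinearMap.le_opNorm _ _)
  have e1 : convOn K T (fun t => ∫ s in Ioo 0 t, w s) t =
      ∫ r in Ioo 0 T, ∫ s in Ioo r T, K (t - s) (w r) := by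
    rw [← integral_prod_triangle h1]
    refine setIntegral_congr_fun measurableSet_Ioo fun s hs => ?_
    simp only
    rw [ContinuousLinearMap.integral_comp_comm]
    exact IntegrableOn.mono_set hw (Ioo_subset_Ioo_right hs.2.le)
  have h2 : Integrable (fun p : ℝ × ℝ => K (p.1 - p.2) (w p.2))
      ((volume.restrict (Ioo 0 t)).prod (timeMeasure T)) :=
    (integrable_kernel_apply hK hw).mono_measure
      (Measure.prod_mono (Measure.restrict_mono (Ioo_subset_Ioo_right ht.2) le_rfl) le_rfl)
  have e2 : ∫ s in Ioo 0 t, convOn K T w s = ∫ r in Ioo 0 T, ∫ s in Ioo 0 t, K (s - r) (w r) :=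
    integral_integral_swap (f := fun s r => K (s - r) (w r)) h2
  rw [e1, e2]
  refine setIntegral_congr_fun measurableSet_Ioo fun r hr => ?_
  rw [← ContinuousLinearMap.integral_apply, ← ContinuousLinearMap.integral_apply,
    integral_causal_kernel_shift hK hc hr ht]
  · exact (hK.comp_sub_right r).restrict
  · exact (hK.comp_sub_left t).restrict

/-- A function all of whose primitives vanish is zero almost everywhere. -/
lemma ae_eq_zero_of_primitive_eq_zero {E : Type*} [NormedAddCommGroup E] [NormedSpace ℝ E]
    [CompleteSpace E] {T : ℝ} {w : ℝ → E} (hw : Integrable w (timeMeasure T))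
    (h : ∀ t ∈ Ioo 0 T, ∫ s in Ioo 0 t, w s = 0) : ∀ᵐ t ∂timeMeasure T, w t = 0 := by
  have hw' : Integrable ((Ioo 0 T).indicator w) := (integrable_indicator_iff measurableSet_Ioo).2 hw
  rw [ae_restrict_iff' measurableSet_Ioo]
  filter_upwards [LocallyIntegrable.ae_hasDerivAt_integral hw'.locallyIntegrable] with t ht htI
  have h1 := ht 0
  rw [indicator_of_mem htI] at h1
  have h2 : (fun x => ∫ s in (0 : ℝ)..x, (Ioo 0 T).indicator w s) =ᶠ[nhds t] fun _ => 0 := by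
    filter_upwards [isOpen_Ioo.mem_nhds htI] with x hx
    rw [intervalIntegral.integral_of_le hx.1.le, integral_Ioc_eq_integral_Ioo,
      setIntegral_indicator measurableSet_Ioo, inter_eq_left.2 (Ioo_subset_Ioo_right hx.2.le),
      h x hx]
  exact (h1.congr_of_eventuallyEq h2.symm).unique (hasDerivAt_const t 0)

end Primitive

/-! ### Uniqueness for the abstract evolution equation -/

section Uniqueness

variable {X : Type*} [NormedAddCommGroup X] [InnerProductSpace ℝ X]

/-- The graph of a densely defined skew-adjoint operator `A`: `(v, w) ∈ G` means that `v` is in the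
domain of `A` and `w = A v`. The second condition is the inclusion of the adjoint in `-A`. -/
structure IsSkewAdjointGraph (G : Submodule ℝ (X × X)) : Prop where
  skew : ∀ p ∈ G, ∀ q ∈ G, inner ℝ p.2 q.1 = -inner ℝ p.1 q.2
  maximal : ∀ u g : X, (∀ p ∈ G, inner ℝ u p.2 = inner ℝ g p.1) → (u, -g) ∈ G
  dense : ∀ z : X, (∀ p ∈ G, inner ℝ z p.1 = 0) → z = 0

/-- `M` is symmetric with `⟨M x, x⟩ ≥ c ‖x‖²`. -/
structure IsSymmCoercive (c : ℝ) (M : X →L[ℝ] X) : Prop where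
  pos : 0 < c
  symm : ∀ x y, inner ℝ (M x) y = inner ℝ x (M y)
  coercive : ∀ x, c * ‖x‖ ^ 2 ≤ inner ℝ (M x) x

/-- Two bounded functionals that agree on each element of a separable set almost everywhere
agree almost everywhere on the whole set. -/
lemma ae_forall_mem_inner_eq [SecondCountableTopology X] {μ : Measure ℝ} (G : Set (X × X))
    {a b : ℝ → X} (h : ∀ p ∈ G, ∀ᵐ t ∂μ, inner ℝ (a t) p.1 = inner ℝ (b t) p.2) :
    ∀ᵐ t ∂μ, ∀ p ∈ G, inner ℝ (a t) p.1 = inner ℝ (b t) p.2 := by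
  obtain ⟨D, hDc, hD⟩ := TopologicalSpace.exists_countable_dense G
  have h1 : ∀ᵐ t ∂μ, ∀ p ∈ D, inner ℝ (a t) p.1.1 = inner ℝ (b t) p.1.2 :=
    (ae_ball_iff hDc).2 fun p _ => h p.1 p.2
  filter_upwards [h1] with t ht
  have hcl : IsClosed {p : G | inner ℝ (a t) p.1.1 = inner ℝ (b t) p.1.2} :=
    isClosed_eq (by fun_prop) (by fun_prop)
  intro p hp
  exact (hcl.closure_subset_iff.2 (fun q hq => ht q hq)) (hD ⟨p, hp⟩)

/-- Uniqueness of integrable solutions of `⟨M w, v⟩' + ⟨K ⋆ w, v⟩ = ⟨w, A v⟩`, `w(0) = 0`. The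
primitive `W` of `w` lies in the domain of `A`, so that the skew-adjointness of `A` gives the
energy identity for `W`, whereas `w` itself is not regular enough to be used as a test function. -/
theorem eq_zero_of_integrated_equation [CompleteSpace X] [SecondCountableTopology X]
    {G : Submodule ℝ (X × X)} (hG : IsSkewAdjointGraph G) {c : ℝ} {M : X →L[ℝ] X}
    (hM : IsSymmCoercive c M) {K : ℝ → X →L[ℝ] X} (hK : Integrable K)
    (hc : ∀ᵐ t, t < 0 → K t = 0) {T : ℝ} (hpos : IsPositiveKernel K T) {w : ℝ → X}
    (hw : Integrable w (timeMeasure T))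
    (heq : ∀ p ∈ G, ∀ᵐ t ∂timeMeasure T, inner ℝ (M (w t)) p.1 =
      ∫ s in Ioo 0 t, (inner ℝ (w s) p.2 - inner ℝ (convOn K T w s) p.1)) :
    ∀ᵐ t ∂timeMeasure T, w t = 0 := by
  set W : ℝ → X := fun t => ∫ s in Ioo 0 t, w s with hW
  have hWm : MemLp W ∞ (timeMeasure T) := memLp_top_primitive hw
  have hcw := integrable_convOn hK hw
  -- convolution commutes with taking primitives, so this is the weak form of `M w + K ⋆ W = -A W`
  have h1 : ∀ᵐ t ∂timeMeasure T, ∀ p ∈ (G : Set (X × X)),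
      inner ℝ (M (w t) + convOn K T W t) p.1 = inner ℝ (W t) p.2 := by
    refine ae_forall_mem_inner_eq _ fun p hp => ?_
    filter_upwards [heq p hp, ae_restrict_mem measurableSet_Ioo] with t ht htI
    have hI1 : IntegrableOn w (Ioo 0 t) := IntegrableOn.mono_set hw (Ioo_subset_Ioo_right htI.2.le)
    have hI2 : IntegrableOn (convOn K T w) (Ioo 0 t) :=
      IntegrableOn.mono_set hcw (Ioo_subset_Ioo_right htI.2.le)
    rw [inner_add_left, ht, convOn_primitive hK hc hw ⟨htI.1.le, htI.2.le⟩, integral_sub,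
      real_inner_comm p.1, ← integral_inner hI2, real_inner_comm p.2, ← integral_inner hI1]
    · simp only [real_inner_comm]
      ring
    · exact hI1.inner_const p.2
    · exact hI2.inner_const p.1
  have h2 : ∀ᵐ t ∂timeMeasure T, inner ℝ (M (w t)) (W t) = -inner ℝ (convOn K T W t) (W t) := by
    filter_upwards [h1] with t ht
    -- maximality puts `W t` into the domain of `A`, and then `⟨A (W t), W t⟩ = 0`
    have h3 := hG.maximal (W t) _ fun p hp => (ht p hp).symm
    have h4 := hG.skew _ h3 _ h3
    simp only [inner_neg_right, inner_add_right,
      real_inner_comm (W t)] at h4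
    linarith [real_inner_comm (W t) (M (w t)), real_inner_comm (W t) (convOn K T W t)]
  refine ae_eq_zero_of_primitive_eq_zero hw fun τ hτ => ?_
  have hle : timeMeasure τ ≤ timeMeasure T :=
    Measure.restrict_mono (Ioo_subset_Ioo_right hτ.2.le) le_rfl
  have h5 := integral_inner_self_primitive hM.symm (hw.mono_measure hle)
  have h6 : ∫ t in Ioo 0 τ, inner ℝ (M (w t)) (W t) =
      -∫ t in Ioo 0 τ, inner ℝ (convOn K T W t) (W t) := by
    rw [← integral_neg]
    exact integral_congr_ae (ae_mono hle h2)
  -- hence `⟨M (W τ), W τ⟩ = -2 ∫ ⟨K ⋆ W, W⟩ ≤ 0`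
  have h7 := hpos.setIntegral_nonneg hK hc hWm hτ.2.le
  have h8 := hM.coercive (W τ)
  have h9 : ‖W τ‖ ^ 2 ≤ 0 := by
    have : c * ‖W τ‖ ^ 2 ≤ 0 := by
      calc c * ‖W τ‖ ^ 2 ≤ _ := h8
        _ = 2 * ∫ t in Ioo 0 τ, inner ℝ (M (w t)) (W t) := h5.symm
        _ ≤ 0 := by rw [h6]; linarith
    have hcp := hM.pos
    by_contra hcon
    push Not at hcon
    have := mul_pos hcp hcon
    linarith
  exact norm_eq_zero.1 (pow_eq_zero_iff two_ne_zero |>.1 (le_antisymm h9 (sq_nonneg _)))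

end Uniqueness

/-! ### Regular functions and the energy estimate -/

section Regular

variable {X : Type*} [NormedAddCommGroup X] [InnerProductSpace ℝ X]

/-- Regular functions: `u` is continuously differentiable with derivative `u'`, takes values in the
domain of the operator with graph `G`, and `z = A u` is continuous. -/
structure IsRegular (G : Submodule ℝ (X × X)) (u u' z : ℝ → X) : Prop where
  hasDerivAt : ∀ t, HasDerivAt u (u' t) t
  continuous_deriv : Continuous u'
  mem : ∀ t, (u t, z t) ∈ G
  continuous_image : Continuous z

/-- The source term `M u' + K ⋆ u + A u` produced by a regular function. The sign of `A u` is the one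
belonging to the weak formulation, in which the operator appears as `⟨u, A v⟩ = -⟨A u, v⟩`. -/
def forcing (M : X →L[ℝ] X) (K : ℝ → X →L[ℝ] X) (T : ℝ) (u u' z : ℝ → X) (t : ℝ) : X :=
  M (u' t) + convOn K T u t + z t

lemma memLp_top_of_continuous {E : Type*} [NormedAddCommGroup E] {u : ℝ → E}
    (hu : Continuous u) (T : ℝ) : MemLp u ∞ (timeMeasure T) := by
  obtain ⟨C, hC⟩ := (isCompact_Icc (a := (0 : ℝ)) (b := T)).exists_bound_of_continuousOn
    hu.continuousOn
  refine memLp_top_of_bound hu.aestronglyMeasurable C ?_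
  filter_upwards [ae_restrict_mem measurableSet_Ioo] with t ht
  exact hC t (Ioo_subset_Icc_self ht)

variable {G : Submodule ℝ (X × X)} {u u' z : ℝ → X}

lemma IsRegular.continuous (h : IsRegular G u u' z) : Continuous u :=
  continuous_iff_continuousAt.2 fun t => (h.hasDerivAt t).continuousAt

lemma IsRegular.add {v v' y : ℝ → X} (h : IsRegular G u u' z) (h' : IsRegular G v v' y) :
    IsRegular G (fun t => u t + v t) (fun t => u' t + v' t) (fun t => z t + y t) where
  hasDerivAt t := (h.hasDerivAt t).add (h'.hasDerivAt t)
  continuous_deriv := h.continuous_deriv.add h'.continuous_deriv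
  mem t := G.add_mem (h.mem t) (h'.mem t)
  continuous_image := h.continuous_image.add h'.continuous_image

lemma IsRegular.smul (r : ℝ) (h : IsRegular G u u' z) :
    IsRegular G (fun t => r • u t) (fun t => r • u' t) (fun t => r • z t) where
  hasDerivAt t := (h.hasDerivAt t).const_smul r
  continuous_deriv := h.continuous_deriv.const_smul r
  mem t := G.smul_mem r (h.mem t)
  continuous_image := h.continuous_image.const_smul r

lemma IsRegular.sub {v v' y : ℝ → X} (h : IsRegular G u u' z) (h' : IsRegular G v v' y) :
    IsRegular G (fun t => u t - v t) (fun t => u' t - v' t) (fun t => z t - y t) where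
  hasDerivAt t := (h.hasDerivAt t).sub (h'.hasDerivAt t)
  continuous_deriv := h.continuous_deriv.sub h'.continuous_deriv
  mem t := G.sub_mem (h.mem t) (h'.mem t)
  continuous_image := h.continuous_image.sub h'.continuous_image

lemma isRegular_smul_const {φ χ : ℝ → ℝ} (hφ : ∀ t, HasDerivAt φ (χ t) t) (hχ : Continuous χ)
    {p : X × X} (hp : p ∈ G) :
    IsRegular G (fun t => φ t • p.1) (fun t => χ t • p.1) (fun t => φ t • p.2) where
  hasDerivAt t := (hφ t).smul_const p.1
  continuous_deriv := hχ.smul continuous_const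
  mem t := G.smul_mem (φ t) hp
  continuous_image :=
    (continuous_iff_continuousAt.2 fun t => (hφ t).continuousAt).smul continuous_const

variable {M : X →L[ℝ] X} {K : ℝ → X →L[ℝ] X} {T : ℝ}

lemma IsRegular.memLp_top_forcing (h : IsRegular G u u' z) (hK : Integrable K) :
    MemLp (forcing M K T u u' z) ∞ (timeMeasure T) :=
  ((memLp_top_of_continuous (M.continuous.comp h.continuous_deriv) T).add
    (memLp_top_convOn hK (memLp_top_of_continuous h.continuous T))).add
    (memLp_top_of_continuous h.continuous_image T)

lemma IsRegular.integrable_forcing (h : IsRegular G u u' z) (hK : Integrable K) :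
    Integrable (forcing M K T u u' z) (timeMeasure T) :=
  (h.memLp_top_forcing hK).integrable le_top

lemma IsRegular.forcing_sub {v v' y : ℝ → X} (h : IsRegular G u u' z) (h' : IsRegular G v v' y)
    (hK : Integrable K) (t : ℝ) :
    forcing M K T (fun t => u t - v t) (fun t => u' t - v' t) (fun t => z t - y t) t =
      forcing M K T u u' z t - forcing M K T v v' y t := by
  simp only [forcing, map_sub, convOn_sub hK (memLp_top_of_continuous h.continuous T)
    (memLp_top_of_continuous h'.continuous T)]
  abel

lemma IsRegular.forcing_add {v v' y : ℝ → X} (h : IsRegular G u u' z) (h' : IsRegular G v v' y)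
    (hK : Integrable K) (t : ℝ) :
    forcing M K T (fun t => u t + v t) (fun t => u' t + v' t) (fun t => z t + y t) t =
      forcing M K T u u' z t + forcing M K T v v' y t := by
  simp only [forcing, map_add, convOn_add hK (memLp_top_of_continuous h.continuous T)
    (memLp_top_of_continuous h'.continuous T)]
  abel

lemma forcing_smul (r t : ℝ) :
    forcing M K T (fun t => r • u t) (fun t => r • u' t) (fun t => r • z t) t =
      r • forcing M K T u u' z t := by
  simp only [forcing, map_smul, convOn_smul, smul_add]

/-- The energy inequality in quadratic form, from the passivity of the kernel and the
skew-symmetry of the operator. -/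
lemma IsRegular.energy_le [CompleteSpace X] (h : IsRegular G u u' z)
    (hG : IsSkewAdjointGraph G) {c : ℝ}
    (hM : IsSymmCoercive c M) (hK : Integrable K) (hc : ∀ᵐ t, t < 0 → K t = 0)
    (hpos : IsPositiveKernel K T) {σ : ℝ} (hσ : σ ∈ Icc 0 T) :
    inner ℝ (M (u σ)) (u σ) ≤ inner ℝ (M (u 0)) (u 0) +
      2 * ∫ t in Ioo 0 σ, ‖forcing M K T u u' z t‖ * ‖u t‖ := by
  have hle : timeMeasure σ ≤ timeMeasure T :=
    Measure.restrict_mono (Ioo_subset_Ioo_right hσ.2) le_rfl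
  have hd : ∀ t, HasDerivAt (fun t => inner ℝ (M (u t)) (u t))
      (2 * inner ℝ (M (u' t)) (u t)) t := by
    intro t
    have h1 := (M.hasFDerivAt.comp_hasDerivAt t (h.hasDerivAt t)).inner ℝ (h.hasDerivAt t)
    refine h1.congr_deriv ?_
    simp only [Function.comp_apply]
    rw [hM.symm (u t), real_inner_comm (M (u' t)) (u t)]
    ring
  have hcont : Continuous fun t => inner ℝ (M (u' t)) (u t) :=
    (M.continuous.comp h.continuous_deriv).inner h.continuous
  have h1 := intervalIntegral.integral_eq_sub_of_hasDerivAt (a := 0) (b := σ) (fun t _ => hd t)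
    ((hcont.const_mul 2).intervalIntegrable _ _)
  rw [intervalIntegral.integral_of_le hσ.1, integral_Ioc_eq_integral_Ioo, integral_const_mul] at h1
  have hum := memLp_top_of_continuous h.continuous T
  have hKu := integrable_convOn hK (hum.integrable le_top)
  have hz : ∀ t, inner ℝ (z t) (u t) = 0 := by
    intro t
    have h2 := hG.skew _ (h.mem t) _ (h.mem t)
    simp only at h2
    rw [real_inner_comm] at h2
    linarith [real_inner_comm (z t) (u t)]
  have hF := h.memLp_top_forcing (M := M) (T := T) hK
  have hi1 : Integrable (fun t => inner ℝ (forcing M K T u u' z t) (u t)) (timeMeasure σ) := by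
    refine Integrable.mono_measure ?_ hle
    refine ((hF.integrable le_top).norm.mul_const (lpNorm u ∞ (timeMeasure T))).mono'
      (hF.1.inner hum.1) ?_
    filter_upwards [ae_le_lpNorm_exponent_top hum] with t ht
    exact (norm_inner_le_norm _ _).trans (by gcongr)
  have hi2 : Integrable (fun t => inner ℝ (convOn K T u t) (u t)) (timeMeasure σ) := by
    refine Integrable.mono_measure ?_ hle
    refine (hKu.norm.mul_const (lpNorm u ∞ (timeMeasure T))).mono' (hKu.1.inner hum.1) ?_
    filter_upwards [ae_le_lpNorm_exponent_top hum] with t ht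
    exact (norm_inner_le_norm _ _).trans (by gcongr)
  have h3 : ∫ t in Ioo 0 σ, inner ℝ (M (u' t)) (u t) =
      (∫ t in Ioo 0 σ, inner ℝ (forcing M K T u u' z t) (u t)) -
        ∫ t in Ioo 0 σ, inner ℝ (convOn K T u t) (u t) := by
    rw [← integral_sub hi1 hi2]
    refine integral_congr_ae (Filter.Eventually.of_forall fun t => ?_)
    simp only [forcing, inner_add_left, hz]
    ring
  have h4 := hpos.setIntegral_nonneg hK hc hum hσ.2
  have hi3 : Integrable (fun t => ‖forcing M K T u u' z t‖ * ‖u t‖) (timeMeasure σ) := by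
    refine Integrable.mono_measure ?_ hle
    refine ((hF.integrable le_top).norm.mul_const (lpNorm u ∞ (timeMeasure T))).mono'
      (hF.1.norm.mul hum.1.norm) ?_
    filter_upwards [ae_le_lpNorm_exponent_top hum] with t ht
    rw [Real.norm_of_nonneg (by positivity)]
    gcongr
  have h5 : ∫ t in Ioo 0 σ, inner ℝ (forcing M K T u u' z t) (u t) ≤
      ∫ t in Ioo 0 σ, ‖forcing M K T u u' z t‖ * ‖u t‖ :=
    integral_mono hi1 hi3 fun t => real_inner_le_norm _ _
  linarith

/-- The a priori estimate for regular functions. The energy inequality is used at a time where the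
energy is maximal; this gives the constant `2 / √c`. -/
lemma IsRegular.sqrt_energy_le [CompleteSpace X] (h : IsRegular G u u' z)
    (hG : IsSkewAdjointGraph G) {c : ℝ}
    (hM : IsSymmCoercive c M) (hK : Integrable K) (hc : ∀ᵐ t, t < 0 → K t = 0)
    (hpos : IsPositiveKernel K T) {τ : ℝ} (hτ : τ ∈ Icc 0 T) :
    √(inner ℝ (M (u τ)) (u τ)) ≤ √(inner ℝ (M (u 0)) (u 0)) +
      2 / √c * ∫ t in Ioo 0 τ, ‖forcing M K T u u' z t‖ := by
  have hE : Continuous fun t => inner ℝ (M (u t)) (u t) :=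
    (M.continuous.comp h.continuous).inner h.continuous
  have hE0 : ∀ t, 0 ≤ inner ℝ (M (u t)) (u t) := fun t =>
    (mul_nonneg hM.pos.le (sq_nonneg _)).trans (hM.coercive (u t))
  obtain ⟨σ, hσ, hmax⟩ := isCompact_Icc.exists_isMaxOn (nonempty_Icc.2 hτ.1) hE.continuousOn
  set m := √(inner ℝ (M (u σ)) (u σ)) with hm
  set B := ∫ t in Ioo 0 τ, ‖forcing M K T u u' z t‖ with hB
  set y := √(inner ℝ (M (u 0)) (u 0)) with hy
  have hcs : 0 < √c := Real.sqrt_pos.2 hM.pos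
  have hF := (h.integrable_forcing (M := M) (T := T) hK).norm
  have hFτ : IntegrableOn (fun t => ‖forcing M K T u u' z t‖) (Ioo 0 τ) :=
    IntegrableOn.mono_set hF (Ioo_subset_Ioo_right hτ.2)
  have hu : ∀ t ∈ Ioo 0 σ, ‖u t‖ ≤ m / √c := by
    intro t ht
    rw [le_div_iff₀ hcs, hm]
    refine Real.le_sqrt_of_sq_le ?_
    rw [mul_pow, Real.sq_sqrt hM.pos.le, mul_comm]
    exact (hM.coercive (u t)).trans (hmax ⟨ht.1.le, ht.2.le.trans hσ.2⟩)
  have h1 := h.energy_le hG hM hK hc hpos (σ := σ) ⟨hσ.1, hσ.2.trans hτ.2⟩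
  have h2 : ∫ t in Ioo 0 σ, ‖forcing M K T u u' z t‖ * ‖u t‖ ≤ B * (m / √c) := by
    calc ∫ t in Ioo 0 σ, ‖forcing M K T u u' z t‖ * ‖u t‖
        ≤ ∫ t in Ioo 0 σ, ‖forcing M K T u u' z t‖ * (m / √c) := by
          refine integral_mono_of_nonneg (Filter.Eventually.of_forall fun t => by positivity)
            ((hFτ.mono_set (Ioo_subset_Ioo_right hσ.2)).mul_const _) ?_
          filter_upwards [ae_restrict_mem measurableSet_Ioo] with t ht
          exact mul_le_mul_of_nonneg_left (hu t ht) (norm_nonneg _)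
      _ = (∫ t in Ioo 0 σ, ‖forcing M K T u u' z t‖) * (m / √c) := integral_mul_const _ _
      _ ≤ B * (m / √c) := by
          refine mul_le_mul_of_nonneg_right ?_ (by positivity)
          exact setIntegral_mono_set hFτ (Filter.Eventually.of_forall fun t => norm_nonneg _)
            (Ioo_subset_Ioo_right hσ.2).eventuallyLE
  have hB0 : 0 ≤ B / √c := div_nonneg (integral_nonneg fun t => norm_nonneg _) hcs.le
  have hm2 : m ^ 2 = inner ℝ (M (u σ)) (u σ) := Real.sq_sqrt (hE0 σ)
  have hy2 : y ^ 2 = inner ℝ (M (u 0)) (u 0) := Real.sq_sqrt (hE0 0)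
  have hy0 : 0 ≤ y := Real.sqrt_nonneg _
  have hm0 : 0 ≤ m := Real.sqrt_nonneg _
  -- the energy inequality at the maximum is quadratic in `m`
  have h3 : m ^ 2 ≤ y ^ 2 + 2 * m * (B / √c) := by
    rw [hm2, hy2]
    calc _ ≤ _ := h1
      _ ≤ inner ℝ (M (u 0)) (u 0) + 2 * (B * (m / √c)) := by gcongr
      _ = _ := by ring
  have h4 : m ≤ y + 2 / √c * B := by
    rw [show 2 / √c * B = 2 * (B / √c) by ring]
    by_contra hcon
    push Not at hcon
    nlinarith
  exact (Real.sqrt_le_sqrt (hmax ⟨hτ.1, le_rfl⟩)).trans h4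

/-- Regular functions satisfy the weak form of the equation with their forcing. -/
lemma IsRegular.weak_equation (h : IsRegular G u u' z) (hG : IsSkewAdjointGraph G)
    (hK : Integrable K) {p : X × X} (hp : p ∈ G) (hT : 0 < T)
    {φ : ℝ → ℝ} (hφ : ContDiff ℝ ∞ φ) (hφT : tsupport φ ⊆ Ioo 0 T) :
    -(∫ t in Ioo 0 T, deriv φ t * inner ℝ (M (u t)) p.1)
        + ∫ t in Ioo 0 T, φ t * inner ℝ (convOn K T u t) p.1
      = ∫ t in Ioo 0 T, φ t * (inner ℝ (u t) p.2 + inner ℝ (forcing M K T u u' z t) p.1) := by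
  have hφd : ∀ t, HasDerivAt φ (deriv φ t) t := fun t =>
    ((hφ.differentiable (by simp)) t).hasDerivAt
  have hφ' : Continuous (deriv φ) := hφ.continuous_deriv (by simp)
  have hd : ∀ t, HasDerivAt (fun t => φ t * inner ℝ (M (u t)) p.1)
      (deriv φ t * inner ℝ (M (u t)) p.1 + φ t * inner ℝ (M (u' t)) p.1) t := by
    intro t
    have h1 := (M.hasFDerivAt.comp_hasDerivAt t (h.hasDerivAt t)).inner ℝ (hasDerivAt_const t p.1)
    refine ((hφd t).mul h1).congr_deriv ?_
    simp
  have hu1 : Continuous fun t => inner ℝ (M (u t)) p.1 :=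
    (M.continuous.comp h.continuous).inner continuous_const
  have hu2 : Continuous fun t => inner ℝ (M (u' t)) p.1 :=
    (M.continuous.comp h.continuous_deriv).inner continuous_const
  have hz : Continuous fun t => inner ℝ (u t) p.2 + inner ℝ (z t) p.1 :=
    (h.continuous.inner continuous_const).add (h.continuous_image.inner continuous_const)
  have h0 : φ 0 = 0 := by
    by_contra hne
    exact lt_irrefl _ (hφT (subset_tsupport φ hne)).1
  have h0T : φ T = 0 := by
    by_contra hne
    exact lt_irrefl _ (hφT (subset_tsupport φ hne)).2
  have hint : ∀ g : ℝ → ℝ, Continuous g → Integrable g (timeMeasure T) := fun g hg =>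
    (memLp_top_of_continuous hg T).integrable le_top
  have hc1 : Continuous fun t => deriv φ t * inner ℝ (M (u t)) p.1 := hφ'.mul hu1
  have hc2 : Continuous fun t => φ t * inner ℝ (M (u' t)) p.1 := hφ.continuous.mul hu2
  have h1 := intervalIntegral.integral_eq_sub_of_hasDerivAt (a := 0) (b := T) (fun t _ => hd t)
    ((hc1.add hc2).intervalIntegrable _ _)
  rw [intervalIntegral.integral_of_le hT.le, integral_Ioc_eq_integral_Ioo,
    integral_add (hint _ hc1) (hint _ hc2), h0, h0T] at h1
  have hconv : Integrable (fun t => φ t * inner ℝ (convOn K T u t) p.1) (timeMeasure T) := by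
    have hm := memLp_top_convOn (T := T) hK (memLp_top_of_continuous h.continuous T)
    exact ((memLp_top_of_continuous hφ.continuous T).integrable le_top).mul_of_top_left
      (hm.inner_const p.1)
  have h2 : ∀ t, φ t * (inner ℝ (u t) p.2 + inner ℝ (forcing M K T u u' z t) p.1) =
      φ t * inner ℝ (M (u' t)) p.1 + φ t * inner ℝ (convOn K T u t) p.1 := by
    intro t
    have h3 := hG.skew _ (h.mem t) _ hp
    simp only at h3
    simp only [forcing, inner_add_left]
    rw [h3]
    ring
  simp only [h2]
  rw [integral_add (hint _ hc2) hconv]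
  linarith

end Regular

/-! ### Triviality of functionals vanishing on regular data -/

section Density

variable {X : Type*} [NormedAddCommGroup X] [InnerProductSpace ℝ X]

/-- The graph of `-A`. -/
def negGraph (G : Submodule ℝ (X × X)) : Submodule ℝ (X × X) :=
  G.comap (LinearMap.prodMap LinearMap.id (-LinearMap.id))

lemma mem_negGraph {G : Submodule ℝ (X × X)} {p : X × X} : p ∈ negGraph G ↔ (p.1, -p.2) ∈ G :=
  Iff.rfl

lemma IsSkewAdjointGraph.neg {G : Submodule ℝ (X × X)} (hG : IsSkewAdjointGraph G) :
    IsSkewAdjointGraph (negGraph G) where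
  skew p hp q hq := by
    have h := hG.skew _ hp _ hq
    simp only [LinearMap.prodMap_apply, LinearMap.id_apply, LinearMap.neg_apply, inner_neg_left,
      inner_neg_right, neg_neg] at h
    linarith
  maximal u g h := by
    rw [mem_negGraph, neg_neg]
    have h1 := hG.maximal u (-g) fun p hp => by
      have h2 := h (p.1, -p.2) (by rw [mem_negGraph]; simpa using hp)
      simp only [inner_neg_right] at h2
      rw [inner_neg_left, ← h2, neg_neg]
    simpa using h1
  dense w h := hG.dense w fun p hp => h (p.1, -p.2) (by rw [mem_negGraph]; simpa using hp)

variable {K : ℝ → X →L[ℝ] X} {T : ℝ}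

lemma integral_timeReflection {E : Type*} [NormedAddCommGroup E] [NormedSpace ℝ E] (T : ℝ)
    (F : ℝ → E) : ∫ t in Ioo 0 T, F (T - t) = ∫ t in Ioo 0 T, F t :=
  (measurePreserving_timeReflection T).integral_comp
    (MeasurableEquiv.subLeft T).measurableEmbedding F

lemma integrable_timeReflection {E : Type*} [NormedAddCommGroup E] {F : ℝ → E}
    (hF : Integrable F (timeMeasure T)) : Integrable (fun t => F (T - t)) (timeMeasure T) :=
  (measurePreserving_timeReflection T).integrable_comp_of_integrable hF

/-- The adjoint of the convolution with `K` is, up to time reflection, the convolution with the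
adjoint kernel. -/
lemma integral_inner_convOn_eq_adjoint [CompleteSpace X] {K' : ℝ → X →L[ℝ] X}
    (hadj : ∀ t x y, inner ℝ (K' t x) y = inner ℝ x (K t y)) (hK : Integrable K)
    (hK' : Integrable K') {a g : ℝ → X}
    (ha : MemLp a ∞ (timeMeasure T)) (hg : Integrable g (timeMeasure T)) :
    ∫ t in Ioo 0 T, inner ℝ (convOn K T a t) (g t) =
      ∫ t in Ioo 0 T, inner ℝ (convOn K' T (fun s => g (T - s)) t) (a (T - t)) := by
  have hh : Integrable (fun t => g (T - t)) (timeMeasure T) := integrable_timeReflection hg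
  have ha' : MemLp (fun t => a (T - t)) ∞ (timeMeasure T) :=
    ha.comp_measurePreserving (measurePreserving_timeReflection T)
  have e1 := integral_inner_convOn hK (ha.integrable le_top)
    (integrable_kernel_inner_of_bdd_left hK ha hg)
  have e2 := integral_inner_convOn hK' hh (integrable_kernel_inner_of_bdd_right hK' hh ha')
  have e3 := integral_prod_timeReflection T
    (fun p : ℝ × ℝ => (inner ℝ (K (p.1 - p.2) (a p.2)) (g p.1) : ℝ))
  refine e1.trans (Eq.trans ?_ e2.symm)
  rw [← e3]
  refine integral_congr_ae (Filter.Eventually.of_forall fun p => ?_)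
  have e : T - p.2 - (T - p.1) = p.1 - p.2 := by ring
  simp only [e]
  rw [hadj, real_inner_comm]

/-- A pair `(p₀, g)` that annihilates the data of all functions `φ(t) v` vanishes: the time
reflection of `g` is an integrable solution of the homogeneous adjoint problem. -/
theorem eq_zero_of_orthogonal_regular [CompleteSpace X] [SecondCountableTopology X]
    {G : Submodule ℝ (X × X)} (hG : IsSkewAdjointGraph G) {c : ℝ} {M : X →L[ℝ] X}
    (hM : IsSymmCoercive c M) (hK : Integrable K)
    (hc : ∀ᵐ t, t < 0 → K t = 0) (hpos : IsPositiveKernel K T)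
    {p₀ : X} {g : ℝ → X} (hg : Integrable g (timeMeasure T))
    (h : ∀ p ∈ G, ∀ φ χ : ℝ → ℝ, (∀ t, HasDerivAt φ (χ t) t) → Continuous χ →
      inner ℝ (φ 0 • p.1) p₀ + ∫ t in Ioo 0 T, inner ℝ (forcing M K T (fun t => φ t • p.1)
        (fun t => χ t • p.1) (fun t => φ t • p.2) t) (g t) = 0) :
    p₀ = 0 ∧ ∀ᵐ t ∂timeMeasure T, g t = 0 := by
  have hg0 : ∀ᵐ t ∂timeMeasure T, g t = 0 := by
    set w : ℝ → X := fun t => g (T - t) with hw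
    have hwi : Integrable w (timeMeasure T) := integrable_timeReflection hg
    set K' : ℝ → X →L[ℝ] X := fun t => ContinuousLinearMap.adjoint (K t) with hK'
    have hK'i : Integrable K' := Integrable.adjoint_kernel hK
    have hadj : ∀ t x y, inner ℝ (K' t x) y = inner ℝ x (K t y) := fun t x y =>
      ContinuousLinearMap.adjoint_inner_left _ _ _
    have hcw := integrable_convOn hK'i hwi
    have hw0 : ∀ᵐ t ∂timeMeasure T, w t = 0 := by
      refine eq_zero_of_integrated_equation hG.neg hM hK'i
        (by filter_upwards [hc] with t ht h0; simp [hK', ht h0]) hpos.adjoint hwi ?_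
      intro p hp
      rw [mem_negGraph] at hp
      set κ : ℝ → ℝ := fun s => inner ℝ (w s) p.2 - inner ℝ (convOn K' T w s) p.1 with hκ
      have hκi : Integrable κ (timeMeasure T) := (hwi.inner_const _).sub (hcw.inner_const _)
      have hMw : Integrable (fun t => inner ℝ (M (w t)) p.1) (timeMeasure T) :=
        (M.integrable_comp hwi).inner_const _
      have hprim := (memLp_top_primitive hκi).integrable le_top
      -- for given `θ`, test with the function whose derivative is the time reflection of `θ`
      have key : ∀ θ : ℝ → ℝ, Continuous θ →
          ∫ t in Ioo 0 T, θ t * (inner ℝ (M (w t)) p.1 - ∫ s in Ioo 0 t, κ s) = 0 := by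
        intro θ hθ
        set χ : ℝ → ℝ := fun t => θ (T - t) with hχ
        have hχc : Continuous χ := by fun_prop
        set φ : ℝ → ℝ := fun t => ∫ s in (0 : ℝ)..t, χ s with hφ
        have hφd : ∀ t, HasDerivAt φ (χ t) t := fun t =>
          intervalIntegral.integral_hasDerivAt_right (hχc.intervalIntegrable _ _)
            (hχc.stronglyMeasurableAtFilter _ _) hχc.continuousAt
        have hφc : Continuous φ := continuous_iff_continuousAt.2 fun t => (hφd t).continuousAt
        have hφT : ∀ t ∈ Ioo 0 T, φ (T - t) = ∫ s in Ioo t T, θ s := by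
          intro t ht
          rw [hφ]
          simp only [hχ]
          rw [intervalIntegral.integral_comp_sub_left (fun s => θ s) T]
          simp only [sub_sub_cancel, sub_zero]
          rw [intervalIntegral.integral_of_le ht.2.le, integral_Ioc_eq_integral_Ioo]
        have h1 := h _ hp φ χ hφd hχc
        have hφv : MemLp (fun t => φ t • p.1) ∞ (timeMeasure T) :=
          memLp_top_of_continuous (hφc.smul continuous_const) T
        have hθi : Integrable θ (timeMeasure T) := (memLp_top_of_continuous hθ T).integrable le_top
        have hbd : ∀ (f : ℝ → ℝ) (k : ℝ → ℝ), Continuous f → Integrable k (timeMeasure T) →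
            Integrable (fun t => f t * k t) (timeMeasure T) := fun f k hf hk =>
          hk.mul_of_top_right (memLp_top_of_continuous hf T)
        have hφ0 : φ 0 = 0 := by simp [hφ]
        rw [hφ0, zero_smul, inner_zero_left, zero_add] at h1
        have hconv : Integrable (fun t => inner ℝ (convOn K T (fun t => φ t • p.1) t) (g t))
            (timeMeasure T) := by
          refine (hg.norm.const_mul
            (lpNorm (convOn K T fun t => φ t • p.1) ∞ (timeMeasure T))).mono' (
              (memLp_top_convOn hK hφv).1.inner hg.1) ?_
          filter_upwards [ae_le_lpNorm_exponent_top (memLp_top_convOn hK hφv)] with t ht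
          exact (norm_inner_le_norm _ _).trans (by gcongr)
        have hi1 : Integrable (fun t => χ t * inner ℝ (M p.1) (g t)) (timeMeasure T) :=
          hbd _ _ hχc (hg.const_inner _)
        have hi3 : Integrable (fun t => φ t * inner ℝ p.2 (g t)) (timeMeasure T) :=
          hbd _ _ hφc (hg.const_inner _)
        have h2 : (∫ t in Ioo 0 T, χ t * inner ℝ (M p.1) (g t)) +
            (∫ t in Ioo 0 T, inner ℝ (convOn K T (fun t => φ t • p.1) t) (g t)) -
            ∫ t in Ioo 0 T, φ t * inner ℝ p.2 (g t) = 0 := by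
          have hi2 : Integrable (fun t => χ t * inner ℝ (M p.1) (g t) +
              inner ℝ (convOn K T (fun t => φ t • p.1) t) (g t)) (timeMeasure T) := hi1.add hconv
          rw [← integral_add hi1 hconv, ← integral_sub hi2 hi3]
          refine Eq.trans ?_ h1
          refine integral_congr_ae (Filter.Eventually.of_forall fun t => ?_)
          simp only [forcing, map_smul, inner_add_left, real_inner_smul_left,
            smul_neg, inner_neg_left]
          ring
        rw [integral_inner_convOn_eq_adjoint hadj hK hK'i hφv hg,
          ← integral_timeReflection T (fun t => χ t * inner ℝ (M p.1) (g t)),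
          ← integral_timeReflection T (fun t => φ t * inner ℝ p.2 (g t))] at h2
        have hφr : Continuous fun t => φ (T - t) := by fun_prop
        have h3 : ∫ t in Ioo 0 T, φ (T - t) * κ t = ∫ t in Ioo 0 T, θ t * ∫ s in Ioo 0 t, κ s := by
          have h4 := integral_inner_primitive (X := ℝ) hθi hκi
          simp only [RCLike.inner_apply, conj_trivial] at h4
          simp only [mul_comm (θ _), h4]
          refine setIntegral_congr_fun measurableSet_Ioo fun t ht => ?_
          simp only [hφT t ht, mul_comm (κ t)]
        have hj1 : Integrable (fun t => θ t * inner ℝ (M (w t)) p.1) (timeMeasure T) :=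
          hbd _ _ hθ hMw
        have hj2 : Integrable (fun t => φ (T - t) * inner ℝ (convOn K' T w t) p.1)
            (timeMeasure T) := hbd _ _ hφr (hcw.inner_const _)
        have hj3 : Integrable (fun t => φ (T - t) * inner ℝ (w t) p.2) (timeMeasure T) :=
          hbd _ _ hφr (hwi.inner_const _)
        simp only [mul_sub]
        rw [integral_sub hj1 (hbd _ _ hθ hprim), ← h3]
        refine Eq.trans ?_ h2
        simp only [hκ, mul_sub]
        rw [integral_sub hj3 hj2]
        have e1 : ∀ t, χ (T - t) * inner ℝ (M p.1) (g (T - t)) = θ t * inner ℝ (M (w t)) p.1 := by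
          intro t
          simp only [hχ, sub_sub_cancel, hw]
          rw [hM.symm, real_inner_comm]
        have e2 : ∀ t, φ (T - t) * inner ℝ p.2 (g (T - t)) = φ (T - t) * inner ℝ (w t) p.2 := by
          intro t
          rw [real_inner_comm]
        have e3 : ∀ t, inner ℝ (convOn K' T
            (fun s => g (T - s)) t) (φ (T - t) • p.1) =
            φ (T - t) * inner ℝ (convOn K' T w t) p.1 := by
          intro t
          rw [real_inner_smul_right]
        simp only [e1, e2, e3]
        ring
      have h5 : ∀ᵐ t, t ∈ Ioo 0 T → inner ℝ (M (w t)) p.1 - ∫ s in Ioo 0 t, κ s = 0 := by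
        refine isOpen_Ioo.ae_eq_zero_of_integral_contDiff_smul_eq_zero ?_ fun θ hθ _ hθT => ?_
        · exact IntegrableOn.locallyIntegrableOn (hMw.sub hprim)
        · refine Eq.trans ?_ (key θ hθ.continuous)
          rw [← integral_indicator measurableSet_Ioo]
          congr 1
          ext t
          by_cases ht : t ∈ Ioo 0 T
          · simp [ht]
          · have : θ t = 0 := by
              by_contra hne
              exact ht (hθT (subset_tsupport θ hne))
            rw [indicator_of_notMem ht, this, zero_smul]
      rw [ae_restrict_iff' measurableSet_Ioo]
      filter_upwards [h5] with t ht htI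
      exact sub_eq_zero.1 (ht htI)
    have h6 := (measurePreserving_timeReflection T).quasiMeasurePreserving.ae hw0
    filter_upwards [h6] with t ht
    have : T - (T - t) = t := by ring
    rw [← this]
    exact ht
  -- once `g = 0`, functions constant in time show that `p₀` is orthogonal to the domain
  refine ⟨hG.dense p₀ fun p hp => ?_, hg0⟩
  have h1 := h p hp (fun _ => 1) (fun _ => 0) (fun t => hasDerivAt_const t 1) continuous_const
  rw [integral_eq_zero_of_ae] at h1
  · rw [real_inner_comm]
    simpa using h1
  · filter_upwards [hg0] with t ht
    simp [ht]

end Density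

/-! ### Existence for the abstract evolution equation -/

section Existence

open Filter Topology

variable {X : Type*} [NormedAddCommGroup X] [InnerProductSpace ℝ X]

/-- The pairs `(u(0), M u' + K ⋆ u + A u)` for regular `u`, as a subspace of the Hilbert space
`X × L²(0, T; X)`. -/
def regularData (G : Submodule ℝ (X × X)) (M : X →L[ℝ] X) {K : ℝ → X →L[ℝ] X} (hK : Integrable K)
    (T : ℝ) : Submodule ℝ (WithLp 2 (X × Lp X 2 (timeMeasure T))) where
  carrier := {y | ∃ u u' z, IsRegular G u u' z ∧ y.fst = u 0 ∧
    y.snd =ᵐ[timeMeasure T] forcing M K T u u' z}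
  add_mem' := by
    rintro x y ⟨u, u', z, h, h0, hF⟩ ⟨v, v', w, h', h0', hF'⟩
    refine ⟨_, _, _, h.add h', by simp [h0, h0'], ?_⟩
    filter_upwards [hF, hF', Lp.coeFn_add x.snd y.snd] with t h1 h2 h3
    rw [h.forcing_add h' hK, ← h1, ← h2]
    exact h3
  zero_mem' := by
    have h0 : IsRegular G (fun _ => 0) (fun _ => 0) (fun _ => 0) :=
      ⟨fun t => hasDerivAt_const t 0, continuous_const, fun t => G.zero_mem, continuous_const⟩
    refine ⟨_, _, _, h0, rfl, ?_⟩
    filter_upwards [Lp.coeFn_zero X 2 (timeMeasure T)] with t h1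
    simp only [forcing, convOn, map_zero, integral_zero, add_zero]
    exact h1
  smul_mem' := by
    rintro r x ⟨u, u', z, h, h0, hF⟩
    refine ⟨_, _, _, h.smul r, by simp [h0], ?_⟩
    filter_upwards [hF, Lp.coeFn_smul r x.snd] with t h1 h3
    rw [forcing_smul, ← h1]
    exact h3

lemma tendsto_integral_mul_inner {μ : Measure ℝ} {a : ℕ → ℝ → X} {b : ℝ → X} {φ : ℝ → ℝ}
    (hφ : Continuous φ) (hφc : HasCompactSupport φ) (ha : ∀ n, Integrable (a n) μ)
    (hb : Integrable b μ) (h : Tendsto (fun n => ∫ t, ‖a n t - b t‖ ∂μ) atTop (𝓝 0)) (y : X) :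
    Tendsto (fun n => ∫ t, φ t * inner ℝ (a n t) y ∂μ) atTop
      (𝓝 (∫ t, φ t * inner ℝ (b t) y ∂μ)) := by
  obtain ⟨C, hC⟩ := hφ.bounded_above_of_compact_support hφc
  have hC0 : 0 ≤ C := (norm_nonneg _).trans (hC 0)
  have hi : ∀ g : ℝ → X, Integrable g μ → Integrable (fun t => φ t * inner ℝ (g t) y) μ :=
    fun g hg => (hg.inner_const y).bdd_mul hφ.aestronglyMeasurable (Eventually.of_forall hC)
  rw [tendsto_iff_norm_sub_tendsto_zero]
  refine squeeze_zero (fun n => norm_nonneg _) (fun n => ?_)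
    (by simpa using h.const_mul (C * ‖y‖))
  rw [← integral_sub (hi _ (ha n)) (hi _ hb), ← integral_const_mul]
  refine norm_integral_le_of_norm_le (((ha n).sub hb).norm.const_mul _)
    (Eventually.of_forall fun t => ?_)
  rw [← mul_sub, ← inner_sub_left, norm_mul, mul_assoc, mul_comm ‖y‖]
  exact mul_le_mul (hC t) (norm_inner_le_norm _ _) (norm_nonneg _) hC0

variable [CompleteSpace X] {G : Submodule ℝ (X × X)} {c : ℝ} {M : X →L[ℝ] X}
  {K : ℝ → X →L[ℝ] X} {T : ℝ}

/-- The data of regular functions are dense, because nothing is orthogonal to them. This replaces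
a direct construction of solutions. -/
lemma dense_regularData [SecondCountableTopology X] (hG : IsSkewAdjointGraph G)
    (hM : IsSymmCoercive c M) (hK : Integrable K)
    (hc : ∀ᵐ t, t < 0 → K t = 0) (hpos : IsPositiveKernel K T) :
    (regularData G M hK T).topologicalClosure = ⊤ := by
  rw [Submodule.topologicalClosure_eq_top_iff, Submodule.eq_bot_iff]
  intro y hy
  rw [Submodule.mem_orthogonal] at hy
  have hgi : Integrable (y.snd : ℝ → X) (timeMeasure T) := (Lp.memLp y.snd).integrable (by norm_num)
  obtain ⟨h0, h1⟩ := eq_zero_of_orthogonal_regular hG hM hK hc hpos (p₀ := y.fst) (g := y.snd) hgi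
    fun p hp φ χ hφ hχ => by
      have hreg := isRegular_smul_const hφ hχ hp
      have hF : MemLp (forcing M K T (fun t => φ t • p.1) (fun t => χ t • p.1)
        (fun t => φ t • p.2)) 2 (timeMeasure T) := (hreg.memLp_top_forcing hK).mono_exponent le_top
      have h2 := hy (WithLp.toLp 2 (φ 0 • p.1, hF.toLp) : WithLp 2 (X × Lp X 2 (timeMeasure T)))
        ⟨_, _, _, hreg, rfl, hF.coeFn_toLp⟩
      rw [WithLp.prod_inner_apply, L2.inner_def] at h2
      refine Eq.trans ?_ h2
      refine congrArg₂ (· + ·) rfl (integral_congr_ae ?_)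
      filter_upwards [hF.coeFn_toLp] with t ht
      rw [← ht]
      rfl
  have h3 : y.snd = 0 := by
    refine Lp.ext ?_
    filter_upwards [h1, Lp.coeFn_zero X 2 (timeMeasure T)] with t ht ht'
    rw [ht, ht']; rfl
  refine (WithLp.equiv 2 _).injective (Prod.ext h0 h3)

/-- Arbitrary data are approximated by data of regular functions. The density is proved in the
Hilbert space with source terms in `L²`, so an integrable source term is first replaced by a simple
function. -/
lemma exists_regular_approx [SecondCountableTopology X] (hG : IsSkewAdjointGraph G)
    (hM : IsSymmCoercive c M) (hK : Integrable K)
    (hc : ∀ᵐ t, t < 0 → K t = 0) (hpos : IsPositiveKernel K T) (u₀ : X) {f : ℝ → X}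
    (hf : Integrable f (timeMeasure T)) {δ : ℝ} (hδ : 0 < δ) :
    ∃ u u' z, IsRegular G u u' z ∧ ‖u 0 - u₀‖ ≤ δ ∧
      ∫ t in Ioo 0 T, ‖forcing M K T u u' z t - f t‖ ≤ δ := by
  obtain ⟨F, hF, hF1⟩ := (memLp_one_iff_integrable.2 hf).exists_simpleFunc_eLpNorm_sub_lt
    ENNReal.one_ne_top (ε := ENNReal.ofReal (δ / 2)) (by simpa using by linarith)
  have hF2 : MemLp F 2 (timeMeasure T) := F.memLp_of_isFiniteMeasure 2 _
  set C : ℝ := ((timeMeasure T univ) ^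
    (1 / (1 : ℝ≥0∞).toReal - 1 / (2 : ℝ≥0∞).toReal)).toReal with hC
  have hCtop : ((timeMeasure T univ) ^ (1 / (1 : ℝ≥0∞).toReal - 1 / (2 : ℝ≥0∞).toReal)) ≠ ⊤ := by
    refine ENNReal.rpow_ne_top_of_nonneg (by norm_num) (measure_ne_top _ _)
  have hC0 : 0 ≤ C := ENNReal.toReal_nonneg
  have hd := dense_regularData hG hM hK hc hpos
  have hmem : (WithLp.toLp 2 (u₀, hF2.toLp) : WithLp 2 (X × Lp X 2 (timeMeasure T))) ∈
      closure (regularData G M hK T : Set _) := by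
    rw [← Submodule.topologicalClosure_coe, hd]
    trivial
  set η := min δ (δ / 2 / (C + 1)) with hη
  have hη0 : 0 < η := lt_min hδ (by positivity)
  obtain ⟨y, ⟨u, u', z, hreg, h0, hy⟩, hdist⟩ := Metric.mem_closure_iff.1 hmem η hη0
  rw [dist_comm, dist_eq_norm] at hdist
  set d := y - (WithLp.toLp 2 (u₀, hF2.toLp) : WithLp 2 (X × Lp X 2 (timeMeasure T))) with hdd
  have hd1 : ‖d.fst‖ ≤ ‖d‖ := by
    have := WithLp.prod_norm_sq_eq_of_L2 d
    exact (pow_le_pow_iff_left₀ (norm_nonneg _) (norm_nonneg _) two_ne_zero).1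
      (by nlinarith [sq_nonneg ‖d.snd‖])
  have hd2 : ‖d.snd‖ ≤ ‖d‖ := by
    have := WithLp.prod_norm_sq_eq_of_L2 d
    exact (pow_le_pow_iff_left₀ (norm_nonneg _) (norm_nonneg _) two_ne_zero).1
      (by nlinarith [sq_nonneg ‖d.fst‖])
  refine ⟨u, u', z, hreg, ?_, ?_⟩
  · have : d.fst = u 0 - u₀ := by simp [hdd, h0]
    rw [← this]
    exact hd1.trans (hdist.le.trans (min_le_left _ _))
  · have hFi := hreg.integrable_forcing (M := M) (T := T) hK
    have hF1i : Integrable F (timeMeasure T) := hF2.integrable (by norm_num)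
    have e1 : ∫ t in Ioo 0 T, ‖f t - F t‖ ≤ δ / 2 := by
      have hm : AEStronglyMeasurable (fun t => f t - F t) (timeMeasure T) := hf.1.sub hF1i.1
      rw [integral_norm_eq_lintegral_enorm hm, ← eLpNorm_one_eq_lintegral_enorm]
      exact ENNReal.toReal_le_of_le_ofReal (by linarith) hF.le
    have e2 : ∫ t in Ioo 0 T, ‖forcing M K T u u' z t - F t‖ ≤ C * ‖d.snd‖ := by
      have hm : AEStronglyMeasurable (fun t => forcing M K T u u' z t - F t) (timeMeasure T) :=
        hFi.1.sub hF1i.1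
      rw [integral_norm_eq_lintegral_enorm hm, ← eLpNorm_one_eq_lintegral_enorm]
      have e3 := eLpNorm_le_eLpNorm_mul_rpow_measure_univ (p := 1) (q := 2) (by norm_num) hm
      have e4 : eLpNorm (fun t => forcing M K T u u' z t - F t) 2 (timeMeasure T) =
          eLpNorm d.snd 2 (timeMeasure T) := by
        refine eLpNorm_congr_ae ?_
        filter_upwards [hy, hF2.coeFn_toLp, Lp.coeFn_sub y.snd hF2.toLp] with t h1 h2 h3
        rw [← h1, ← h2]
        exact h3.symm
      rw [e4] at e3
      rw [Lp.norm_def, mul_comm, hC, ← ENNReal.toReal_mul]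
      exact ENNReal.toReal_mono (ENNReal.mul_ne_top (Lp.eLpNorm_ne_top _) hCtop) e3
    have e5 : C * ‖d.snd‖ ≤ δ / 2 := by
      have h1 : ‖d.snd‖ ≤ δ / 2 / (C + 1) := hd2.trans (hdist.le.trans (min_le_right _ _))
      calc C * ‖d.snd‖ ≤ (C + 1) * (δ / 2 / (C + 1)) := by gcongr; linarith
        _ = δ / 2 := by field_simp
    calc ∫ t in Ioo 0 T, ‖forcing M K T u u' z t - f t‖
        ≤ ∫ t in Ioo 0 T, (‖forcing M K T u u' z t - F t‖ + ‖f t - F t‖) := by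
          refine integral_mono (hFi.sub hf).norm ((hFi.sub hF1i).norm.add (hf.sub hF1i).norm)
            fun t => ?_
          simp only
          rw [norm_sub_rev (f t)]
          exact norm_sub_le_norm_sub_add_norm_sub _ _ _
      _ = (∫ t in Ioo 0 T, ‖forcing M K T u u' z t - F t‖) + ∫ t in Ioo 0 T, ‖f t - F t‖ :=
          integral_add (hFi.sub hF1i).norm (hf.sub hF1i).norm
      _ ≤ δ := by linarith

/-- Existence for arbitrary data, with the a priori estimate: the regular solutions for
approximating data form a Cauchy sequence in `C([0, T]; X)`. -/
theorem exists_continuous_solution [SecondCountableTopology X] (hG : IsSkewAdjointGraph G)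
    (hM : IsSymmCoercive c M) (hK : Integrable K)
    (hc : ∀ᵐ t, t < 0 → K t = 0) (hT : 0 < T) (hpos : IsPositiveKernel K T) (u₀ : X) {f : ℝ → X}
    (hf : Integrable f (timeMeasure T)) :
    ∃ u : ℝ → X, Continuous u ∧ u 0 = u₀ ∧
      (∀ p ∈ G, ∀ φ : ℝ → ℝ, ContDiff ℝ ∞ φ → HasCompactSupport φ → tsupport φ ⊆ Ioo 0 T →
        -(∫ t in Ioo 0 T, deriv φ t * inner ℝ (M (u t)) p.1)
          + ∫ t in Ioo 0 T, φ t * inner ℝ (convOn K T u t) p.1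
        = ∫ t in Ioo 0 T, φ t * (inner ℝ (u t) p.2 + inner ℝ (f t) p.1)) ∧
      ∀ τ ∈ Icc 0 T, √(inner ℝ (M (u τ)) (u τ)) ≤ √(inner ℝ (M u₀) u₀) +
        2 / √c * ∫ t in Ioo 0 τ, ‖f t‖ := by
  set δ : ℕ → ℝ := fun n => 1 / ((n : ℝ) + 1) with hδ
  have hδ0 : ∀ n, 0 < δ n := fun n => Nat.one_div_pos_of_nat
  have hδlim : Tendsto δ atTop (𝓝 0) := tendsto_one_div_add_atTop_nhds_zero_nat
  choose v v' z hreg h0 hF using fun n =>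
    exists_regular_approx hG hM hK hc hpos u₀ hf (hδ0 n)
  have hcs : 0 < √c := Real.sqrt_pos.2 hM.pos
  set F : ℕ → ℝ → X := fun n => forcing M K T (v n) (v' n) (z n) with hFdef
  have hFi : ∀ n, Integrable (F n) (timeMeasure T) := fun n => (hreg n).integrable_forcing hK
  set A : ℝ := (√‖M‖ + 2 / √c) / √c with hA
  have hA0 : 0 ≤ A := by positivity
  have hcoer : ∀ x, √c * ‖x‖ ≤ √(inner ℝ (M x) x) := by
    intro x
    refine Real.le_sqrt_of_sq_le ?_
    rw [mul_pow, Real.sq_sqrt hM.pos.le]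
    exact hM.coercive x
  have hupper : ∀ x, √(inner ℝ (M x) x) ≤ √‖M‖ * ‖x‖ := by
    intro x
    rw [Real.sqrt_le_left (by positivity), mul_pow, Real.sq_sqrt (norm_nonneg _)]
    exact (real_inner_le_norm _ _).trans (by nlinarith [M.le_opNorm x, norm_nonneg x])
  have hdiff : ∀ m n, ∀ t ∈ Icc 0 T, ‖v m t - v n t‖ ≤ A * (δ m + δ n) := by
    intro m n t ht
    have h1 := ((hreg m).sub (hreg n)).sqrt_energy_le hG hM hK hc hpos ht
    have h2 : ∫ s in Ioo 0 t, ‖forcing M K T (fun t => v m t - v n t) (fun t => v' m t - v' n t)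
        (fun t => z m t - z n t) s‖ ≤ δ m + δ n := by
      simp only [(hreg m).forcing_sub (hreg n) hK]
      calc ∫ s in Ioo 0 t, ‖F m s - F n s‖ ≤ ∫ s in Ioo 0 T, ‖F m s - F n s‖ :=
            setIntegral_mono_set ((hFi m).sub (hFi n)).norm
              (Eventually.of_forall fun s => norm_nonneg _) (Ioo_subset_Ioo_right ht.2).eventuallyLE
        _ ≤ ∫ s in Ioo 0 T, (‖F m s - f s‖ + ‖F n s - f s‖) := by
            refine integral_mono ((hFi m).sub (hFi n)).norm
              (((hFi m).sub hf).norm.add ((hFi n).sub hf).norm) fun s => ?_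
            simp only
            rw [norm_sub_rev (F n s)]
            exact norm_sub_le_norm_sub_add_norm_sub _ _ _
        _ = (∫ s in Ioo 0 T, ‖F m s - f s‖) + ∫ s in Ioo 0 T, ‖F n s - f s‖ :=
            integral_add ((hFi m).sub hf).norm ((hFi n).sub hf).norm
        _ ≤ δ m + δ n := add_le_add (hF m) (hF n)
    have h3 : ‖v m 0 - v n 0‖ ≤ δ m + δ n := by
      calc ‖v m 0 - v n 0‖ ≤ ‖v m 0 - u₀‖ + ‖u₀ - v n 0‖ := norm_sub_le_norm_sub_add_norm_sub _ _ _
        _ ≤ δ m + δ n := by rw [norm_sub_rev u₀]; exact add_le_add (h0 m) (h0 n)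
    have h4 : √c * ‖v m t - v n t‖ ≤ (√‖M‖ + 2 / √c) * (δ m + δ n) := by
      calc √c * ‖v m t - v n t‖ ≤ _ := hcoer _
        _ ≤ _ := h1
        _ ≤ √‖M‖ * (δ m + δ n) + 2 / √c * (δ m + δ n) := by
            refine add_le_add ((hupper _).trans ?_) ?_
            · gcongr
            · gcongr
        _ = _ := by ring
    rw [hA, div_mul_eq_mul_div, le_div_iff₀ hcs, mul_comm]
    exact h4
  -- the limit in the complete space of continuous functions on `[0, T]`
  set V : ℕ → C(Icc (0 : ℝ) T, X) := fun n => ⟨fun t => v n t,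
    (hreg n).continuous.comp continuous_subtype_val⟩ with hV
  have hVd : ∀ m n, dist (V m) (V n) ≤ A * (δ m + δ n) := by
    intro m n
    refine (ContinuousMap.dist_le (by have := hδ0 m; have := hδ0 n; positivity)).2 fun t => ?_
    rw [dist_eq_norm]
    exact hdiff m n t t.2
  have hVc : CauchySeq V := by
    refine cauchySeq_of_le_tendsto_0 (fun N => A * (δ N + δ N)) (fun m n N hm hn => ?_) ?_
    · refine (hVd m n).trans ?_
      have h1 : δ m ≤ δ N := one_div_le_one_div_of_le (by positivity)
        (by exact_mod_cast Nat.succ_le_succ hm)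
      have h2 : δ n ≤ δ N := one_div_le_one_div_of_le (by positivity)
        (by exact_mod_cast Nat.succ_le_succ hn)
      gcongr
    · simpa using (hδlim.add hδlim).const_mul A
  obtain ⟨U, hU⟩ := cauchySeq_tendsto_of_complete hVc
  set u : ℝ → X := IccExtend hT.le U with hu
  have huc : Continuous u := U.continuous.Icc_extend'
  have hsup : Tendsto (fun n => dist (V n) U) atTop (𝓝 0) := tendsto_iff_dist_tendsto_zero.1 hU
  have hvu : ∀ n, ∀ t ∈ Icc 0 T, ‖v n t - u t‖ ≤ dist (V n) U := by
    intro n t ht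
    have h1 := ContinuousMap.dist_apply_le_dist (f := V n) (g := U) ⟨t, ht⟩
    rw [dist_eq_norm] at h1
    rw [hu, IccExtend_of_mem _ _ ht]
    exact h1
  have hlim : ∀ t ∈ Icc 0 T, Tendsto (fun n => v n t) atTop (𝓝 (u t)) := by
    intro t ht
    rw [tendsto_iff_norm_sub_tendsto_zero]
    exact squeeze_zero (fun _ => norm_nonneg _) (fun n => hvu n t ht) hsup
  have hmem0 : (0 : ℝ) ∈ Icc 0 T := ⟨le_rfl, hT.le⟩
  have hu0lim : Tendsto (fun n => v n 0) atTop (𝓝 u₀) := by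
    rw [tendsto_iff_norm_sub_tendsto_zero]
    exact squeeze_zero (fun _ => norm_nonneg _) h0 hδlim
  have hum := memLp_top_of_continuous huc T
  have hvm : ∀ n, MemLp (v n) ∞ (timeMeasure T) := fun n =>
    memLp_top_of_continuous (hreg n).continuous T
  -- uniform convergence on `(0, T)` implies convergence in the mean
  have hmean : ∀ (a : ℕ → ℝ → X) (b : ℝ → X) (B : ℝ),
      (∀ n, ∀ t ∈ Ioo 0 T, ‖a n t - b t‖ ≤ B * dist (V n) U) →
      Tendsto (fun n => ∫ t in Ioo 0 T, ‖a n t - b t‖) atTop (𝓝 0) := by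
    intro a b B hab
    refine squeeze_zero (fun n => integral_nonneg fun _ => norm_nonneg _) (fun n => ?_)
      (by simpa using (hsup.const_mul B).mul_const T)
    calc ∫ t in Ioo 0 T, ‖a n t - b t‖ ≤ ∫ t in Ioo 0 T, B * dist (V n) U := by
          refine integral_mono_of_nonneg (Eventually.of_forall fun _ => norm_nonneg _)
            (integrable_const _) ?_
          filter_upwards [ae_restrict_mem measurableSet_Ioo] with t ht using hab n t ht
      _ = B * dist (V n) U * T := by simp [hT.le, mul_comm]
  have hFlim : Tendsto (fun n => ∫ t in Ioo 0 T, ‖F n t - f t‖) atTop (𝓝 0) :=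
    squeeze_zero (fun n => integral_nonneg fun _ => norm_nonneg _) hF hδlim
  refine ⟨u, huc, tendsto_nhds_unique (hlim 0 hmem0) hu0lim, ?_, ?_⟩
  · intro p hp φ hφ hφc hφT
    have hφ' : Continuous (deriv φ) := hφ.continuous_deriv (by simp)
    have hi : ∀ {a : ℝ → X}, MemLp a ∞ (timeMeasure T) → Integrable a (timeMeasure T) :=
      fun ha => ha.integrable le_top
    have t1 := tendsto_integral_mul_inner (μ := timeMeasure T) (a := fun n t => M (v n t))
      (b := fun t => M (u t)) hφ' hφc.deriv (fun n => M.integrable_comp (hi (hvm n)))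
      (M.integrable_comp (hi hum)) (hmean _ _ ‖M‖ fun n t ht => by
        rw [← map_sub]
        exact (M.le_opNorm _).trans (by gcongr; exact hvu n t (Ioo_subset_Icc_self ht))) p.1
    have t2 := tendsto_integral_mul_inner (μ := timeMeasure T) (a := fun n => convOn K T (v n))
      (b := convOn K T u) hφ.continuous hφc (fun n => integrable_convOn hK (hi (hvm n)))
      (integrable_convOn hK (hi hum)) (hmean _ _ (∫ s, ‖K s‖) fun n t ht => by
        rw [← convOn_sub hK (hvm n) hum]
        refine norm_convOn_le hK dist_nonneg ?_ t
        filter_upwards [ae_restrict_mem measurableSet_Ioo] with s hs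
        exact hvu n s (Ioo_subset_Icc_self hs)) p.1
    have t3 := tendsto_integral_mul_inner (μ := timeMeasure T) (a := v)
      (b := u) hφ.continuous hφc (fun n => hi (hvm n))
      (hi hum) (hmean _ _ 1 fun n t ht => by
        rw [one_mul]; exact hvu n t (Ioo_subset_Icc_self ht)) p.2
    have t4 := tendsto_integral_mul_inner (μ := timeMeasure T) (a := F)
      (b := f) hφ.continuous hφc hFi hf hFlim p.1
    have hsplit : ∀ (a b : ℝ → X), Integrable a (timeMeasure T) → Integrable b (timeMeasure T) →
        ∫ t in Ioo 0 T, φ t * (inner ℝ (a t) p.2 + inner ℝ (b t) p.1) =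
          (∫ t in Ioo 0 T, φ t * inner ℝ (a t) p.2) + ∫ t in Ioo 0 T, φ t * inner ℝ (b t) p.1 := by
      intro a b ha hb
      simp only [mul_add]
      exact integral_add
        ((ha.inner_const p.2).mul_of_top_right (memLp_top_of_continuous hφ.continuous T))
        ((hb.inner_const p.1).mul_of_top_right (memLp_top_of_continuous hφ.continuous T))
    rw [hsplit u f (hi hum) hf]
    refine tendsto_nhds_unique (t1.neg.add t2) ((t3.add t4).congr fun n => ?_)
    rw [← hsplit (v n) (F n) (hi (hvm n)) (hFi n)]
    exact ((hreg n).weak_equation hG hK hp hT hφ hφT).symm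
  · intro τ hτ
    have hEc : Continuous fun x : X => √(inner ℝ (M x) x) :=
      Real.continuous_sqrt.comp (M.continuous.inner continuous_id)
    have hle : timeMeasure τ ≤ timeMeasure T :=
      Measure.restrict_mono (Ioo_subset_Ioo_right hτ.2) le_rfl
    have t1 := (hEc.tendsto _).comp (hlim τ hτ)
    have t2 := (hEc.tendsto _).comp hu0lim
    have t3 : Tendsto (fun n => ∫ t in Ioo 0 τ, ‖F n t‖) atTop (𝓝 (∫ t in Ioo 0 τ, ‖f t‖)) := by
      rw [tendsto_iff_norm_sub_tendsto_zero]
      refine squeeze_zero (fun _ => norm_nonneg _) (fun n => ?_) hFlim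
      have i1 : Integrable (F n) (timeMeasure τ) := (hFi n).mono_measure hle
      have i2 : Integrable f (timeMeasure τ) := hf.mono_measure hle
      rw [← integral_sub i1.norm i2.norm]
      refine (norm_integral_le_of_norm_le (i1.sub i2).norm
        (Eventually.of_forall fun t => abs_norm_sub_norm_le _ _)).trans ?_
      exact setIntegral_mono_set ((hFi n).sub hf).norm
        (Eventually.of_forall fun s => norm_nonneg _) (Ioo_subset_Ioo_right hτ.2).eventuallyLE
    exact le_of_tendsto_of_tendsto' t1 (t2.add (t3.const_mul _)) fun n =>
      (hreg n).sqrt_energy_le hG hM hK hc hpos hτ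

end Existence

/-! ### The weak curl -/

section Mollify

open Filter Topology

open scoped Convolution

/-- The correlation of two `L²` functions is continuous, by the continuity of translations. -/
lemma continuous_correlation (p q : L2) : Continuous fun y : E3 => ∫ x, p x * q (x - y) := by
  have h : ∀ y : E3, ∫ x, p x * q (x - y) = inner ℝ (DomAddAct.mk (-y) +ᵥ q) p := by
    intro y
    rw [L2.inner_def]
    refine integral_congr_ae ?_
    filter_upwards [DomAddAct.vadd_Lp_ae_eq (DomAddAct.mk (-y)) q] with x hx
    rw [hx]
    simp [sub_eq_neg_add]
  simp only [h]
  have : Fact ((2 : ℝ≥0∞) ≠ ⊤) := ⟨by simp⟩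
  have h1 : Continuous fun y : E3 => (DomAddAct.mk (-y) +ᵥ q : L2) :=
    (continuous_vadd.comp ((DomAddAct.continuous_mk.comp continuous_neg).prodMk continuous_const))
  exact h1.inner continuous_const

lemma integrable_mul_L2 (p q : L2) : Integrable fun x => p x * q x :=
  (Lp.memLp p).integrable_mul (Lp.memLp q)

/-- The function `p(x) ρ(y) q(x - y)` is integrable in both variables. -/
lemma integrable_triple (p q : L2) {ρ : E3 → ℝ} (hρ : Integrable ρ) :
    Integrable (fun a : E3 × E3 => p a.1 * (ρ a.2 * q (a.1 - a.2))) (volume.prod volume) := by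
  have hp2 : Integrable fun x => p x ^ 2 := (Lp.memLp p).integrable_sq
  have hq2 : Integrable fun x => q x ^ 2 := (Lp.memLp q).integrable_sq
  have h1 := hρ.norm.convolution_integrand (ContinuousLinearMap.mul ℝ ℝ) hq2
  have h2 := hp2.mul_prod hρ.norm
  have hm : AEStronglyMeasurable (fun a : E3 × E3 => p a.1 * (ρ a.2 * q (a.1 - a.2)))
      (volume.prod volume) :=
    (Lp.aestronglyMeasurable p).comp_fst.mul (hρ.1.comp_snd.mul
      ((Lp.aestronglyMeasurable q).comp_quasiMeasurePreserving (quasiMeasurePreserving_sub _ _)))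
  refine (h1.add h2).mono' hm (Eventually.of_forall fun a => ?_)
  simp only [Pi.add_apply, ContinuousLinearMap.mul_apply', norm_mul]
  have h3 : ‖p a.1‖ ^ 2 = p a.1 ^ 2 := by simp
  have h4 : ‖q (a.1 - a.2)‖ ^ 2 = q (a.1 - a.2) ^ 2 := by simp
  rw [← h3, ← h4]
  nlinarith [mul_nonneg (norm_nonneg (ρ a.2)) (sq_nonneg (‖p a.1‖ - ‖q (a.1 - a.2)‖)),
    mul_nonneg (norm_nonneg (ρ a.2)) (sq_nonneg (‖p a.1‖)),
    mul_nonneg (norm_nonneg (ρ a.2)) (sq_nonneg (‖q (a.1 - a.2)‖))]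

/-- Convolution of a kernel with an `L²` function. -/
def moll (ρ : E3 → ℝ) (q : L2) : E3 → ℝ := ρ ⋆[ContinuousLinearMap.mul ℝ ℝ] (q : E3 → ℝ)

lemma integrable_mul_moll (p q : L2) {ρ : E3 → ℝ} (hρ : Integrable ρ) :
    Integrable fun x => p x * moll ρ q x := by
  refine (integrable_triple p q hρ).integral_prod_left.congr (Eventually.of_forall fun x => ?_)
  simp only [integral_const_mul]
  rfl

lemma integral_mul_moll (p q : L2) {ρ : E3 → ℝ} (hρ : Integrable ρ) :
    ∫ x, p x * moll ρ q x = ∫ y, ρ y * ∫ x, p x * q (x - y) := by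
  have h := integral_integral_swap (f := fun x y => p x * (ρ y * q (x - y)))
    (integrable_triple p q hρ)
  simp only [integral_const_mul] at h
  refine Eq.trans h ?_
  refine integral_congr_ae (Eventually.of_forall fun y => ?_)
  simp only
  rw [← integral_const_mul]
  congr 1
  ext x
  ring

lemma locallyIntegrable_L2 (q : L2) : LocallyIntegrable (q : E3 → ℝ) :=
  (Lp.memLp q).locallyIntegrable (by norm_num)

lemma contDiff_moll {ρ : E3 → ℝ} (hρ : ContDiff ℝ ∞ ρ) (hρc : HasCompactSupport ρ) (q : L2) :
    ContDiff ℝ ∞ (moll ρ q) :=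
  hρc.contDiff_convolution_left _ hρ (locallyIntegrable_L2 q)

lemma partialDeriv_moll {ρ : E3 → ℝ} (hρ : ContDiff ℝ ∞ ρ) (hρc : HasCompactSupport ρ) (q : L2)
    (i : Fin 3) (x : E3) : partialDeriv i (moll ρ q) x = moll (partialDeriv i ρ) q x := by
  have hρ1 : ContDiff ℝ 1 ρ := hρ.of_le (by exact_mod_cast le_top)
  have h := hρc.hasFDerivAt_convolution_left (μ := volume) (ContinuousLinearMap.mul ℝ ℝ) hρ1
    (locallyIntegrable_L2 q) x
  rw [partialDeriv, moll, h.fderiv]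
  have hce := (hρc.fderiv ℝ).convolutionExists_left
    ((ContinuousLinearMap.mul ℝ ℝ).precompL E3) (μ := volume) (hρ.continuous_fderiv (by simp))
    (locallyIntegrable_L2 q) x
  rw [convolution, ContinuousLinearMap.integral_apply hce]
  rfl

end Mollify

section Curl

open Filter Topology

lemma contDiff_partialDeriv {g : E3 → ℝ} (hg : ContDiff ℝ ∞ g) (i : Fin 3) :
    ContDiff ℝ ∞ (partialDeriv i g) :=
  (hg.fderiv_right (by simp)).clm_apply contDiff_const

lemma hasCompactSupport_partialDeriv {g : E3 → ℝ} (hg : HasCompactSupport g) (i : Fin 3) :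
    HasCompactSupport (partialDeriv i g) :=
  (hg.fderiv ℝ).comp_left (g := fun L : E3 →L[ℝ] ℝ => L (EuclideanSpace.single i 1)) (by simp)

lemma partialDeriv_mul {f g : E3 → ℝ} (hf : ContDiff ℝ ∞ f) (hg : ContDiff ℝ ∞ g) (i : Fin 3)
    (x : E3) : partialDeriv i (fun y => f y * g y) x =
      f x * partialDeriv i g x + partialDeriv i f x * g x := by
  simp only [partialDeriv]
  rw [fderiv_fun_mul (hf.differentiable (by simp) x) (hg.differentiable (by simp) x)]
  simp [mul_comm]

lemma contDiff_component {φ : E3 → Fin 3 → ℝ} (hφ : ContDiff ℝ ∞ φ) (i : Fin 3) :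
    ContDiff ℝ ∞ fun x => φ x i := contDiff_pi.1 hφ i

lemma hasCompactSupport_component {φ : E3 → Fin 3 → ℝ} (hφ : HasCompactSupport φ) (i : Fin 3) :
    HasCompactSupport fun x => φ x i := hφ.comp_left (g := fun v : Fin 3 → ℝ => v i) rfl

lemma contDiff_curl {φ : E3 → Fin 3 → ℝ} (hφ : ContDiff ℝ ∞ φ) : ContDiff ℝ ∞ (curl φ) := by
  rw [contDiff_pi]
  have h := fun a b => contDiff_partialDeriv (contDiff_component hφ a) b
  intro i
  fin_cases i
  · exact (h 2 1).sub (h 1 2)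
  · exact (h 0 2).sub (h 2 0)
  · exact (h 1 0).sub (h 0 1)

lemma hasCompactSupport_curl_component {φ : E3 → Fin 3 → ℝ} (hφ : HasCompactSupport φ) (i : Fin 3) :
    HasCompactSupport fun x => curl φ x i := by
  have h := fun a b => hasCompactSupport_partialDeriv (hasCompactSupport_component hφ a) b
  fin_cases i
  · exact (h 2 1).sub (h 1 2)
  · exact (h 0 2).sub (h 2 0)
  · exact (h 1 0).sub (h 0 1)

lemma memLp_two_of_test {g : E3 → ℝ} (hg : Continuous g) (hgc : HasCompactSupport g) :
    MemLp g 2 (volume : Measure E3) := hg.memLp_of_hasCompactSupport hgc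

lemma integral_partialDeriv_mul {f g : E3 → ℝ} (hf : ContDiff ℝ ∞ f) (hg : ContDiff ℝ ∞ g)
    (hgc : HasCompactSupport g) (i : Fin 3) :
    ∫ x, f x * partialDeriv i g x = -∫ x, partialDeriv i f x * g x := by
  refine integral_mul_fderiv_eq_neg_fderiv_mul_of_integrable ?_ ?_ ?_
    (fun x _ => hf.differentiable (by simp) x) (fun x _ => hg.differentiable (by simp) x)
  · exact Continuous.integrable_of_hasCompactSupport
      ((contDiff_partialDeriv hf i).continuous.mul hg.continuous) hgc.mul_left
  · exact Continuous.integrable_of_hasCompactSupport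
      (hf.continuous.mul (contDiff_partialDeriv hg i).continuous)
      (hasCompactSupport_partialDeriv hgc i).mul_left
  · exact (hf.continuous.mul hg.continuous).integrable_of_hasCompactSupport hgc.mul_left

lemma moll_eq_integral (ρ : E3 → ℝ) (q : L2) (x : E3) : moll ρ q x = ∫ y, q y * ρ (x - y) := by
  rw [moll, convolution_def, ← integral_sub_left_eq_self _ volume x]
  refine integral_congr_ae (Eventually.of_forall fun y => ?_)
  simp [mul_comm]

lemma partialDeriv_comp_sub_left {ρ : E3 → ℝ} (hρ : ContDiff ℝ ∞ ρ) (i : Fin 3) (x y : E3) :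
    partialDeriv i (fun y => ρ (x - y)) y = -partialDeriv i ρ (x - y) := by
  have h1 : HasFDerivAt (fun y : E3 => x - y) (-ContinuousLinearMap.id ℝ E3) y := by
    simpa using (hasFDerivAt_id y).const_sub x
  have h2 := ((hρ.differentiable (by simp)) (x - y)).hasFDerivAt.comp y h1
  rw [partialDeriv, partialDeriv]
  change (fderiv ℝ (ρ ∘ fun y => x - y) y) _ = _
  rw [h2.fderiv]
  simp

lemma partialDeriv_zero (i : Fin 3) (y : E3) : partialDeriv i (fun _ => 0) y = 0 := by
  simp [partialDeriv]

/-- Mollification commutes with the weak curl. -/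
lemma HasWeakCurl.curl_moll {w z : Fin 3 → L2} (h : HasWeakCurl w z) {ρ : E3 → ℝ}
    (hρ : ContDiff ℝ ∞ ρ) (hρc : HasCompactSupport ρ) (x : E3) (k : Fin 3) :
    curl (fun y i => moll ρ (w i) y) x k = moll ρ (z k) x := by
  set r : E3 → ℝ := fun y => ρ (x - y) with hr
  have hrs : ContDiff ℝ ∞ r := hρ.comp (contDiff_const.sub contDiff_id)
  have hrc : HasCompactSupport r := hρc.comp_homeomorph (Homeomorph.subLeft x)
  set φ : E3 → Fin 3 → ℝ := fun y i => if i = k then r y else 0 with hφ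
  have hφs : ContDiff ℝ ∞ φ := by
    rw [contDiff_pi]
    intro i
    by_cases hi : i = k
    · simpa [hφ, hi] using hrs
    · simpa [hφ, hi] using contDiff_const
  have hφc : HasCompactSupport φ :=
    hrc.comp_left (g := fun (a : ℝ) (i : Fin 3) => if i = k then a else 0) (by ext; simp)
  have h1 := h φ hφs hφc
  have hz : moll ρ (z k) x = ∫ y, ∑ i, z i y * φ y i := by
    rw [moll_eq_integral]
    simp [hφ, hr]
  have hp : ∀ a y, partialDeriv a r y = -partialDeriv a ρ (x - y) :=
    fun a y => partialDeriv_comp_sub_left hρ a x y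
  have hi : ∀ a b, Integrable fun y => w b y * partialDeriv a ρ (x - y) := by
    intro a b
    refine (Lp.memLp (w b)).integrable_mul (memLp_two_of_test ?_ ?_)
    · exact (contDiff_partialDeriv hρ a).continuous.comp (continuous_const.sub continuous_id)
    · exact (hasCompactSupport_partialDeriv hρc a).comp_homeomorph (Homeomorph.subLeft x)
  have hm : ∀ a b, partialDeriv a (fun y => moll ρ (w b) y) x =
      ∫ y, w b y * partialDeriv a ρ (x - y) := fun a b => by
    rw [← moll_eq_integral]; exact partialDeriv_moll hρ hρc (w b) a x
  rw [hz, h1]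
  fin_cases k
  all_goals
    simp only [curl, hφ, Fin.sum_univ_three, Fin.isValue, Fin.zero_eta, Fin.mk_one,
      Fin.reduceFinMk, Matrix.cons_val, Matrix.cons_val_zero, Matrix.cons_val_one, reduceIte,
      Fin.reduceEq, partialDeriv_zero, hm, hp, one_ne_zero, zero_ne_one]
    rw [← integral_sub (hi _ _) (hi _ _)]
    refine integral_congr_ae (Eventually.of_forall fun y => ?_)
    simp only
    ring

/-- Smooth cutoff functions which converge to `1` and whose gradients tend to zero uniformly. -/
lemma exists_cutoff : ∃ (χ : ℕ → E3 → ℝ) (D : ℝ), (∀ n, ContDiff ℝ ∞ (χ n)) ∧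
    (∀ n, HasCompactSupport (χ n)) ∧ (∀ n x, |χ n x| ≤ 1) ∧
    (∀ x, Tendsto (fun n => χ n x) atTop (𝓝 1)) ∧
    (∀ n i x, |partialDeriv i (χ n) x| ≤ D / ((n : ℝ) + 1)) := by
  let b : ContDiffBump (0 : E3) := ⟨1, 2, by norm_num, by norm_num⟩
  have hb : ContDiff ℝ ∞ b := b.contDiff
  have hD : ∀ i, ∃ C, ∀ x, ‖partialDeriv i b x‖ ≤ C := fun i =>
    (contDiff_partialDeriv hb i).continuous.bounded_above_of_compact_support
      (hasCompactSupport_partialDeriv b.hasCompactSupport i)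
  choose C hC using hD
  have hne : ∀ n : ℕ, ((n : ℝ) + 1)⁻¹ ≠ 0 := fun n => by positivity
  refine ⟨fun n x => b (((n : ℝ) + 1)⁻¹ • x), max (C 0) (max (C 1) (C 2)), fun n => ?_, fun n => ?_,
    fun n x => ?_, fun x => ?_, fun n i x => ?_⟩
  · exact hb.comp (contDiff_const_smul _)
  · exact b.hasCompactSupport.comp_smul (hne n)
  · rw [abs_of_nonneg b.nonneg]; exact b.le_one
  · have h1 : Tendsto (fun n : ℕ => ((n : ℝ) + 1)⁻¹ • x) atTop (𝓝 ((0 : ℝ) • x)) := by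
      refine Tendsto.smul_const ?_ x
      simpa using tendsto_one_div_add_atTop_nhds_zero_nat (𝕜 := ℝ)
    rw [zero_smul] at h1
    have h2 := (hb.continuous.tendsto 0).comp h1
    rwa [b.one_of_mem_closedBall (by simp [b])] at h2
  · have h1 : HasFDerivAt (fun y : E3 => ((n : ℝ) + 1)⁻¹ • y)
        (((n : ℝ) + 1)⁻¹ • ContinuousLinearMap.id ℝ E3) x :=
      (((n : ℝ) + 1)⁻¹ • ContinuousLinearMap.id ℝ E3).hasFDerivAt
    have h2 := ((hb.differentiable (by simp)) (((n : ℝ) + 1)⁻¹ • x)).hasFDerivAt.comp x h1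
    have h3 : partialDeriv i (fun x => b (((n : ℝ) + 1)⁻¹ • x)) x =
        ((n : ℝ) + 1)⁻¹ * partialDeriv i b (((n : ℝ) + 1)⁻¹ • x) := by
      rw [partialDeriv, partialDeriv]
      change (fderiv ℝ (b ∘ fun y : E3 => ((n : ℝ) + 1)⁻¹ • y) x) _ = _
      rw [h2.fderiv]
      simp
    rw [h3, abs_mul, abs_of_pos (by positivity), div_eq_inv_mul]
    gcongr
    refine (hC i _).trans ?_
    fin_cases i <;> simp

/-- The product rule for the curl, in the form of an estimate for the commutator. -/
lemma abs_curl_mul_sub_le {χ : E3 → ℝ} {Φ : E3 → Fin 3 → ℝ} (hχ : ContDiff ℝ ∞ χ)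
    (hΦ : ContDiff ℝ ∞ Φ) {d : ℝ} {x : E3} (hd : ∀ i, |partialDeriv i χ x| ≤ d) (k : Fin 3) :
    |curl (fun y i => χ y * Φ y i) x k - χ x * curl Φ x k| ≤ 2 * d * ∑ j, |Φ x j| := by
  have h : ∀ a b, partialDeriv a (fun y => χ y * Φ y b) x =
      χ x * partialDeriv a (fun y => Φ y b) x + partialDeriv a χ x * Φ x b := fun a b =>
    partialDeriv_mul hχ (contDiff_component hΦ b) a x
  have hd0 : 0 ≤ d := (abs_nonneg _).trans (hd 0)
  have hS : ∀ j, |Φ x j| ≤ ∑ j, |Φ x j| := fun j =>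
    Finset.single_le_sum (f := fun j => |Φ x j|) (fun i _ => abs_nonneg _) (Finset.mem_univ j)
  have key : ∀ a b i j, |partialDeriv a χ x * Φ x i - partialDeriv b χ x * Φ x j| ≤
      2 * d * ∑ j, |Φ x j| := by
    intro a b i j
    refine (abs_sub _ _).trans ?_
    rw [abs_mul, abs_mul]
    have h1 := mul_le_mul (hd a) (hS i) (abs_nonneg _) hd0
    have h2 := mul_le_mul (hd b) (hS j) (abs_nonneg _) hd0
    linarith
  fin_cases k
  · convert key 1 2 2 1 using 2
    simp [curl, h]; ring
  · convert key 2 0 0 2 using 2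
    simp [curl, h]; ring
  · convert key 0 1 1 0 using 2
    simp [curl, h]; ring

/-- The defining identity of the weak curl extends from compactly supported to merely integrable
smooth test fields. -/
lemma HasWeakCurl.integral_eq_of_integrable {w z : Fin 3 → L2} (h : HasWeakCurl w z)
    {Φ : E3 → Fin 3 → ℝ} (hΦ : ContDiff ℝ ∞ Φ)
    (hz : ∀ k, Integrable fun x => z k x * Φ x k)
    (hw : ∀ k j, Integrable fun x => w k x * Φ x j)
    (hc : ∀ k, Integrable fun x => w k x * curl Φ x k) :
    ∫ x, ∑ i, z i x * Φ x i = ∫ x, ∑ i, w i x * curl Φ x i := by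
  obtain ⟨χ, D, hχ, hχc, hχ1, hχl, hχd⟩ := exists_cutoff
  have hD : 0 ≤ D := by
    have := (abs_nonneg _).trans (hχd 0 0 0)
    simpa using this
  have h1 : ∀ n, ∫ x, ∑ i, z i x * (χ n x * Φ x i) =
      ∫ x, ∑ i, w i x * curl (fun y i => χ n y * Φ y i) x i := fun n =>
    h _ (contDiff_pi.2 fun i => (hχ n).mul (contDiff_component hΦ i))
      (HasCompactSupport.intro (hχc n) fun x hx => by
        ext i; simp [image_eq_zero_of_notMem_tsupport hx])
  have hlim1 : Tendsto (fun n => ∫ x, ∑ i, z i x * (χ n x * Φ x i)) atTop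
      (𝓝 (∫ x, ∑ i, z i x * Φ x i)) := by
    refine tendsto_integral_of_dominated_convergence (fun x => ∑ i, |z i x * Φ x i|) (fun n => ?_)
      (integrable_finsetSum _ fun i _ => (hz i).abs) (fun n => Eventually.of_forall fun x => ?_)
      (Eventually.of_forall fun x => ?_)
    · refine Finset.aestronglyMeasurable_fun_sum _ fun i _ => ?_
      exact (Lp.aestronglyMeasurable _).mul ((hχ n).continuous.mul
        (contDiff_component hΦ i).continuous).aestronglyMeasurable
    · refine (Finset.abs_sum_le_sum_abs _ _).trans (Finset.sum_le_sum fun i _ => ?_)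
      rw [mul_left_comm, abs_mul]
      exact mul_le_of_le_one_left (abs_nonneg _) (hχ1 n x)
    · refine tendsto_finsetSum _ fun i _ => ?_
      simpa using ((hχl x).mul_const (Φ x i)).const_mul (z i x)
  have hcurl : ∀ n, Continuous (fun x => curl (fun y i => χ n y * Φ y i) x) := fun n =>
    (contDiff_curl (contDiff_pi.2 fun i => (hχ n).mul (contDiff_component hΦ i))).continuous
  have hd : ∀ n x i, |partialDeriv i (χ n) x| ≤ D := fun n x i =>
    (hχd n i x).trans (div_le_self hD (by linarith [n.cast_nonneg (α := ℝ)]))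
  have hlim2 : Tendsto (fun n => ∫ x, ∑ i, w i x * curl (fun y i => χ n y * Φ y i) x i) atTop
      (𝓝 (∫ x, ∑ i, w i x * curl Φ x i)) := by
    refine tendsto_integral_of_dominated_convergence
      (fun x => ∑ i, (|w i x * curl Φ x i| + 2 * D * ∑ j, |w i x * Φ x j|)) (fun n => ?_)
      (integrable_finsetSum _ fun i _ => (hc i).abs.add
        ((integrable_finsetSum _ fun j _ => (hw i j).abs).const_mul _))
      (fun n => Eventually.of_forall fun x => ?_)
      (Eventually.of_forall fun x => ?_)
    · refine Finset.aestronglyMeasurable_fun_sum _ fun i _ => ?_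
      exact (Lp.aestronglyMeasurable _).mul
        ((continuous_apply i).comp (hcurl n)).aestronglyMeasurable
    · refine (Finset.abs_sum_le_sum_abs _ _).trans (Finset.sum_le_sum fun i _ => ?_)
      have h2 := abs_curl_mul_sub_le (hχ n) hΦ (hd n x) i
      have h3 : |curl (fun y i => χ n y * Φ y i) x i| ≤ |curl Φ x i| + 2 * D * ∑ j, |Φ x j| := by
        have h4 : |χ n x * curl Φ x i| ≤ |curl Φ x i| := by
          rw [abs_mul]; exact mul_le_of_le_one_left (abs_nonneg _) (hχ1 n x)
        have h5 := abs_sub_abs_le_abs_sub (curl (fun y i => χ n y * Φ y i) x i) (χ n x * curl Φ x i)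
        linarith
      calc |w i x * curl (fun y i => χ n y * Φ y i) x i|
          = |w i x| * |curl (fun y i => χ n y * Φ y i) x i| := abs_mul _ _
        _ ≤ |w i x| * (|curl Φ x i| + 2 * D * ∑ j, |Φ x j|) := by gcongr
        _ = _ := by
            simp only [abs_mul, Finset.mul_sum, mul_add]
            congr 1
            exact Finset.sum_congr rfl fun j _ => by ring
    · refine tendsto_finsetSum _ fun i _ => ?_
      refine Tendsto.const_mul _ ?_
      have h2 : Tendsto (fun n => χ n x * curl Φ x i) atTop (𝓝 (curl Φ x i)) := by
        simpa using (hχl x).mul_const (curl Φ x i)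
      have h3 : Tendsto (fun n : ℕ => 2 * (D / ((n : ℝ) + 1)) * ∑ j, |Φ x j|) atTop (𝓝 0) := by
        have := (tendsto_one_div_add_atTop_nhds_zero_nat (𝕜 := ℝ)).const_mul D
        simpa [div_eq_mul_inv] using (this.const_mul 2).mul_const (∑ j, |Φ x j|)
      have h4 : Tendsto (fun n => curl (fun y i => χ n y * Φ y i) x i - χ n x * curl Φ x i) atTop
          (𝓝 0) :=
        squeeze_zero_norm (fun n => abs_curl_mul_sub_le (hχ n) hΦ (fun i => hχd n i x) i) h3
      simpa using h4.add h2
  refine tendsto_nhds_unique hlim1 ?_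
  simp only [h1]
  exact hlim2

/-- The weak curl is symmetric on its maximal domain. Both sides are the values at `0` of
correlations. Mollifying one of the fields shows that the correlations agree as distributions, and
they are continuous. -/
lemma HasWeakCurl.integral_symm {w z w' z' : Fin 3 → L2} (h : HasWeakCurl w z)
    (h' : HasWeakCurl w' z') :
    ∑ i, ∫ x, z i x * w' i x = ∑ i, ∫ x, w i x * z' i x := by
  -- the correlation of the two fields vanishes against every smooth kernel
  set F : E3 → ℝ := fun y =>
    (∑ i, ∫ x, z i x * w' i (x - y)) - ∑ i, ∫ x, w i x * z' i (x - y) with hF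
  have hFc : Continuous F :=
    (continuous_finsetSum _ fun i _ => continuous_correlation _ _).sub
      (continuous_finsetSum _ fun i _ => continuous_correlation _ _)
  have hF0 : ∀ᵐ y, F y = 0 := by
    refine ae_eq_zero_of_integral_contDiff_smul_eq_zero hFc.locallyIntegrable fun ρ hρ hρc => ?_
    have hρi : Integrable ρ := hρ.continuous.integrable_of_hasCompactSupport hρc
    set Φ : E3 → Fin 3 → ℝ := fun y i => moll ρ (w' i) y
    have hΦ : ContDiff ℝ ∞ Φ := contDiff_pi.2 fun i => contDiff_moll hρ hρc (w' i)
    have hcurl : ∀ x k, curl Φ x k = moll ρ (z' k) x := h'.curl_moll hρ hρc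
    have h1 := h.integral_eq_of_integrable hΦ (fun k => integrable_mul_moll _ _ hρi)
      (fun k j => integrable_mul_moll _ _ hρi)
      (fun k => by simp only [hcurl]; exact integrable_mul_moll _ _ hρi)
    simp only [hcurl] at h1
    rw [integral_finsetSum _ fun i _ => integrable_mul_moll (z i) (w' i) hρi,
      integral_finsetSum _ fun i _ => integrable_mul_moll (w i) (z' i) hρi] at h1
    simp only [integral_mul_moll _ _ hρi] at h1
    have hci : ∀ p q : L2, Integrable fun y => ρ y * ∫ x, p x * q (x - y) := fun p q =>
      (hρ.continuous.mul (continuous_correlation p q)).integrable_of_hasCompactSupport hρc.mul_right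
    simp only [hF, smul_eq_mul, mul_sub, Finset.mul_sum]
    rw [integral_sub (integrable_finsetSum _ fun i _ => hci _ _)
      (integrable_finsetSum _ fun i _ => hci _ _), integral_finsetSum _ fun i _ => hci _ _,
      integral_finsetSum _ fun i _ => hci _ _, h1, sub_self]
  have hF1 : F = fun _ => 0 := (hFc.ae_eq_iff_eq volume continuous_const).1 hF0
  have h2 := congrFun hF1 0
  simp only [hF, sub_zero] at h2
  exact sub_eq_zero.1 h2

end Curl

/-! ### Skew-adjointness of the Maxwell operator -/

section Graph

/-- The components of a smooth compactly supported vector field as elements of `L²(ℝ³)`. -/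
def testField (φ : E3 → Fin 3 → ℝ) (hφ : ContDiff ℝ ∞ φ) (hφc : HasCompactSupport φ)
    (i : Fin 3) : L2 :=
  (memLp_two_of_test (contDiff_component hφ i).continuous
    (hasCompactSupport_component hφc i)).toLp _

/-- The components of the curl of a test field as elements of `L²(ℝ³)`. -/
def testCurl (φ : E3 → Fin 3 → ℝ) (hφ : ContDiff ℝ ∞ φ) (hφc : HasCompactSupport φ)
    (i : Fin 3) : L2 :=
  (memLp_two_of_test (contDiff_component (contDiff_curl hφ) i).continuous
    (hasCompactSupport_curl_component hφc i)).toLp _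

lemma inner_L2 (p q : L2) : inner ℝ p q = ∫ x, p x * q x := by
  rw [L2.inner_def]
  exact integral_congr_ae (Filter.Eventually.of_forall fun x => by simp [mul_comm])

lemma inner_toLp_right (p : L2) {g : E3 → ℝ} (hg : MemLp g 2 (volume : Measure E3)) :
    inner ℝ p (hg.toLp g) = ∫ x, p x * g x := by
  rw [inner_L2]
  refine integral_congr_ae ?_
  filter_upwards [hg.coeFn_toLp] with x hx
  rw [hx]

/-- The weak curl is defined by orthogonality relations in `L²`. -/
lemma hasWeakCurl_iff {w z : Fin 3 → L2} : HasWeakCurl w z ↔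
    ∀ φ (hφ : ContDiff ℝ ∞ φ) (hφc : HasCompactSupport φ),
      ∑ i, inner ℝ (z i) (testField φ hφ hφc i) = ∑ i, inner ℝ (w i) (testCurl φ hφ hφc i) := by
  refine forall_congr' fun φ => forall_congr' fun hφ => forall_congr' fun hφc => ?_
  rw [integral_finsetSum, integral_finsetSum]
  · simp only [testField, testCurl, inner_toLp_right]
  · exact fun i _ => (Lp.memLp (w i)).integrable_mul (memLp_two_of_test
      (contDiff_component (contDiff_curl hφ) i).continuous (hasCompactSupport_curl_component hφc i))
  · exact fun i _ => (Lp.memLp (z i)).integrable_mul (memLp_two_of_test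
      (contDiff_component hφ i).continuous (hasCompactSupport_component hφc i))

lemma HasWeakCurl.inner_symm {w z w' z' : Fin 3 → L2} (h : HasWeakCurl w z)
    (h' : HasWeakCurl w' z') : ∑ i, inner ℝ (z i) (w' i) = ∑ i, inner ℝ (w i) (z' i) := by
  simp only [inner_L2]
  exact h.integral_symm h'

lemma HasWeakCurl.add {w z w' z' : Fin 3 → L2} (h : HasWeakCurl w z) (h' : HasWeakCurl w' z') :
    HasWeakCurl (w + w') (z + z') := by
  rw [hasWeakCurl_iff] at *
  intro φ hφ hφc
  simp only [Pi.add_apply, inner_add_left, Finset.sum_add_distrib, h φ hφ hφc, h' φ hφ hφc]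

lemma HasWeakCurl.smul {w z : Fin 3 → L2} (h : HasWeakCurl w z) (r : ℝ) :
    HasWeakCurl (r • w) (r • z) := by
  rw [hasWeakCurl_iff] at *
  intro φ hφ hφc
  simp only [Pi.smul_apply, real_inner_smul_left, ← Finset.mul_sum, h φ hφ hφc]

lemma hasWeakCurl_zero : HasWeakCurl 0 0 := by
  rw [hasWeakCurl_iff]
  intro φ hφ hφc
  simp

lemma integral_curl_mul {φ ψ : E3 → Fin 3 → ℝ} (hφ : ContDiff ℝ ∞ φ) (hφc : HasCompactSupport φ)
    (hψ : ContDiff ℝ ∞ ψ) (hψc : HasCompactSupport ψ) :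
    ∑ i, ∫ x, curl φ x i * ψ x i = ∑ i, ∫ x, φ x i * curl ψ x i := by
  have hI : ∀ a i j, Integrable fun x => partialDeriv a (fun y => φ y i) x * ψ x j := fun a i j =>
    ((contDiff_partialDeriv (contDiff_component hφ i) a).continuous.mul
      (contDiff_component hψ j).continuous).integrable_of_hasCompactSupport
      (hasCompactSupport_component hψc j).mul_left
  have hJ : ∀ a i j, Integrable fun x => φ x i * partialDeriv a (fun y => ψ y j) x := fun a i j =>
    ((contDiff_component hφ i).continuous.mul
      (contDiff_partialDeriv (contDiff_component hψ j) a).continuous).integrable_of_hasCompactSupport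
      (hasCompactSupport_component hφc i).mul_right
  have hp : ∀ a i j, ∫ x, φ x i * partialDeriv a (fun y => ψ y j) x =
      -∫ x, partialDeriv a (fun y => φ y i) x * ψ x j := fun a i j =>
    integral_partialDeriv_mul (contDiff_component hφ i) (contDiff_component hψ j)
      (hasCompactSupport_component hψc j) a
  simp only [curl, Fin.sum_univ_three, Matrix.cons_val, sub_mul, mul_sub,
    integral_sub (hI _ _ _) (hI _ _ _), integral_sub (hJ _ _ _) (hJ _ _ _), hp]
  ring

lemma hasWeakCurl_testField {φ : E3 → Fin 3 → ℝ} (hφ : ContDiff ℝ ∞ φ)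
    (hφc : HasCompactSupport φ) : HasWeakCurl (testField φ hφ hφc) (testCurl φ hφ hφc) := by
  rw [hasWeakCurl_iff]
  intro ψ hψ hψc
  have h1 : ∀ {f g : E3 → ℝ} (hf : MemLp f 2 (volume : Measure E3))
      (hg : MemLp g 2 (volume : Measure E3)),
      inner ℝ (hf.toLp f) (hg.toLp g) = ∫ x, f x * g x := by
    intro f g hf hg
    rw [inner_toLp_right]
    refine integral_congr_ae ?_
    filter_upwards [hf.coeFn_toLp] with x hx
    rw [hx]
  simp only [testField, testCurl, h1]
  exact integral_curl_mul hφ hφc hψ hψc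

lemma inner_eq_elec_add_magn (u v : H) :
    inner ℝ u v = ∑ i, inner ℝ (elec u i) (elec v i) + ∑ i, inner ℝ (magn u i) (magn v i) := by
  rw [PiLp.inner_apply, Fintype.sum_sum_type]
  rfl

/-- The field with given electric and magnetic parts. -/
def mkField (a b : Fin 3 → L2) : H := WithLp.toLp 2 (Sum.elim a b)

@[simp] lemma elec_mkField (a b : Fin 3 → L2) : elec (mkField a b) = a := rfl

@[simp] lemma magn_mkField (a b : Fin 3 → L2) : magn (mkField a b) = b := rfl

lemma magn_add (u v : H) : magn (u + v) = magn u + magn v := rfl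

lemma magn_smul (r : ℝ) (u : H) : magn (r • u) = r • magn u := rfl

lemma elec_neg (u : H) : elec (-u) = -elec u := rfl

lemma magn_neg (u : H) : magn (-u) = -magn u := rfl

lemma magn_zero : magn 0 = 0 := rfl

/-- The graph of the Maxwell operator. -/
def maxwellGraph : Submodule ℝ (H × H) where
  carrier := {p | HasMaxwell p.1 p.2}
  add_mem' := by
    rintro p q ⟨h1, h2⟩ ⟨h3, h4⟩
    refine ⟨h1.add h3, ?_⟩
    rw [Prod.snd_add, magn_add, neg_add]
    exact h2.add h4
  zero_mem' := by
    refine ⟨hasWeakCurl_zero, ?_⟩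
    rw [Prod.snd_zero, magn_zero, neg_zero]
    exact hasWeakCurl_zero
  smul_mem' := by
    rintro r p ⟨h1, h2⟩
    refine ⟨h1.smul r, ?_⟩
    rw [Prod.smul_snd, magn_smul, ← smul_neg]
    exact h2.smul r

lemma mkField_testField_zero_mem {φ : E3 → Fin 3 → ℝ} (hφ : ContDiff ℝ ∞ φ)
    (hφc : HasCompactSupport φ) :
    (mkField (testField φ hφ hφc) 0, mkField 0 (-testCurl φ hφ hφc)) ∈ maxwellGraph := by
  refine ⟨hasWeakCurl_zero, ?_⟩
  simp only [elec_mkField, magn_mkField, neg_neg]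
  exact hasWeakCurl_testField hφ hφc

lemma mkField_zero_testField_mem {φ : E3 → Fin 3 → ℝ} (hφ : ContDiff ℝ ∞ φ)
    (hφc : HasCompactSupport φ) :
    (mkField 0 (testField φ hφ hφc), mkField (testCurl φ hφ hφc) 0) ∈ maxwellGraph := by
  refine ⟨hasWeakCurl_testField hφ hφc, ?_⟩
  simp only [elec_mkField, magn_mkField, neg_zero]
  exact hasWeakCurl_zero

lemma eq_zero_of_inner_testField {p : Fin 3 → L2}
    (h : ∀ φ (hφ : ContDiff ℝ ∞ φ) (hφc : HasCompactSupport φ),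
      ∑ i, inner ℝ (p i) (testField φ hφ hφc i) = 0) (k : Fin 3) : p k = 0 := by
  rw [Lp.eq_zero_iff_ae_eq_zero]
  refine ae_eq_zero_of_integral_contDiff_smul_eq_zero (locallyIntegrable_L2 _) fun g hg hgc => ?_
  have hs : ContDiff ℝ ∞ fun (x : E3) (i : Fin 3) => if i = k then g x else 0 := by
    rw [contDiff_pi]
    intro i
    by_cases hi : i = k
    · simpa [hi] using hg
    · simpa [hi] using contDiff_const
  have hc : HasCompactSupport fun (x : E3) (i : Fin 3) => if i = k then g x else 0 :=
    hgc.comp_left (g := fun (a : ℝ) (i : Fin 3) => if i = k then a else 0) (by ext; simp)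
  have h1 := h _ hs hc
  simp only [testField, inner_toLp_right] at h1
  rw [Finset.sum_eq_single k (fun i _ hi => by simp [hi]) (by simp)] at h1
  simpa [mul_comm] using h1

/-- The Maxwell operator is skew-adjoint: symmetry of the weak curl makes it skew, and its domain is
maximal because it is defined by testing with smooth fields. -/
lemma isSkewAdjointGraph_maxwellGraph : IsSkewAdjointGraph maxwellGraph where
  skew := by
    rintro p ⟨h1, h2⟩ q ⟨h3, h4⟩
    have e1 := h1.inner_symm h4
    have e2 := h2.inner_symm h3
    simp only [Pi.neg_apply, inner_neg_right, inner_neg_left, Finset.sum_neg_distrib] at e1 e2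
    rw [inner_eq_elec_add_magn, inner_eq_elec_add_magn]
    linarith
  maximal := by
    intro u g h
    refine ⟨hasWeakCurl_iff.2 fun φ hφ hφc => ?_, hasWeakCurl_iff.2 fun φ hφ hφc => ?_⟩
    · have h1 := h _ (mkField_testField_zero_mem hφ hφc)
      simp only [inner_eq_elec_add_magn, elec_mkField, magn_mkField, Pi.zero_apply,
        inner_zero_right, Finset.sum_const_zero, zero_add, add_zero, Pi.neg_apply, inner_neg_right,
        Finset.sum_neg_distrib] at h1
      simp only [elec_neg, Pi.neg_apply, inner_neg_left, Finset.sum_neg_distrib]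
      linarith
    · have h1 := h _ (mkField_zero_testField_mem hφ hφc)
      simp only [inner_eq_elec_add_magn, elec_mkField, magn_mkField, Pi.zero_apply,
        inner_zero_right, Finset.sum_const_zero, zero_add, add_zero] at h1
      simp only [magn_neg, neg_neg]
      linarith
  dense := by
    intro z h
    have h1 : ∀ k, elec z k = 0 := eq_zero_of_inner_testField fun φ hφ hφc => by
      simpa [inner_eq_elec_add_magn] using h _ (mkField_testField_zero_mem hφ hφc)
    have h2 : ∀ k, magn z k = 0 := eq_zero_of_inner_testField fun φ hφ hφc => by
      simpa [inner_eq_elec_add_magn] using h _ (mkField_zero_testField_mem hφ hφc)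
    ext1 i
    rcases i with i | i
    · exact h1 i
    · exact h2 i

end Graph

/-! ### Multiplication operators -/

section MultiplicationOperator

/-- Multiplication of square integrable functions by bounded functions, as a bounded bilinear
map. -/
def smulCLM : Linf ℝ →L[ℝ] L2 →L[ℝ] L2 :=
  (ContinuousLinearMap.mul ℝ ℝ).holderL (volume : Measure E3) ∞ 2 2

lemma smulCLM_apply (g : Linf ℝ) (p : L2) : smulCLM g p = g • p := by
  refine Lp.ext ?_
  have h1 : (smulCLM g p : E3 → ℝ) =ᵐ[volume] fun x => g x * p x :=
    (ContinuousLinearMap.mul ℝ ℝ).coeFn_holder g p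
  have h2 : ((g • p : L2) : E3 → ℝ) =ᵐ[volume] ⇑g • ⇑p := Lp.coeFn_lpSMul g p
  filter_upwards [h1, h2] with x hx1 hx2
  rw [hx1, hx2]
  rfl

/-- The inclusion of a component in the space of fields. -/
def embedCLM (i : Idx) : L2 →L[ℝ] H :=
  (PiLp.continuousLinearEquiv 2 ℝ (fun _ : Idx => L2)).symm.toContinuousLinearMap ∘L
    ContinuousLinearMap.single ℝ (fun _ : Idx => L2) i

lemma embedCLM_apply (i : Idx) (p : L2) (k : Idx) : embedCLM i p k = if k = i then p else 0 := by
  change (Pi.single i p : Idx → L2) k = _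
  rw [Pi.single_apply]

/-- The operator on fields which multiplies component `j` by a bounded function and places the
result in component `i`, as a bounded linear function of the multiplier. -/
def entryOp (i j : Idx) : Linf ℝ →L[ℝ] H →L[ℝ] H :=
  (ContinuousLinearMap.compL ℝ H L2 H (embedCLM i)) ∘L
    ((ContinuousLinearMap.compL ℝ H L2 L2).flip (PiLp.proj 2 (fun _ : Idx => L2) j)) ∘L smulCLM

lemma entryOp_apply (i j : Idx) (g : Linf ℝ) (u : H) :
    entryOp i j g u = embedCLM i (g • u j) := by
  rw [← smulCLM_apply]; rfl

/-- The multiplication operator on `𝓗` given by a matrix with bounded entries. -/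
def mulOp (A : Matrix Idx Idx (Linf ℝ)) : H →L[ℝ] H := ∑ i, ∑ j, entryOp i j (A i j)

lemma mulOp_apply (A : Matrix Idx Idx (Linf ℝ)) (u : H) : mulOp A u = mulField A u := by
  ext1 k
  simp only [mulOp, sum_apply, entryOp_apply, WithLp.ofLp_sum,
    Finset.sum_apply, embedCLM_apply, mulField]
  rw [Finset.sum_eq_single k (fun i _ hi => by simp [hi.symm]) (by simp)]
  simp

lemma mulOp_zero : mulOp 0 = 0 := by simp [mulOp]

lemma inner_smul_L2 (g : Linf ℝ) (p q : L2) :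
    inner ℝ (g • p : L2) q = ∫ x, g x * p x * q x := by
  rw [inner_L2]
  refine integral_congr_ae ?_
  have h2 : ((g • p : L2) : E3 → ℝ) =ᵐ[volume] ⇑g • ⇑p := Lp.coeFn_lpSMul g p
  filter_upwards [h2] with x hx
  rw [hx]
  rfl

lemma integrable_smul_mul (g : Linf ℝ) (p q : L2) : Integrable fun x => g x * p x * q x := by
  have h2 : ((g • p : L2) : E3 → ℝ) =ᵐ[volume] ⇑g • ⇑p := Lp.coeFn_lpSMul g p
  refine (integrable_mul_L2 (g • p) q).congr ?_
  filter_upwards [h2] with x hx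
  rw [hx]
  rfl

lemma inner_mulOp (A : Matrix Idx Idx (Linf ℝ)) (u v : H) :
    inner ℝ (mulOp A u) v = ∑ i, ∑ j, ∫ x, A i j x * u j x * v i x := by
  rw [mulOp_apply, PiLp.inner_apply]
  simp only [mulField, sum_inner, inner_smul_L2]

lemma integrable_indicator_sum_comp {Y Z ι : Type*} [NormedAddCommGroup Y] [NormedSpace ℝ Y]
    [NormedAddCommGroup Z] [NormedSpace ℝ Z] [Fintype ι] (L : ι → ι → Y →L[ℝ] Z)
    {g : ℝ → ι → ι → Y} (hg : ∀ i j, LocallyIntegrable (fun t => g t i j)) (a b : ℝ) :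
    Integrable ((Ioo a b).indicator fun t => ∑ i, ∑ j, L i j (g t i j)) := by
  rw [integrable_indicator_iff measurableSet_Ioo]
  refine integrable_finsetSum _ fun i _ => integrable_finsetSum _ fun j _ =>
    (L i j).integrable_comp ?_
  exact ((hg i j).integrableOn_isCompact isCompact_Icc).mono_set Ioo_subset_Icc_self

/-- The kernel of multiplication operators given by `Λ`, cut off outside `(-T, T)`. Differences of
times in `(0, T)` stay in this interval, and the cutoff makes the kernel integrable. -/
def kernelOp (Λ : ℝ → Matrix Idx Idx (Linf ℝ)) (T : ℝ) : ℝ → H →L[ℝ] H :=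
  (Ioo (-T) T).indicator fun t => mulOp (Λ t)

lemma integrable_kernelOp {Λ : ℝ → Matrix Idx Idx (Linf ℝ)}
    (hΛ : ∀ i j, LocallyIntegrable (fun t => Λ t i j) volume) (T : ℝ) :
    Integrable (kernelOp Λ T) :=
  integrable_indicator_sum_comp entryOp hΛ (-T) T

lemma kernelOp_eq_zero_of_neg {Λ : ℝ → Matrix Idx Idx (Linf ℝ)} (hΛ : IsCausal Λ) (T : ℝ) :
    ∀ᵐ t, t < 0 → kernelOp Λ T t = 0 := by
  filter_upwards [hΛ] with t ht h0
  by_cases hm : t ∈ Ioo (-T) T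
  · rw [kernelOp, indicator_of_mem hm, ht h0, mulOp_zero]
  · rw [kernelOp, indicator_of_notMem hm]

/-- By causality, the truncated convolution is the convolution on the whole time interval. -/
lemma convOn_kernelOp {Λ : ℝ → Matrix Idx Idx (Linf ℝ)} (hΛ : IsCausal Λ) {T t : ℝ}
    (ht : t ∈ Ioo 0 T) (u : ℝ → H) : convOn (kernelOp Λ T) T u t = truncConv Λ u t := by
  have h0 := (Measure.measurePreserving_sub_left (volume : Measure ℝ) t).quasiMeasurePreserving.ae
    (kernelOp_eq_zero_of_neg hΛ T)
  have h1 : convOn (kernelOp Λ T) T u t =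
      ∫ s in Ioo 0 T, (Ioo 0 t).indicator (fun s => mulField (Λ (t - s)) (u s)) s := by
    refine setIntegral_congr_ae measurableSet_Ioo ?_
    have hne : ∀ᵐ s : ℝ, s ≠ t := by simp [ae_iff]
    filter_upwards [h0, hne] with s hs hst hsT
    by_cases hm : s ∈ Ioo 0 t
    · have : t - s ∈ Ioo (-T) T := ⟨by linarith [hsT.1, hsT.2, hm.2], by linarith [hsT.1, ht.2]⟩
      rw [indicator_of_mem hm, kernelOp, indicator_of_mem this, mulOp_apply]
    · have hts : t < s := by
        rcases lt_trichotomy s t with h | h | h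
        · exact absurd ⟨hsT.1, h⟩ hm
        · exact absurd h hst
        · exact h
      rw [indicator_of_notMem hm, hs (by linarith)]
      simp
  rw [h1, setIntegral_indicator measurableSet_Ioo, inter_eq_right.2 (Ioo_subset_Ioo_right ht.2.le),
    truncConv, intervalIntegral.integral_of_le ht.1.le, integral_Ioc_eq_integral_Ioo]

/-- The operator of multiplication by `diag(ε, μ)` is symmetric and coercive. -/
lemma isSymmCoercive_mulOp {c : ℝ} (hc : 0 < c) {ε μ : Matrix (Fin 3) (Fin 3) (Linf ℝ)}
    (hε : IsElliptic c ε) (hμ : IsElliptic c μ) : IsSymmCoercive c (mulOp (blockM ε μ)) where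
  pos := hc
  symm u v := by
    have hs : ∀ i j, blockM ε μ i j = blockM ε μ j i := by
      have : (blockM ε μ).IsSymm := Matrix.IsSymm.fromBlocks hε.1 (by simp) hμ.1
      exact fun i j => this.apply j i
    rw [← real_inner_comm u, inner_mulOp, inner_mulOp, Finset.sum_comm]
    refine Finset.sum_congr rfl fun i _ => Finset.sum_congr rfl fun j _ => ?_
    rw [hs]
    congr 1
    ext x
    ring
  coercive u := by
    have hn : ‖u‖ ^ 2 = ∑ i, ∫ x, u i x * u i x := by
      rw [← real_inner_self_eq_norm_sq, PiLp.inner_apply]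
      simp only [inner_L2]
    rw [inner_mulOp, hn, ← integral_finsetSum _ fun i _ => integrable_mul_L2 _ _,
      ← integral_const_mul]
    have hI : ∀ i, Integrable fun x => ∑ j, blockM ε μ i j x * u j x * u i x := fun i =>
      integrable_finsetSum _ fun j _ => integrable_smul_mul _ _ _
    have he : ∑ i, ∑ j, ∫ x, blockM ε μ i j x * u j x * u i x =
        ∫ x, ∑ i, ∑ j, blockM ε μ i j x * u j x * u i x := by
      rw [integral_finsetSum _ fun i _ => hI i]
      refine Finset.sum_congr rfl fun i _ => ?_
      rw [integral_finsetSum _ fun j _ => integrable_smul_mul _ _ _]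
    rw [he]
    refine integral_mono_ae ((integrable_finsetSum _ fun i _ => integrable_mul_L2 _ _).const_mul _)
      (integrable_finsetSum _ fun i _ => hI i) ?_
    have hz : ∀ᵐ x : E3, (0 : Linf ℝ) x = 0 := Lp.coeFn_zero ℝ ∞ volume
    filter_upwards [hε.2, hμ.2, hz] with x h1 h2 h3
    have e1 := h1 fun i => u (Sum.inl i) x
    have e2 := h2 fun i => u (Sum.inr i) x
    simp only [Fintype.sum_sum_type, blockM, Matrix.fromBlocks_apply₁₁, Matrix.fromBlocks_apply₁₂,
      Matrix.fromBlocks_apply₂₁, Matrix.fromBlocks_apply₂₂, Matrix.zero_apply, h3, zero_mul,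
      Finset.sum_const_zero, add_zero, zero_add]
    simp only [pow_two] at e1 e2
    linarith

end MultiplicationOperator

/-! ### Truncation of Fourier integrals -/

section Cutoff

open Filter Topology FourierTransform

/-- A smooth cutoff function on the frequency axis. -/
def bumpFun : ContDiffBump (0 : ℝ) := ⟨1, 2, by norm_num, by norm_num⟩

/-- The dilates of the cutoff function, which tend to `1`. -/
def cutoff (n : ℕ) (x : ℝ) : ℝ := bumpFun (((n : ℝ) + 1)⁻¹ * x)

lemma contDiff_cutoff (n : ℕ) : ContDiff ℝ ∞ (cutoff n) :=
  bumpFun.contDiff.comp (contDiff_const.mul contDiff_id)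

lemma cutoff_nonneg (n : ℕ) (x : ℝ) : 0 ≤ cutoff n x := bumpFun.nonneg

lemma hasCompactSupport_cutoff (n : ℕ) : HasCompactSupport (cutoff n) :=
  bumpFun.hasCompactSupport.comp_smul (c := ((n : ℝ) + 1)⁻¹) (by positivity)

/-- As `1 - bumpFun` vanishes near zero, its bounded derivatives are at most linear in `|x|`. -/
lemma exists_iteratedDeriv_one_sub_bumpFun_le (i : ℕ) :
    ∃ C, ∀ x : ℝ, ‖iteratedDeriv i (fun y => 1 - bumpFun y) x‖ ≤ C * |x| := by
  have hs : ContDiff ℝ i (bumpFun : ℝ → ℝ) := bumpFun.contDiff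
  obtain ⟨C, hC⟩ : ∃ C, ∀ x : ℝ, ‖iteratedDeriv i (fun y => 1 - bumpFun y) x‖ ≤ C := by
    have h1 : HasCompactSupport (iteratedFDeriv ℝ i (bumpFun : ℝ → ℝ)) :=
      bumpFun.hasCompactSupport.iteratedFDeriv i
    obtain ⟨C, hC⟩ := (hs.continuous_iteratedFDeriv le_rfl).bounded_above_of_compact_support h1
    refine ⟨1 + C, fun x => ?_⟩
    rcases Nat.eq_zero_or_pos i with rfl | hi
    · have := hC x
      rw [norm_iteratedFDeriv_zero] at this
      rw [iteratedDeriv_zero]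
      exact (norm_sub_le _ _).trans (by simpa using this)
    · have := hC x
      rw [iteratedDeriv_const_sub hi, ← norm_iteratedFDeriv_eq_norm_iteratedDeriv]
      rw [iteratedFDeriv_neg_apply, norm_neg]
      linarith
  have hC0 : 0 ≤ C := (norm_nonneg _).trans (hC 0)
  refine ⟨C, fun x => ?_⟩
  rcases lt_or_ge |x| 1 with hx | hx
  · have h1 : (fun y => 1 - bumpFun y) =ᶠ[𝓝 x] fun _ => 0 := by
      have : Metric.ball (0 : ℝ) 1 ∈ 𝓝 x := Metric.isOpen_ball.mem_nhds (by simpa using hx)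
      filter_upwards [this] with y hy
      rw [bumpFun.one_of_mem_closedBall (Metric.ball_subset_closedBall hy), sub_self]
    rw [h1.iteratedDeriv_eq]
    simp
    positivity
  · exact (hC x).trans (le_mul_of_one_le_right hC0 hx)

lemma exists_iteratedFDeriv_one_sub_cutoff_le (i : ℕ) :
    ∃ C, 0 ≤ C ∧ ∀ (n : ℕ) (x : ℝ),
      ‖iteratedFDeriv ℝ i (fun y => 1 - cutoff n y) x‖ ≤ C * ‖x‖ / ((n : ℝ) + 1) := by
  obtain ⟨C, hC⟩ := exists_iteratedDeriv_one_sub_bumpFun_le i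
  have hC0 : 0 ≤ C := by simpa using (norm_nonneg _).trans (hC 1)
  refine ⟨C, hC0, fun n x => ?_⟩
  have hs : ContDiff ℝ i (fun y : ℝ => 1 - bumpFun y) := contDiff_const.sub bumpFun.contDiff
  have hn : (0 : ℝ) < (n : ℝ) + 1 := by positivity
  have h1 : iteratedDeriv i (fun y => 1 - cutoff n y) x =
      (((n : ℝ) + 1)⁻¹) ^ i * iteratedDeriv i (fun y => 1 - bumpFun y) (((n : ℝ) + 1)⁻¹ * x) := by
    have := iteratedDeriv_comp_const_mul hs (((n : ℝ) + 1)⁻¹)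
    exact congrFun this x
  rw [norm_iteratedFDeriv_eq_norm_iteratedDeriv, h1, norm_mul]
  have h2 : ‖(((n : ℝ) + 1)⁻¹) ^ i‖ ≤ 1 := by
    rw [norm_pow, Real.norm_of_nonneg (by positivity)]
    exact pow_le_one₀ (by positivity) (inv_le_one_of_one_le₀ (by linarith [n.cast_nonneg (α := ℝ)]))
  calc _ ≤ 1 * (C * |((n : ℝ) + 1)⁻¹ * x|) := by gcongr; exact hC _
    _ = _ := by
      rw [abs_mul, abs_of_pos (inv_pos.2 hn), Real.norm_eq_abs]
      field_simp

/-- The truncation of a Schwartz function by the cutoff functions. -/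
def truncate (n : ℕ) (h : 𝓢(ℝ, ℂ)) : 𝓢(ℝ, ℂ) :=
  HasCompactSupport.toSchwartzMap (f := fun x => cutoff n x • h x)
    ((hasCompactSupport_cutoff n).smul_right) ((contDiff_cutoff n).smul h.smooth')

lemma truncate_apply (n : ℕ) (h : 𝓢(ℝ, ℂ)) (x : ℝ) : truncate n h x = cutoff n x • h x := rfl

/-- Truncations of a Schwartz function converge in the Schwartz space: in the Leibniz formula the
derivatives of `1 - cutoff n` contribute a factor `‖x‖ / (n + 1)`, and the weight `‖x‖` is absorbed
by a higher seminorm. -/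
lemma tendsto_truncate (h : 𝓢(ℝ, ℂ)) : Tendsto (fun n => truncate n h) atTop (𝓝 h) := by
  choose C hC0 hC using exists_iteratedFDeriv_one_sub_cutoff_le
  refine ((schwartz_withSeminorms ℝ ℝ ℂ).tendsto_nhds _ _).2 ?_
  rintro ⟨k, m⟩ ε hε
  set D : ℝ := ∑ i ∈ Finset.range (m + 1),
    (m.choose i : ℝ) * C i * SchwartzMap.seminorm ℝ (k + 1) (m - i) h with hD
  have hD0 : 0 ≤ D := Finset.sum_nonneg fun i _ =>
    mul_nonneg (mul_nonneg (Nat.cast_nonneg _) (hC0 i)) (apply_nonneg _ _)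
  have hb : ∀ n : ℕ, SchwartzMap.seminorm ℝ k m (truncate n h - h) ≤ D / ((n : ℝ) + 1) := by
    intro n
    refine SchwartzMap.seminorm_le_bound ℝ k m _ (by positivity) fun x => ?_
    have he : (⇑(truncate n h - h) : ℝ → ℂ) = -fun y => (1 - cutoff n y) • h y := by
      ext y
      simp only [sub_apply, truncate_apply, Pi.neg_apply, sub_smul, one_smul]
      ring
    rw [he, iteratedFDeriv_neg_apply, norm_neg]
    have hl := norm_iteratedFDeriv_smul_le (𝕜 := ℝ) (n := m) (N := ∞) (g := ⇑h)
      (contDiff_const.sub (contDiff_cutoff n) : ContDiff ℝ ∞ fun y => 1 - cutoff n y)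
      (h.smooth' : ContDiff ℝ ∞ h) x (by exact_mod_cast le_top)
    calc ‖x‖ ^ k * _ ≤ ‖x‖ ^ k * _ := mul_le_mul_of_nonneg_left hl (by positivity)
      _ ≤ D / ((n : ℝ) + 1) := by
        rw [Finset.mul_sum, hD, Finset.sum_div]
        refine Finset.sum_le_sum fun i _ => ?_
        have h0 := hC0 i
        have h1 := hC i n x
        have h2 := SchwartzMap.le_seminorm ℝ (k + 1) (m - i) h x
        calc _ ≤ ‖x‖ ^ k * ((m.choose i : ℝ) * (C i * ‖x‖ / ((n : ℝ) + 1)) *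
              ‖iteratedFDeriv ℝ (m - i) h x‖) := by gcongr
          _ = (m.choose i : ℝ) * C i * (‖x‖ ^ (k + 1) * ‖iteratedFDeriv ℝ (m - i) h x‖) /
              ((n : ℝ) + 1) := by ring
          _ ≤ _ := by gcongr
  have ht : Tendsto (fun n : ℕ => D / ((n : ℝ) + 1)) atTop (𝓝 0) := by
    simpa [div_eq_mul_inv] using (tendsto_one_div_add_atTop_nhds_zero_nat (𝕜 := ℝ)).const_mul D
  filter_upwards [ht.eventually_lt_const hε] with n hn
  exact (hb n).trans_lt hn

/-- The truncated Fourier transform of `ρ`, in the normalisation of `IsTimeFourier`; Mathlib's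
transform `𝓕` uses the character `e^{-2πi x η}` instead, whence the rescaling of the frequency. -/
def truncTransform (ρ : ℝ → ℂ) (n : ℕ) (ξ : ℝ) : ℂ :=
  ((cutoff n (ξ / (2 * Real.pi)) * (Real.sqrt (2 * Real.pi))⁻¹ : ℝ) : ℂ) *
    𝓕 ρ (ξ / (2 * Real.pi))

lemma truncTransform_eq {ρ : ℝ → ℂ} (hρ : ContDiff ℝ ∞ ρ) (hρc : HasCompactSupport ρ) (n : ℕ)
    (ξ : ℝ) : truncTransform ρ n ξ = ((Real.sqrt (2 * Real.pi))⁻¹ : ℂ) *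
      truncate n (𝓕 (hρc.toSchwartzMap hρ)) (ξ / (2 * Real.pi)) := by
  rw [truncTransform, truncate_apply, SchwartzMap.fourier_coe]
  have : (⇑(hρc.toSchwartzMap hρ) : ℝ → ℂ) = ρ := rfl
  rw [this, Complex.real_smul]
  push_cast
  ring

lemma contDiff_truncTransform {ρ : ℝ → ℂ} (hρ : ContDiff ℝ ∞ ρ) (hρc : HasCompactSupport ρ)
    (n : ℕ) : ContDiff ℝ ∞ (truncTransform ρ n) := by
  have : truncTransform ρ n = _ := funext (truncTransform_eq hρ hρc n)
  rw [this]
  exact contDiff_const.mul (((truncate n _).smooth').comp (contDiff_id.div_const _))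

lemma hasCompactSupport_truncTransform (ρ : ℝ → ℂ) (n : ℕ) :
    HasCompactSupport (truncTransform ρ n) := by
  have h1 : HasCompactSupport fun ξ : ℝ => cutoff n (ξ / (2 * Real.pi)) := by
    have := (hasCompactSupport_cutoff n).comp_smul (c := (2 * Real.pi)⁻¹)
      (inv_ne_zero Real.two_pi_pos.ne')
    simpa only [smul_eq_mul, ← div_eq_inv_mul] using this
  refine HasCompactSupport.intro h1 fun ξ hξ => ?_
  rw [truncTransform, image_eq_zero_of_notMem_tsupport hξ]
  simp

/-- The action of the kernel on a test function is a limit of integrals against its Fourier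
transform. The truncation is needed because the Fourier transform of the kernel is only locally
integrable. -/
lemma IsTimeFourier.tendsto_integral {lam : ℝ → Linf ℝ} {lamHat : ℝ → Linf ℂ}
    (h : IsTimeFourier lam lamHat) {ρ : ℝ → ℂ} (hρ : ContDiff ℝ ∞ ρ) (hρc : HasCompactSupport ρ) :
    Tendsto (fun n => ∫ ξ, truncTransform ρ n ξ • lamHat ξ) atTop
      (𝓝 (∫ t, ρ t • toComplex (lam t))) := by
  obtain ⟨S, hS1, hS2⟩ := h
  set ρS := hρc.toSchwartzMap hρ with hρS
  have h1 : S ρS = ∫ t, ρ t • toComplex (lam t) := hS1 ρS hρc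
  have h2 : ∀ n, S (𝓕⁻ (truncate n (𝓕 ρS))) = ∫ ξ, truncTransform ρ n ξ • lamHat ξ := by
    intro n
    have hc := hasCompactSupport_truncTransform ρ n
    refine hS2 _ (hc.toSchwartzMap (contDiff_truncTransform hρ hρc n)) hc fun t => ?_
    change _ = _ * ∫ ξ : ℝ, truncTransform ρ n ξ * Complex.exp (Complex.I * ξ * t)
    simp only [truncTransform_eq hρ hρc]
    rw [SchwartzMap.fourierInv_coe, Real.fourierInv_eq']
    set g := truncate n (𝓕 ρS)
    have hpi : (0 : ℝ) < 2 * Real.pi := Real.two_pi_pos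
    have e1 : ∀ ξ : ℝ, ((Real.sqrt (2 * Real.pi))⁻¹ : ℂ) * g (ξ / (2 * Real.pi)) *
        Complex.exp (Complex.I * ξ * t) = ((Real.sqrt (2 * Real.pi))⁻¹ : ℂ) *
        (fun η : ℝ => Complex.exp (((2 * Real.pi * inner ℝ η t : ℝ) : ℂ) * Complex.I) • g η)
          (ξ / (2 * Real.pi)) := by
      intro ξ
      have : ((2 * Real.pi * inner ℝ (ξ / (2 * Real.pi)) t : ℝ) : ℂ) * Complex.I =
          Complex.I * ξ * t := by
        have h3 : 2 * Real.pi * inner ℝ (ξ / (2 * Real.pi)) t = ξ * t := by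
          simp only [RCLike.inner_apply, conj_trivial]
          field_simp
        rw [h3]
        push_cast
        ring
      simp only [this, smul_eq_mul]
      ring
    have e2 : ((Real.sqrt (2 * Real.pi))⁻¹ : ℂ) * ((Real.sqrt (2 * Real.pi))⁻¹ : ℂ) *
        ((2 * Real.pi : ℝ) : ℂ) = 1 := by
      have : (Real.sqrt (2 * Real.pi))⁻¹ * (Real.sqrt (2 * Real.pi))⁻¹ * (2 * Real.pi) = 1 := by
        rw [← mul_inv, Real.mul_self_sqrt hpi.le, inv_mul_cancel₀ hpi.ne']
      exact_mod_cast this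
    have e3 := Measure.integral_comp_div (fun η : ℝ =>
      Complex.exp (((2 * Real.pi * inner ℝ η t : ℝ) : ℂ) * Complex.I) • g η) (2 * Real.pi)
    simp only [e1]
    rw [integral_const_mul, e3, abs_of_pos hpi, Complex.real_smul,
      ← mul_assoc, ← mul_assoc, e2, one_mul]
  rw [← h1]
  simp only [← h2]
  have h3 : Tendsto (fun n => 𝓕⁻ (truncate n (𝓕 ρS))) atTop (𝓝 (𝓕⁻ (𝓕 ρS))) :=
    ((continuous_fourierInv (E := 𝓢(ℝ, ℂ))).tendsto _).comp (tendsto_truncate _)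
  rw [FourierTransform.fourierInv_fourier_eq] at h3
  exact (S.continuous.tendsto _).comp h3

end Cutoff

/-! ### Correlations and pairings -/

section Correlation

open Filter Topology FourierTransform ComplexConjugate
open scoped Convolution

/-- The correlation of two functions of time. -/
def correlation (φ ψ : ℝ → ℝ) (r : ℝ) : ℝ := ∫ s, φ s * ψ (r + s)

lemma correlation_eq_convolution (φ ψ : ℝ → ℝ) :
    correlation φ ψ = (fun s => φ (-s)) ⋆[ContinuousLinearMap.mul ℝ ℝ] ψ := by
  ext r
  rw [correlation, convolution_def, ← integral_neg_eq_self]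
  simp [sub_eq_add_neg]

lemma ofReal_correlation_eq_convolution (φ ψ : ℝ → ℝ) :
    (fun r => (correlation φ ψ r : ℂ)) =
      (fun s => (φ (-s) : ℂ)) ⋆[ContinuousLinearMap.mul ℂ ℂ] (fun s => (ψ s : ℂ)) := by
  ext r
  rw [correlation, convolution_def, ← integral_neg_eq_self, ← integral_complex_ofReal]
  simp [sub_eq_add_neg]

lemma contDiff_correlation {φ ψ : ℝ → ℝ} (hφ : Continuous φ) (hψ : ContDiff ℝ ∞ ψ)
    (hψc : HasCompactSupport ψ) : ContDiff ℝ ∞ (correlation φ ψ) := by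
  rw [correlation_eq_convolution]
  exact hψc.contDiff_convolution_right _ (hφ.comp continuous_neg).locallyIntegrable hψ

lemma hasCompactSupport_correlation {φ ψ : ℝ → ℝ} (hφc : HasCompactSupport φ)
    (hψc : HasCompactSupport ψ) : HasCompactSupport (correlation φ ψ) := by
  rw [correlation_eq_convolution]
  exact HasCompactSupport.convolution _ (hφc.comp_homeomorph (Homeomorph.neg ℝ)) hψc

lemma correlation_eq_zero {φ ψ : ℝ → ℝ} {T : ℝ} (hφ : ∀ s, s ∉ Ioo 0 T → φ s = 0)
    (hψ : ∀ s, s ∉ Ioo 0 T → ψ s = 0) {r : ℝ} (hr : r ∉ Ioo (-T) T) : correlation φ ψ r = 0 := by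
  refine integral_eq_zero_of_ae (Eventually.of_forall fun s => ?_)
  by_cases h1 : s ∈ Ioo 0 T
  · have h2 : r + s ∉ Ioo 0 T := fun h2 => hr ⟨by linarith [h1.2, h2.1], by linarith [h1.1, h2.2]⟩
    simp [hψ _ h2]
  · simp [hφ _ h1]

/-- The transform of a correlation is a product `z_φ * conj z_ψ`, which is what makes the quadratic
form of passivity appear. -/
lemma fourier_correlation {φ ψ : ℝ → ℝ} (hφ : Integrable φ) (hψ : Integrable ψ) (η : ℝ) :
    𝓕 (fun r => (correlation φ ψ r : ℂ)) η =
      𝓕⁻ (fun s => (φ s : ℂ)) η * conj (𝓕⁻ (fun s => (ψ s : ℂ)) η) := by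
  have h := Real.fourier_mul_convolution_eq (R := ℂ) (f₁ := fun s : ℝ => (φ (-s) : ℂ))
    (f₂ := fun s : ℝ => (ψ s : ℂ)) (hφ.comp_neg.ofReal (𝕜 := ℂ)) (hψ.ofReal (𝕜 := ℂ)) η
  rw [ofReal_correlation_eq_convolution]
  refine h.trans ?_
  rw [Real.fourierInv_eq_fourier_comp_neg]
  congr 1
  rw [Real.fourier_eq', Real.fourierInv_eq', ← integral_conj]
  refine integral_congr_ae (Eventually.of_forall fun s => ?_)
  have h2 : conj (2 : ℂ) = 2 := by exact_mod_cast Complex.conj_ofReal 2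
  simp [← Complex.exp_conj, h2]

/-- A double integral over the square `(0, T)²` with a kernel depending on the difference of the
times, in terms of the correlation of the weights. -/
lemma integral_kernel_eq_correlation {κ : ℝ → ℝ} (hκ : Integrable κ) {φ ψ : ℝ → ℝ} {T : ℝ}
    (hφ : Continuous φ) (hφc : HasCompactSupport φ) (hφ0 : ∀ s, s ∉ Ioo 0 T → φ s = 0)
    (hψ : Continuous ψ) (hψc : HasCompactSupport ψ) (hψ0 : ∀ s, s ∉ Ioo 0 T → ψ s = 0) :
    ∫ p, κ (p.1 - p.2) * (φ p.2 * ψ p.1) ∂(timeMeasure T).prod (timeMeasure T) =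
      ∫ r, κ r * correlation φ ψ r := by
  set F : ℝ × ℝ → ℝ := fun p => κ (p.1 - p.2) * (φ p.2 * ψ p.1) with hF
  obtain ⟨C, hC⟩ := hψ.bounded_above_of_compact_support hψc
  have h1 : Integrable F (volume.prod volume) := by
    have h2 := (hφ.integrable_of_hasCompactSupport hφc (μ := volume)).convolution_integrand
      (ContinuousLinearMap.mul ℝ ℝ) hκ
    refine (h2.mul_bdd (c := C) (hψ.comp continuous_fst).aestronglyMeasurable
      (Eventually.of_forall fun p => hC p.1)).congr (Eventually.of_forall fun p => ?_)
    simp only [ContinuousLinearMap.mul_apply', hF, Function.comp]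
    ring
  have h3 : Integrable (fun z : ℝ × ℝ => F (z.1 + z.2, z.2)) (volume.prod volume) :=
    (measurePreserving_add_prod (volume : Measure ℝ)
      (volume : Measure ℝ)).integrable_comp_of_integrable h1
  calc ∫ p, F p ∂(timeMeasure T).prod (timeMeasure T)
      = ∫ p, F p ∂(volume : Measure ℝ).prod volume := by
        rw [Measure.prod_restrict]
        refine setIntegral_eq_integral_of_forall_compl_eq_zero fun p hp => ?_
        rw [mem_prod, not_and_or] at hp
        rcases hp with hp | hp
        · simp [hF, hψ0 _ hp]
        · simp [hF, hφ0 _ hp]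
    _ = ∫ s, ∫ t, F (t, s) := integral_prod_symm F h1
    _ = ∫ s, ∫ r, F (r + s, s) := by
        refine integral_congr_ae (Eventually.of_forall fun s => ?_)
        exact (integral_add_right_eq_self (fun t => F (t, s)) s).symm
    _ = ∫ r, ∫ s, F (r + s, s) := (integral_integral_swap h3).symm
    _ = _ := by
        refine integral_congr_ae (Eventually.of_forall fun r => ?_)
        simp only [hF, add_sub_cancel_right, correlation, integral_const_mul]

end Correlation

section Pairing

open Filter Topology ComplexConjugate

lemma memLp_one_ofReal_mul (p q : L2) :
    MemLp (fun x => ((p x * q x : ℝ) : ℂ)) 1 (volume : Measure E3) :=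
  memLp_one_iff_integrable.2 ((integrable_mul_L2 p q).ofReal (𝕜 := ℂ))

/-- Integration of a bounded function against the product of two square integrable functions. -/
def pairCLM (p q : L2) : Linf ℂ →L[ℂ] ℂ :=
  ((ContinuousLinearMap.mul ℂ ℂ).lpPairing (volume : Measure E3) ∞ 1).flip
    ((memLp_one_ofReal_mul p q).toLp _)

lemma pairCLM_apply (p q : L2) (g : Linf ℂ) :
    pairCLM p q g = ∫ x, g x * ((p x * q x : ℝ) : ℂ) := by
  rw [pairCLM, ContinuousLinearMap.flip_apply, ContinuousLinearMap.lpPairing_eq_integral]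
  refine integral_congr_ae ?_
  filter_upwards [(memLp_one_ofReal_mul p q).coeFn_toLp] with x hx
  simp only [ContinuousLinearMap.mul_apply']
  rw [hx]

lemma integrable_pairing (p q : L2) (g : Linf ℂ) :
    Integrable fun x => g x * ((p x * q x : ℝ) : ℂ) :=
  ((integrable_mul_L2 p q).ofReal (𝕜 := ℂ)).mul_of_top_right (Lp.memLp g)

lemma pairCLM_toComplex (p q : L2) (g : Linf ℝ) :
    pairCLM p q (toComplex g) = ((∫ x, g x * p x * q x : ℝ) : ℂ) := by
  rw [pairCLM_apply, ← integral_complex_ofReal]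
  refine integral_congr_ae ?_
  filter_upwards [ContinuousLinearMap.coeFn_compLp Complex.ofRealCLM g] with x hx
  rw [toComplex, hx]
  simp [mul_assoc]

lemma locallyIntegrable_toComplex {lam : ℝ → Linf ℝ} (h : LocallyIntegrable lam) :
    LocallyIntegrable fun t => toComplex (lam t) := fun t => by
  obtain ⟨s, hs, hi⟩ := h t
  exact ⟨s, hs, (Complex.ofRealCLM.compLpL ∞ (volume : Measure E3)).integrable_comp hi⟩

end Pairing

/-! ### Passivity implies positivity on finite sums -/

section Passivity

open Filter Topology ComplexConjugate FourierTransform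

lemma truncTransform_correlation {φ ψ : ℝ → ℝ} (hφ : Integrable φ) (hψ : Integrable ψ) (n : ℕ)
    (ξ : ℝ) : truncTransform (fun r => (correlation φ ψ r : ℂ)) n ξ =
      ((cutoff n (ξ / (2 * Real.pi)) * (Real.sqrt (2 * Real.pi))⁻¹ : ℝ) : ℂ) *
        (𝓕⁻ (fun s => (φ s : ℂ)) (ξ / (2 * Real.pi)) *
          conj (𝓕⁻ (fun s => (ψ s : ℂ)) (ξ / (2 * Real.pi)))) := by
  rw [truncTransform, fourier_correlation hφ hψ]

/-- The algebraic identity turning a sum over rank one terms into the quadratic form of a matrix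
evaluated at a superposition. -/
lemma sum_quadratic_form {m : ℕ} (A : Idx → Idx → ℂ) (z : Fin m → ℂ) (a : Fin m → Idx → ℝ) :
    ∑ k, ∑ l, ∑ i, ∑ j, (z k * conj (z l)) * (A i j * ((a k j * a l i : ℝ) : ℂ)) =
      ∑ i, ∑ j, A i j * (∑ k, z k * (a k j : ℂ)) * conj (∑ k, z k * (a k i : ℂ)) := by
  have h : ∀ i j, A i j * (∑ k, z k * (a k j : ℂ)) * conj (∑ k, z k * (a k i : ℂ)) =
      ∑ k, ∑ l, (z k * conj (z l)) * (A i j * ((a k j * a l i : ℝ) : ℂ)) := by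
    intro i j
    rw [map_sum, mul_assoc, Finset.sum_mul_sum, Finset.mul_sum]
    refine Finset.sum_congr rfl fun k _ => ?_
    rw [Finset.mul_sum]
    refine Finset.sum_congr rfl fun l _ => ?_
    simp only [map_mul, Complex.conj_ofReal, Complex.ofReal_mul]
    ring
  simp only [h]
  rw [Finset.sum_congr rfl fun k _ => Finset.sum_comm, Finset.sum_comm]
  refine Finset.sum_congr rfl fun i _ => ?_
  rw [Finset.sum_congr rfl fun k _ => Finset.sum_comm, Finset.sum_comm]

/-- Passivity at a fixed frequency, integrated over space against finitely many fields with complex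
amplitudes. -/
lemma re_sum_pairCLM_nonneg {A : Matrix Idx Idx (Linf ℂ)}
    (hA : ∀ᵐ x : E3, ∀ X : Idx → ℂ, 0 ≤ (∑ i, ∑ j, A i j x * X j * conj (X i)).re)
    {m : ℕ} (z : Fin m → ℂ) (e : Fin m → H) :
    0 ≤ (∑ k, ∑ l, ∑ i, ∑ j, (z k * conj (z l)) * pairCLM (e k j) (e l i) (A i j)).re := by
  have hI : ∀ k l i j, Integrable fun x =>
      (z k * conj (z l)) * (A i j x * ((e k j x * e l i x : ℝ) : ℂ)) := fun k l i j =>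
    (integrable_pairing _ _ _).const_mul _
  have h1 : ∑ k, ∑ l, ∑ i, ∑ j, (z k * conj (z l)) * pairCLM (e k j) (e l i) (A i j) =
      ∫ x, ∑ k, ∑ l, ∑ i, ∑ j, (z k * conj (z l)) * (A i j x * ((e k j x * e l i x : ℝ) : ℂ)) := by
    rw [integral_finsetSum _ fun k _ => integrable_finsetSum _ fun l _ =>
      integrable_finsetSum _ fun i _ => integrable_finsetSum _ fun j _ => hI k l i j]
    refine Finset.sum_congr rfl fun k _ => ?_
    rw [integral_finsetSum _ fun l _ =>
      integrable_finsetSum _ fun i _ => integrable_finsetSum _ fun j _ => hI k l i j]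
    refine Finset.sum_congr rfl fun l _ => ?_
    rw [integral_finsetSum _ fun i _ => integrable_finsetSum _ fun j _ => hI k l i j]
    refine Finset.sum_congr rfl fun i _ => ?_
    rw [integral_finsetSum _ fun j _ => hI k l i j]
    refine Finset.sum_congr rfl fun j _ => ?_
    rw [integral_const_mul, pairCLM_apply]
  have h2 : Integrable fun x => ∑ k, ∑ l, ∑ i, ∑ j,
      (z k * conj (z l)) * (A i j x * ((e k j x * e l i x : ℝ) : ℂ)) :=
    integrable_finsetSum _ fun k _ => integrable_finsetSum _ fun l _ =>
      integrable_finsetSum _ fun i _ => integrable_finsetSum _ fun j _ => hI k l i j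
  have h3 := Complex.reCLM.integral_comp_comm h2
  rw [h1]
  change 0 ≤ Complex.reCLM _
  rw [← h3]
  refine integral_nonneg_of_ae ?_
  filter_upwards [hA] with x hx
  have h4 := sum_quadratic_form (fun i j => A i j x) z (fun k j => e k j x)
  simp only at h4
  change 0 ≤ (_ : ℂ).re
  rw [h4]
  exact hx _

variable {Λ : ℝ → Matrix Idx Idx (Linf ℝ)} {ΛHat : ℝ → Matrix Idx Idx (Linf ℂ)}

/-- Positivity of the kernel on fields that are finite sums of products of functions of time and
of space: by the convergence of truncated Fourier integrals it follows from passivity. -/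
lemma sum_integral_correlation_nonneg
    (hΛ : ∀ i j, LocallyIntegrable (fun t => Λ t i j) volume)
    (hΛHat : ∀ i j, LocallyIntegrable (fun ξ => ΛHat ξ i j) volume)
    (hFourier : ∀ i j, IsTimeFourier (fun t => Λ t i j) (fun ξ => ΛHat ξ i j))
    (hpassive : IsPassive ΛHat) {m : ℕ} {φ : Fin m → ℝ → ℝ} (hφ : ∀ k, ContDiff ℝ ∞ (φ k))
    (hφc : ∀ k, HasCompactSupport (φ k)) (e : Fin m → H) :
    0 ≤ ∑ k, ∑ l, ∫ r, inner ℝ (mulOp (Λ r) (e k)) (e l) * correlation (φ k) (φ l) r := by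
  have hφi : ∀ k, Integrable (φ k) := fun k =>
    (hφ k).continuous.integrable_of_hasCompactSupport (hφc k)
  set ρ : Fin m → Fin m → ℝ → ℂ := fun k l r => (correlation (φ k) (φ l) r : ℂ) with hρdef
  have hρ : ∀ k l, ContDiff ℝ ∞ (ρ k l) := fun k l =>
    Complex.ofRealCLM.contDiff.comp (contDiff_correlation (hφ k).continuous (hφ l) (hφc l))
  have hρc : ∀ k l, HasCompactSupport (ρ k l) := fun k l =>
    (hasCompactSupport_correlation (hφc k) (hφc l)).comp_left (g := Complex.ofReal)
      Complex.ofReal_zero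
  set L : Fin m → Fin m → Idx → Idx → Linf ℂ →L[ℝ] ℝ := fun k l i j =>
    Complex.reCLM ∘L (pairCLM (e k j) (e l i)).restrictScalars ℝ with hL
  have hIt : ∀ k l i j, Integrable fun t => ρ k l t • toComplex (Λ t i j) := fun k l i j =>
    (locallyIntegrable_toComplex (hΛ i j)).integrable_smul_left_of_hasCompactSupport
      (hρ k l).continuous (hρc k l)
  have hIξ : ∀ n k l i j, Integrable fun ξ => truncTransform (ρ k l) n ξ • ΛHat ξ i j :=
    fun n k l i j => (hΛHat i j).integrable_smul_left_of_hasCompactSupport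
      (contDiff_truncTransform (hρ k l) (hρc k l) n).continuous
      (hasCompactSupport_truncTransform _ n)
  -- the sum as the value of continuous functionals at the integrals of the kernel
  have h1 : ∑ k, ∑ l, ∫ r, inner ℝ (mulOp (Λ r) (e k)) (e l) * correlation (φ k) (φ l) r =
      ∑ k, ∑ l, ∑ i, ∑ j, L k l i j (∫ t, ρ k l t • toComplex (Λ t i j)) := by
    refine Finset.sum_congr rfl fun k _ => Finset.sum_congr rfl fun l _ => ?_
    have hLt : ∀ i j t, L k l i j (ρ k l t • toComplex (Λ t i j)) =
        (∫ x, Λ t i j x * e k j x * e l i x) * correlation (φ k) (φ l) t := by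
      intro i j t
      simp only [hL, hρdef, ContinuousLinearMap.comp_apply,
        ContinuousLinearMap.coe_restrictScalars', map_smul, smul_eq_mul, pairCLM_toComplex,
        Complex.reCLM_apply, ← Complex.ofReal_mul, Complex.ofReal_re]
      ring
    have hLi : ∀ i j, Integrable fun t =>
        (∫ x, Λ t i j x * e k j x * e l i x) * correlation (φ k) (φ l) t := fun i j =>
      ((L k l i j).integrable_comp (hIt k l i j)).congr (Eventually.of_forall fun t => hLt i j t)
    simp only [inner_mulOp, Finset.sum_mul]
    rw [integral_finsetSum _ fun i _ => integrable_finsetSum _ fun j _ => hLi i j]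
    refine Finset.sum_congr rfl fun i _ => ?_
    rw [integral_finsetSum _ fun j _ => hLi i j]
    refine Finset.sum_congr rfl fun j _ => ?_
    rw [← (L k l i j).integral_comp_comm (hIt k l i j)]
    simp only [hLt]
  rw [h1]
  have hlim : Tendsto (fun n => ∑ k, ∑ l, ∑ i, ∑ j,
      L k l i j (∫ ξ, truncTransform (ρ k l) n ξ • ΛHat ξ i j)) atTop
      (𝓝 (∑ k, ∑ l, ∑ i, ∑ j, L k l i j (∫ t, ρ k l t • toComplex (Λ t i j)))) :=
    tendsto_finsetSum _ fun k _ => tendsto_finsetSum _ fun l _ => tendsto_finsetSum _ fun i _ =>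
      tendsto_finsetSum _ fun j _ => ((L k l i j).continuous.tendsto _).comp
        ((hFourier i j).tendsto_integral (hρ k l) (hρc k l))
  -- each approximation is an integral over frequencies of the quadratic form of passivity
  refine ge_of_tendsto' hlim fun n => ?_
  have hI : ∀ k l i j, Integrable fun ξ => L k l i j (truncTransform (ρ k l) n ξ • ΛHat ξ i j) :=
    fun k l i j => (L k l i j).integrable_comp (hIξ n k l i j)
  have h2 : ∑ k, ∑ l, ∑ i, ∑ j, L k l i j (∫ ξ, truncTransform (ρ k l) n ξ • ΛHat ξ i j) =
      ∫ ξ, ∑ k, ∑ l, ∑ i, ∑ j, L k l i j (truncTransform (ρ k l) n ξ • ΛHat ξ i j) := by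
    rw [integral_finsetSum _ fun k _ => integrable_finsetSum _ fun l _ =>
      integrable_finsetSum _ fun i _ => integrable_finsetSum _ fun j _ => hI k l i j]
    refine Finset.sum_congr rfl fun k _ => ?_
    rw [integral_finsetSum _ fun l _ =>
      integrable_finsetSum _ fun i _ => integrable_finsetSum _ fun j _ => hI k l i j]
    refine Finset.sum_congr rfl fun l _ => ?_
    rw [integral_finsetSum _ fun i _ => integrable_finsetSum _ fun j _ => hI k l i j]
    refine Finset.sum_congr rfl fun i _ => ?_
    rw [integral_finsetSum _ fun j _ => hI k l i j]
    refine Finset.sum_congr rfl fun j _ => ?_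
    rw [(L k l i j).integral_comp_comm (hIξ n k l i j)]
  rw [h2]
  refine integral_nonneg_of_ae ?_
  filter_upwards [hpassive] with ξ hξ
  set w : ℝ := cutoff n (ξ / (2 * Real.pi)) * (Real.sqrt (2 * Real.pi))⁻¹ with hw
  have hw0 : 0 ≤ w := mul_nonneg (cutoff_nonneg _ _) (by positivity)
  set z : Fin m → ℂ := fun k => 𝓕⁻ (fun s => (φ k s : ℂ)) (ξ / (2 * Real.pi)) with hz
  have h3 : ∀ k l i j, L k l i j (truncTransform (ρ k l) n ξ • ΛHat ξ i j) =
      w * ((z k * conj (z l)) * pairCLM (e k j) (e l i) (ΛHat ξ i j)).re := by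
    intro k l i j
    simp only [hL, hρdef, ContinuousLinearMap.comp_apply,
      ContinuousLinearMap.coe_restrictScalars', map_smul, smul_eq_mul, Complex.reCLM_apply,
      truncTransform_correlation (hφi k) (hφi l)]
    rw [mul_assoc, Complex.re_ofReal_mul]
  have h4 := re_sum_pairCLM_nonneg hξ z e
  simp only [Complex.re_sum] at h4
  simp only [h3, ← Finset.mul_sum]
  exact mul_nonneg hw0 h4

end Passivity

/-! ### Positivity of passive kernels -/

section Density

open Filter Topology

variable {X : Type*} [NormedAddCommGroup X] [InnerProductSpace ℝ X]

lemma integral_kernel_mul_right_le {k : ℝ → ℝ} (hk : Integrable k) (hk0 : ∀ r, 0 ≤ k r) {T : ℝ}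
    {b : ℝ → ℝ} (hb : Integrable b (timeMeasure T)) (hb0 : ∀ s, 0 ≤ b s) :
    ∫ p, k (p.1 - p.2) * b p.2 ∂(timeMeasure T).prod (timeMeasure T) ≤
      (∫ r, k r) * ∫ s, b s ∂timeMeasure T := by
  have h := integrable_kernel_mul_right hk hb
  rw [integral_prod_symm _ h, ← integral_const_mul]
  refine integral_mono h.integral_prod_right (hb.const_mul _) fun s => ?_
  simp only
  rw [integral_mul_const]
  refine mul_le_mul_of_nonneg_right ?_ (hb0 s)
  rw [← integral_sub_right_eq_self k s]
  exact setIntegral_le_integral (hk.comp_sub_right s) (Eventually.of_forall fun t => hk0 _)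

lemma integral_kernel_mul_left_le {k : ℝ → ℝ} (hk : Integrable k) (hk0 : ∀ r, 0 ≤ k r) {T : ℝ}
    {b : ℝ → ℝ} (hb : Integrable b (timeMeasure T)) (hb0 : ∀ s, 0 ≤ b s) :
    ∫ p, k (p.1 - p.2) * b p.1 ∂(timeMeasure T).prod (timeMeasure T) ≤
      (∫ r, k r) * ∫ s, b s ∂timeMeasure T := by
  have h := integral_kernel_mul_right_le (k := fun r => k (-r)) hk.comp_neg (fun r => hk0 _) hb hb0
  rw [integral_neg_eq_self k, ← integral_prod_swap] at h
  simpa using h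

/-- Boundedness on `L²` of the bilinear form of an integrable kernel. -/
lemma abs_integral_kernel_inner_le {K : ℝ → X →L[ℝ] X} (hK : Integrable K) {T : ℝ} {a b : ℝ → X}
    (ha : MemLp a 2 (timeMeasure T)) (hb : MemLp b 2 (timeMeasure T)) :
    |∫ p, inner ℝ (K (p.1 - p.2) (a p.2)) (b p.1) ∂(timeMeasure T).prod (timeMeasure T)| ≤
      (∫ r, ‖K r‖) / 2 * ((∫ s, ‖a s‖ ^ 2 ∂timeMeasure T) + ∫ s, ‖b s‖ ^ 2 ∂timeMeasure T) := by
  have ha2 : Integrable (fun s => ‖a s‖ ^ 2) (timeMeasure T) := ha.integrable_norm_pow (by simp)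
  have hb2 : Integrable (fun s => ‖b s‖ ^ 2) (timeMeasure T) := hb.integrable_norm_pow (by simp)
  have i1 := integrable_kernel_mul_right hK.norm ha2
  have i2 := integrable_kernel_mul_left hK.norm hb2
  have h1 := norm_integral_le_of_norm_le ((i1.add i2).const_mul (1 / 2))
    (f := fun p : ℝ × ℝ => inner ℝ (K (p.1 - p.2) (a p.2)) (b p.1))
    (Eventually.of_forall fun p => by
      refine (norm_inner_apply_le _ _ _).trans ?_
      simp only [Pi.add_apply]
      nlinarith [mul_nonneg (norm_nonneg (K (p.1 - p.2))) (sq_nonneg (‖a p.2‖ - ‖b p.1‖))])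
  rw [Real.norm_eq_abs] at h1
  refine h1.trans ?_
  rw [integral_const_mul, integral_add' i1 i2]
  have e1 := integral_kernel_mul_right_le hK.norm (fun r => norm_nonneg _) ha2
    (fun s => by positivity)
  have e2 := integral_kernel_mul_left_le hK.norm (fun r => norm_nonneg _) hb2
    (fun s => by positivity)
  linarith

lemma memLp_smul_const_of_test {φ : ℝ → ℝ} (hφ : Continuous φ) (hφc : HasCompactSupport φ) (e : X)
    (T : ℝ) (p : ℝ≥0∞) : MemLp (fun t => φ t • e) p (timeMeasure T) :=
  (Continuous.memLp_of_hasCompactSupport (hφ.smul continuous_const)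
    (hφc.smul_right (f' := fun _ => e))).restrict _

/-- Finite sums of products of test functions on `(0, T)` and vectors are dense in
`L²(0, T; X)`. -/
lemma exists_sum_smul_approx [CompleteSpace X] {T : ℝ} {a : ℝ → X}
    (ha : MemLp a 2 (timeMeasure T)) {δ : ℝ} (hδ : 0 < δ) :
    ∃ (m : ℕ) (φ : Fin m → ℝ → ℝ) (e : Fin m → X), (∀ k, ContDiff ℝ ∞ (φ k)) ∧
      (∀ k, HasCompactSupport (φ k)) ∧ (∀ k, tsupport (φ k) ⊆ Ioo 0 T) ∧
      ∫ t, ‖a t - ∑ k, φ k t • e k‖ ^ 2 ∂timeMeasure T ≤ δ ^ 2 := by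
  set S : Set (Lp X 2 (timeMeasure T)) := {g | ∃ (φ : ℝ → ℝ) (e : X), ContDiff ℝ ∞ φ ∧
    HasCompactSupport φ ∧ tsupport φ ⊆ Ioo 0 T ∧ g =ᵐ[timeMeasure T] fun t => φ t • e} with hS
  have hd : (Submodule.span ℝ S).topologicalClosure = ⊤ := by
    rw [Submodule.topologicalClosure_eq_top_iff, Submodule.eq_bot_iff]
    intro g hg
    rw [Submodule.mem_orthogonal] at hg
    have hgl : Integrable g (timeMeasure T) := (Lp.memLp g).integrable (by norm_num)
    have h0 : ∀ φ : ℝ → ℝ, ContDiff ℝ ∞ φ → HasCompactSupport φ → tsupport φ ⊆ Ioo 0 T →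
        ∫ t, φ t • g t = 0 := by
      intro φ hφ hφc hφT
      have hi : Integrable (fun t => φ t • g t) (timeMeasure T) := by
        obtain ⟨C, hC⟩ := hφ.continuous.bounded_above_of_compact_support hφc
        exact hgl.bdd_smul C hφ.continuous.aestronglyMeasurable (Eventually.of_forall hC)
      have he : ∫ t, φ t • g t = ∫ t, φ t • g t ∂timeMeasure T := by
        refine (setIntegral_eq_integral_of_forall_compl_eq_zero fun t ht => ?_).symm
        rw [image_eq_zero_of_notMem_tsupport fun h => ht (hφT h), zero_smul]
      rw [he]
      refine ext_inner_left ℝ fun e => ?_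
      rw [← integral_inner hi, inner_zero_right]
      have hm := memLp_smul_const_of_test hφ.continuous hφc e T 2
      have h1 := hg (hm.toLp _) (Submodule.subset_span ⟨φ, e, hφ, hφc, hφT, hm.coeFn_toLp⟩)
      rw [L2.inner_def] at h1
      refine Eq.trans (integral_congr_ae ?_) h1
      filter_upwards [hm.coeFn_toLp] with t ht
      rw [ht, inner_smul_right, real_inner_smul_left]
    have h2 := isOpen_Ioo.ae_eq_zero_of_integral_contDiff_smul_eq_zero (U := Ioo 0 T)
      (f := (g : ℝ → X)) (μ := volume) (IntegrableOn.locallyIntegrableOn hgl) h0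
    rw [Lp.eq_zero_iff_ae_eq_zero]
    exact (ae_restrict_iff' measurableSet_Ioo).2 h2
  have hmem : ha.toLp a ∈ closure (Submodule.span ℝ S : Set (Lp X 2 (timeMeasure T))) := by
    rw [← Submodule.topologicalClosure_coe, hd]
    trivial
  obtain ⟨v, hv, hav⟩ := Metric.mem_closure_iff.1 hmem δ hδ
  obtain ⟨m, r, g, rfl⟩ := Submodule.mem_span_set'.1 hv
  choose φ e hφ hφc hφT hg using fun i => (g i).2
  refine ⟨m, fun i t => r i * φ i t, e, fun i => contDiff_const.mul (hφ i),
    fun i => (hφc i).mul_left, fun i => (tsupport_mul_subset_right).trans (hφT i), ?_⟩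
  rw [dist_eq_norm] at hav
  set d := ha.toLp a - ∑ i, r i • (g i : Lp X 2 (timeMeasure T)) with hddef
  have h3 : (d : ℝ → X) =ᵐ[timeMeasure T] fun t => a t - ∑ k, (r k * φ k t) • e k := by
    have hg' : ∀ᵐ t ∂timeMeasure T, ∀ i, (g i : Lp X 2 (timeMeasure T)) t = φ i t • e i :=
      ae_all_iff.2 fun i => hg i
    have hr : ∀ᵐ t ∂timeMeasure T, ∀ i, (r i • (g i : Lp X 2 (timeMeasure T)) :) t =
        r i • (g i : Lp X 2 (timeMeasure T)) t := ae_all_iff.2 fun i => Lp.coeFn_smul _ _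
    filter_upwards [Lp.coeFn_sub (ha.toLp a) (∑ i, r i • (g i : Lp X 2 (timeMeasure T))),
      ha.coeFn_toLp, hg', hr,
      Lp.coeFn_finsetSum Finset.univ (fun i => r i • (g i : Lp X 2 (timeMeasure T)))]
      with t h1 h2 h3 h4 h5
    rw [h1, Pi.sub_apply, h2, h5]
    simp [h4, h3, mul_smul]
  have h4 : ‖d‖ ^ 2 = ∫ t, ‖a t - ∑ k, (r k * φ k t) • e k‖ ^ 2 ∂timeMeasure T := by
    rw [← real_inner_self_eq_norm_sq, L2.inner_def]
    refine integral_congr_ae ?_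
    filter_upwards [h3] with t ht
    rw [ht, real_inner_self_eq_norm_sq]
  rw [← h4]
  gcongr

/-- Positivity of a kernel may be tested on finite sums of products of test functions and
vectors. -/
lemma isPositiveKernel_of_sum_smul [CompleteSpace X] {K : ℝ → X →L[ℝ] X} (hK : Integrable K)
    {T : ℝ} (h : ∀ (m : ℕ) (φ : Fin m → ℝ → ℝ) (e : Fin m → X), (∀ k, ContDiff ℝ ∞ (φ k)) →
      (∀ k, HasCompactSupport (φ k)) → (∀ k, tsupport (φ k) ⊆ Ioo 0 T) →
      0 ≤ ∫ p, inner ℝ (K (p.1 - p.2) (∑ k, φ k p.2 • e k)) (∑ k, φ k p.1 • e k)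
        ∂(timeMeasure T).prod (timeMeasure T)) : IsPositiveKernel K T := by
  intro a ha
  replace ha : MemLp a 2 (timeMeasure T) := ha.mono_exponent le_top
  set κ := ∫ r, ‖K r‖ with hκ
  have hκ0 : 0 ≤ κ := integral_nonneg fun r => norm_nonneg _
  set A := ∫ s, ‖a s‖ ^ 2 ∂timeMeasure T with hA
  have key : ∀ δ : ℝ, 0 < δ → δ ≤ 1 → -(δ * (κ * (2 + A))) ≤
      ∫ p, inner ℝ (K (p.1 - p.2) (a p.2)) (a p.1) ∂(timeMeasure T).prod (timeMeasure T) := by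
    intro δ hδ hδ1
    obtain ⟨m, φ, e, hφ, hφc, hφT, hle⟩ := exists_sum_smul_approx ha hδ
    have hb0 := h m φ e hφ hφc hφT
    set b : ℝ → X := fun t => ∑ k, φ k t • e k with hb
    have hbm : MemLp b 2 (timeMeasure T) :=
      memLp_finsetSum _ fun k _ => memLp_smul_const_of_test (hφ k).continuous (hφc k) (e k) T 2
    set d : ℝ → X := fun t => a t - b t with hd
    have hdm : MemLp d 2 (timeMeasure T) := ha.sub hbm
    have hdδ : MemLp (fun t => δ⁻¹ • d t) 2 (timeMeasure T) := hdm.const_smul _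
    have hn : ∫ s, ‖δ⁻¹ • d s‖ ^ 2 ∂timeMeasure T ≤ 1 := by
      simp only [norm_smul, mul_pow, integral_const_mul]
      rw [Real.norm_of_nonneg (by positivity)]
      calc δ⁻¹ ^ 2 * _ ≤ δ⁻¹ ^ 2 * δ ^ 2 := by gcongr
        _ = 1 := by field_simp
    -- rescaling `d` by `δ⁻¹` makes the cross terms of order `δ`
    have e1 := abs_integral_kernel_inner_le hK hdδ ha
    have e2 := abs_integral_kernel_inner_le hK ha hdδ
    have e3 := abs_integral_kernel_inner_le hK hdm hdm
    have i1 := integrable_kernel_inner_of_memLp_two hK hdm ha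
    have i2 := integrable_kernel_inner_of_memLp_two hK ha hdm
    have i3 := integrable_kernel_inner_of_memLp_two hK hdm hdm
    have i0 := integrable_kernel_inner_of_memLp_two hK ha ha
    simp only [map_smul, real_inner_smul_left, real_inner_smul_right, integral_const_mul] at e1 e2
    have hsplit : ∫ p, inner ℝ (K (p.1 - p.2) (b p.2)) (b p.1)
          ∂(timeMeasure T).prod (timeMeasure T) =
        (∫ p, inner ℝ (K (p.1 - p.2) (a p.2)) (a p.1) ∂(timeMeasure T).prod (timeMeasure T))
        - (∫ p, inner ℝ (K (p.1 - p.2) (d p.2)) (a p.1) ∂(timeMeasure T).prod (timeMeasure T))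
        - (∫ p, inner ℝ (K (p.1 - p.2) (a p.2)) (d p.1) ∂(timeMeasure T).prod (timeMeasure T))
        + ∫ p, inner ℝ (K (p.1 - p.2) (d p.2)) (d p.1)
          ∂(timeMeasure T).prod (timeMeasure T) := by
      have i4 : Integrable (fun p : ℝ × ℝ => inner ℝ (K (p.1 - p.2) (a p.2)) (a p.1) -
          inner ℝ (K (p.1 - p.2) (d p.2)) (a p.1)) ((timeMeasure T).prod (timeMeasure T)) :=
        i0.sub i1
      have i5 : Integrable (fun p : ℝ × ℝ => inner ℝ (K (p.1 - p.2) (a p.2)) (a p.1) -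
          inner ℝ (K (p.1 - p.2) (d p.2)) (a p.1) - inner ℝ (K (p.1 - p.2) (a p.2)) (d p.1))
          ((timeMeasure T).prod (timeMeasure T)) := i4.sub i2
      rw [← integral_sub i0 i1, ← integral_sub i4 i2, ← integral_add i5 i3]
      refine integral_congr_ae (Eventually.of_forall fun p => ?_)
      have hbd : ∀ t, b t = a t - d t := fun t => by simp [hd]
      simp only [hbd, map_sub, inner_sub_left, inner_sub_right]
      ring
    set q1 := ∫ p, inner ℝ (K (p.1 - p.2) (d p.2)) (a p.1) ∂(timeMeasure T).prod (timeMeasure T)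
    set q2 := ∫ p, inner ℝ (K (p.1 - p.2) (a p.2)) (d p.1) ∂(timeMeasure T).prod (timeMeasure T)
    set q3 := ∫ p, inner ℝ (K (p.1 - p.2) (d p.2)) (d p.1) ∂(timeMeasure T).prod (timeMeasure T)
    have scale : ∀ q : ℝ, |δ⁻¹ * q| ≤ κ / 2 * (1 + A) → |q| ≤ δ * (κ / 2 * (1 + A)) := by
      intro q hq
      rw [abs_mul, abs_of_pos (inv_pos.2 hδ)] at hq
      rwa [inv_mul_le_iff₀ hδ] at hq
    have f1 : |q1| ≤ δ * (κ / 2 * (1 + A)) := scale _ (e1.trans (by gcongr))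
    have f2 : |q2| ≤ δ * (κ / 2 * (1 + A)) :=
      scale _ (e2.trans (by rw [add_comm]; gcongr))
    have f3 : |q3| ≤ δ * κ := by
      refine e3.trans ?_
      calc κ / 2 * (_ + _) ≤ κ / 2 * (δ ^ 2 + δ ^ 2) := by gcongr
        _ = κ * δ ^ 2 := by ring
        _ ≤ κ * δ := by gcongr; nlinarith
        _ = δ * κ := mul_comm _ _
    have g1 := (abs_le.1 f1).1
    have g2 := (abs_le.1 f2).1
    have g3 := (abs_le.1 f3).2
    rw [hsplit] at hb0
    linarith
  have hlim : Tendsto (fun n : ℕ => -(1 / ((n : ℝ) + 1) * (κ * (2 + A)))) atTop (𝓝 0) := by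
    simpa using ((tendsto_one_div_add_atTop_nhds_zero_nat (𝕜 := ℝ)).mul_const (κ * (2 + A))).neg
  refine le_of_tendsto' hlim fun n => key _ (by positivity) ?_
  rw [div_le_one (by positivity)]
  linarith [n.cast_nonneg (α := ℝ)]

end Density

section PassiveKernel

variable {Λ : ℝ → Matrix Idx Idx (Linf ℝ)} {ΛHat : ℝ → Matrix Idx Idx (Linf ℂ)}

/-- The convolution with a passive kernel is a positive operator. -/
lemma isPositiveKernel_kernelOp
    (hΛ : ∀ i j, LocallyIntegrable (fun t => Λ t i j) volume)
    (hΛHat : ∀ i j, LocallyIntegrable (fun ξ => ΛHat ξ i j) volume)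
    (hFourier : ∀ i j, IsTimeFourier (fun t => Λ t i j) (fun ξ => ΛHat ξ i j))
    (hpassive : IsPassive ΛHat) (T : ℝ) : IsPositiveKernel (kernelOp Λ T) T := by
  have hK := integrable_kernelOp hΛ T
  refine isPositiveKernel_of_sum_smul hK fun m φ e hφ hφc hφT => ?_
  have hφ0 : ∀ k s, s ∉ Ioo 0 T → φ k s = 0 := fun k s hs =>
    image_eq_zero_of_notMem_tsupport fun h => hs (hφT k h)
  have hκ : ∀ k l, Integrable fun r => inner ℝ (kernelOp Λ T r (e k)) (e l) := fun k l =>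
    (hK.apply_continuousLinearMap (e k)).inner_const (e l)
  have hI : ∀ k l, Integrable (fun p : ℝ × ℝ =>
      inner ℝ (kernelOp Λ T (p.1 - p.2) (e k)) (e l) * (φ k p.2 * φ l p.1))
      ((timeMeasure T).prod (timeMeasure T)) := by
    intro k l
    obtain ⟨C, hC⟩ := (hφ l).continuous.bounded_above_of_compact_support (hφc l)
    refine ((integrable_kernel_mul_right (hκ k l)
      (((hφ k).continuous.integrable_of_hasCompactSupport (hφc k)).restrict)).mul_bdd (c := C)
      ((hφ l).continuous.comp continuous_fst).aestronglyMeasurable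
      (Filter.Eventually.of_forall fun p => hC p.1)).congr (Filter.Eventually.of_forall fun p => ?_)
    simp only [Function.comp]
    ring
  have h1 : ∫ p, inner ℝ (kernelOp Λ T (p.1 - p.2) (∑ k, φ k p.2 • e k)) (∑ k, φ k p.1 • e k)
        ∂(timeMeasure T).prod (timeMeasure T) =
      ∑ k, ∑ l, ∫ p, inner ℝ (kernelOp Λ T (p.1 - p.2) (e k)) (e l) * (φ k p.2 * φ l p.1)
        ∂(timeMeasure T).prod (timeMeasure T) := by
    have h2 := fun k => integral_finsetSum Finset.univ fun l _ => hI k l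
    simp only [← h2]
    rw [← integral_finsetSum _ fun k _ => integrable_finsetSum _ fun l _ => hI k l]
    refine integral_congr_ae (Filter.Eventually.of_forall fun p => ?_)
    simp only [map_sum, map_smul, sum_inner, inner_sum, real_inner_smul_left,
      real_inner_smul_right]
    rw [Finset.sum_comm]
    refine Finset.sum_congr rfl fun k _ => Finset.sum_congr rfl fun l _ => ?_
    ring
  rw [h1]
  refine (sum_integral_correlation_nonneg hΛ hΛHat hFourier hpassive hφ hφc e).trans_eq ?_
  refine Finset.sum_congr rfl fun k _ => Finset.sum_congr rfl fun l _ => ?_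
  rw [integral_kernel_eq_correlation (hκ k l) (hφ k).continuous (hφc k) (hφ0 k)
    (hφ l).continuous (hφc l) (hφ0 l)]
  refine integral_congr_ae (Filter.Eventually.of_forall fun r => ?_)
  by_cases hr : r ∈ Ioo (-T) T
  · simp [kernelOp, hr]
  · simp [correlation_eq_zero (hφ0 k) (hφ0 l) hr]

end PassiveKernel

/-! ### Weak solutions -/

section DistributionalDerivative

open Filter Topology

/-- A test function on `(0, T)` with zero mean is the derivative of a test function. -/
lemma exists_test_primitive {T : ℝ} (hT : 0 < T) {ψ : ℝ → ℝ} (hψ : ContDiff ℝ ∞ ψ)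
    (hψc : HasCompactSupport ψ) (hψT : tsupport ψ ⊆ Ioo 0 T) (h0 : ∫ t, ψ t = 0) :
    ∃ φ : ℝ → ℝ, ContDiff ℝ ∞ φ ∧ HasCompactSupport φ ∧ tsupport φ ⊆ Ioo 0 T ∧ deriv φ = ψ := by
  -- outside a compact subinterval containing the support, the primitive is `0` or the mean
  obtain ⟨α, β, hα, hβ, hαβ⟩ : ∃ α β, 0 < α ∧ β < T ∧ tsupport ψ ⊆ Icc α β := by
    rcases (tsupport ψ).eq_empty_or_nonempty with he | hne
    · exact ⟨T / 2, T / 2, by linarith, by linarith, by simp [he]⟩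
    · obtain ⟨α, hα⟩ := IsCompact.exists_isLeast hψc hne
      obtain ⟨β, hβ⟩ := IsCompact.exists_isGreatest hψc hne
      exact ⟨α, β, (hψT hα.1).1, (hψT hβ.1).2, fun x hx => ⟨hα.2 hx, hβ.2 hx⟩⟩
  have hz : ∀ t, t ∉ Icc α β → ψ t = 0 := fun t ht =>
    image_eq_zero_of_notMem_tsupport fun h => ht (hαβ h)
  set φ : ℝ → ℝ := fun t => ∫ s in (0 : ℝ)..t, ψ s with hφ
  have hd : ∀ t, HasDerivAt φ (ψ t) t := fun t =>
    intervalIntegral.integral_hasDerivAt_right (hψ.continuous.intervalIntegrable _ _)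
      (hψ.continuous.stronglyMeasurableAtFilter _ _) hψ.continuous.continuousAt
  have hderiv : deriv φ = ψ := funext fun t => (hd t).deriv
  have hφ0 : ∀ t, t ∉ Icc α β → φ t = 0 := by
    intro t ht
    rcases lt_or_ge t α with h1 | h1
    · refine intervalIntegral.integral_zero_ae (Eventually.of_forall fun s hs => hz s fun h => ?_)
      rcases mem_uIoc.1 hs with h2 | h2
      · linarith [h2.2, h.1]
      · linarith [h2.2, h.1]
    · have h2 : β < t := lt_of_not_ge fun h => ht ⟨h1, h⟩
      rw [hφ]
      simp only
      rw [intervalIntegral.integral_eq_integral_of_support_subset, h0]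
      intro s hs
      have h3 := hαβ (subset_tsupport ψ hs)
      exact ⟨by linarith [h3.1], by linarith [h3.2]⟩
  have hsub : tsupport φ ⊆ Icc α β :=
    closure_minimal (fun t ht => by_contra fun h => ht (hφ0 t h)) isClosed_Icc
  refine ⟨φ, contDiff_infty_iff_deriv.2 ⟨fun t => (hd t).differentiableAt, hderiv ▸ hψ⟩,
    HasCompactSupport.intro isCompact_Icc hφ0, hsub.trans fun t ht => ?_, hderiv⟩
  exact ⟨by linarith [ht.1], by linarith [ht.2]⟩

lemma integrable_test_mul {T : ℝ} {φ h : ℝ → ℝ} (hφ : Continuous φ) (hφc : HasCompactSupport φ)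
    (hh : Integrable h (timeMeasure T)) : Integrable (fun t => φ t * h t) (timeMeasure T) := by
  obtain ⟨C, hC⟩ := hφ.bounded_above_of_compact_support hφc
  exact hh.bdd_mul (c := C) hφ.aestronglyMeasurable (Eventually.of_forall hC)

/-- The lemma of du Bois-Reymond. -/
lemma ae_eq_const_of_integral_deriv_mul_eq_zero {T : ℝ} (hT : 0 < T) {h : ℝ → ℝ}
    (hh : Integrable h (timeMeasure T))
    (h0 : ∀ φ : ℝ → ℝ, ContDiff ℝ ∞ φ → HasCompactSupport φ → tsupport φ ⊆ Ioo 0 T →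
      ∫ t in Ioo 0 T, deriv φ t * h t = 0) :
    ∃ C, ∀ᵐ t ∂timeMeasure T, h t = C := by
  let b : ContDiffBump (T / 2) := ⟨T / 8, T / 4, by positivity, by linarith⟩
  set θ : ℝ → ℝ := b.normed volume with hθ
  have hθs : ContDiff ℝ ∞ θ := b.contDiff_normed
  have hθc : HasCompactSupport θ := b.hasCompactSupport_normed
  have hθT : tsupport θ ⊆ Ioo 0 T := by
    rw [hθ, b.tsupport_normed_eq, Real.closedBall_eq_Icc]
    intro x hx
    have h1 : T / 2 - T / 4 ≤ x := hx.1
    have h2 : x ≤ T / 2 + T / 4 := hx.2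
    exact ⟨by linarith, by linarith⟩
  have hθ1 : ∫ t, θ t = 1 := b.integral_normed
  set C := ∫ t in Ioo 0 T, θ t * h t with hC
  refine ⟨C, ?_⟩
  have key : ∀ ψ : ℝ → ℝ, ContDiff ℝ ∞ ψ → HasCompactSupport ψ → tsupport ψ ⊆ Ioo 0 T →
      ∫ t, ψ t • (h t - C) = 0 := by
    intro ψ hψ hψc hψT
    have hψi := hψ.continuous.integrable_of_hasCompactSupport hψc (μ := volume)
    have hθi := hθs.continuous.integrable_of_hasCompactSupport hθc (μ := volume)
    set m := ∫ t, ψ t with hm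
    -- subtracting a multiple of `θ` gives zero mean
    obtain ⟨φ, hφ, hφc, hφT, hφd⟩ := exists_test_primitive hT (ψ := fun t => ψ t - m * θ t)
      (hψ.sub (contDiff_const.mul hθs)) (hψc.sub hθc.mul_left)
      ((tsupport_sub _ _).trans (union_subset hψT ((tsupport_mul_subset_right).trans hθT)))
      (by rw [integral_sub hψi (hθi.const_mul m), integral_const_mul, hθ1]; simp [hm])
    have h1 := h0 φ hφ hφc hφT
    have e1 : ∀ t, deriv φ t * h t = ψ t * h t - m * (θ t * h t) := fun t => by
      rw [hφd]; ring
    simp only [e1] at h1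
    rw [integral_sub (integrable_test_mul hψ.continuous hψc hh)
      ((integrable_test_mul hθs.continuous hθc hh).const_mul m), integral_const_mul] at h1
    have e2 : ∫ t, ψ t • (h t - C) = ∫ t in Ioo 0 T, ψ t • (h t - C) := by
      refine (setIntegral_eq_integral_of_forall_compl_eq_zero fun t ht => ?_).symm
      rw [image_eq_zero_of_notMem_tsupport fun h => ht (hψT h), zero_smul]
    have e3 : ∫ t in Ioo 0 T, ψ t = m :=
      setIntegral_eq_integral_of_forall_compl_eq_zero fun t ht =>
        image_eq_zero_of_notMem_tsupport fun h => ht (hψT h)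
    rw [e2]
    simp only [smul_eq_mul, mul_sub]
    rw [integral_sub (integrable_test_mul hψ.continuous hψc hh) (hψi.restrict.mul_const C),
      integral_mul_const, e3]
    exact h1
  have h2 := isOpen_Ioo.ae_eq_zero_of_integral_contDiff_smul_eq_zero (U := Ioo 0 T)
    (f := fun t => h t - C) (μ := volume)
    (IntegrableOn.locallyIntegrableOn (hh.sub (integrable_const C))) key
  rw [ae_restrict_iff' measurableSet_Ioo]
  filter_upwards [h2] with t ht htT
  exact sub_eq_zero.1 (ht htT)

/-- If the distributional derivative of `a` is the integrable function `b` and `g` is the continuous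
representative of `a`, then `a` is `g(0)` plus the primitive of `b`. -/
lemma ae_eq_add_primitive {T : ℝ} (hT : 0 < T) {a b g : ℝ → ℝ} (ha : Integrable a (timeMeasure T))
    (hb : Integrable b (timeMeasure T)) (hg : ContinuousOn g (Icc 0 T))
    (hga : ∀ᵐ t ∂timeMeasure T, g t = a t)
    (heq : ∀ φ : ℝ → ℝ, ContDiff ℝ ∞ φ → HasCompactSupport φ → tsupport φ ⊆ Ioo 0 T →
      -(∫ t in Ioo 0 T, deriv φ t * a t) = ∫ t in Ioo 0 T, φ t * b t) :
    ∀ᵐ t ∂timeMeasure T, a t = g 0 + ∫ s in Ioo 0 t, b s := by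
  set B : ℝ → ℝ := fun t => ∫ s in Ioo 0 t, b s with hB
  have hBc : ContinuousOn B (Icc 0 T) := continuousOn_primitive_Ioo hb
  have hBi : Integrable B (timeMeasure T) := (memLp_top_primitive hb).integrable le_top
  obtain ⟨C, hC⟩ := ae_eq_const_of_integral_deriv_mul_eq_zero hT (h := fun t => a t - B t)
    (ha.sub hBi) fun φ hφ hφc hφT => by
      have hd : Continuous (deriv φ) := hφ.continuous_deriv (by simp)
      have hdi : Integrable (deriv φ) (timeMeasure T) :=
        (hd.integrable_of_hasCompactSupport hφc.deriv).restrict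
      have h1 := integral_inner_primitive (X := ℝ) hdi hb
      have h2 : ∀ s ∈ Ioo 0 T, ∫ t in Ioo s T, deriv φ t = -φ s := by
        intro s hs
        rw [← integral_Ioc_eq_integral_Ioo, ← intervalIntegral.integral_of_le hs.2.le,
          intervalIntegral.integral_deriv_eq_sub
            (fun x _ => (hφ.differentiable (by simp)) x) (hd.intervalIntegrable _ _),
          image_eq_zero_of_notMem_tsupport fun h => lt_irrefl _ (hφT h).2, zero_sub]
      have h3 : ∫ s in Ioo 0 T, inner ℝ (∫ t in Ioo s T, deriv φ t) (b s) =
          -∫ s in Ioo 0 T, φ s * b s := by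
        rw [← integral_neg]
        refine setIntegral_congr_fun measurableSet_Ioo fun s hs => ?_
        simp only [h2 s hs, RCLike.inner_apply, conj_trivial]
        ring
      have h4 : ∫ t in Ioo 0 T, inner ℝ (deriv φ t) (∫ s in Ioo 0 t, b s) =
          ∫ t in Ioo 0 T, deriv φ t * B t := by
        refine setIntegral_congr_fun measurableSet_Ioo fun s hs => ?_
        simp only [hB, RCLike.inner_apply, conj_trivial]
        ring
      have h5 := heq φ hφ hφc hφT
      simp only [mul_sub]
      rw [integral_sub (integrable_test_mul hd hφc.deriv ha)
        (integrable_test_mul hd hφc.deriv hBi), ← h4, h1, h3]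
      linarith
  -- the continuous function `g - B` is constant up to the end point `0`
  have h6 : ∀ᵐ t ∂volume.restrict (Ioo 0 T), (fun t => g t - B t) t = (fun _ => C) t := by
    filter_upwards [hC, hga] with t h1 h2
    rw [h2, h1]
  have h7 : EqOn (fun t => g t - B t) (fun _ => C) (Ioo 0 T) :=
    Measure.eqOn_open_of_ae_eq h6 isOpen_Ioo ((hg.sub hBc).mono Ioo_subset_Icc_self)
      continuousOn_const
  have h8 : EqOn (fun t => g t - B t) (fun _ => C) (Icc 0 T) :=
    h7.of_subset_closure (hg.sub hBc) continuousOn_const Ioo_subset_Icc_self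
      (closure_Ioo hT.ne).ge
  have h9 : g 0 - B 0 = C := h8 ⟨le_rfl, hT.le⟩
  have hB0 : B 0 = 0 := by simp [hB]
  filter_upwards [hC] with t ht
  have h10 : B t = ∫ s in Ioo 0 t, b s := rfl
  linarith

end DistributionalDerivative

section WeakSolution

instance secondCountableTopology_fields : SecondCountableTopology H := by
  have : Fact ((2 : ℝ≥0∞) ≠ ⊤) := ⟨by simp⟩
  infer_instance

variable {T : ℝ} {Λ : ℝ → Matrix Idx Idx (Linf ℝ)}
  {f : ℝ → H} {u₀ : H} {w : ℝ → H} {M : Matrix Idx Idx (Linf ℝ)}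

/-- The weak formulation, integrated in time. -/
lemma IsWeakSolution.integrated (hT : 0 < T) (h : IsWeakSolution T M Λ f u₀ w)
    (hΛ : ∀ i j, LocallyIntegrable (fun t => Λ t i j) volume) (hcausal : IsCausal Λ)
    (hf : IntegrableOn f (Ioo 0 T)) {p : H × H} (hp : p ∈ maxwellGraph) :
    ∀ᵐ t ∂timeMeasure T, inner ℝ (mulOp M (w t)) p.1 = inner ℝ (mulOp M u₀) p.1 +
      ∫ s in Ioo 0 t, (inner ℝ (w s) p.2 + inner ℝ (f s) p.1 -
        inner ℝ (convOn (kernelOp Λ T) T w s) p.1) := by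
  have hw : Integrable w (timeMeasure T) := MemLp.integrable le_top h.memLp
  have hcw : Integrable (convOn (kernelOp Λ T) T w) (timeMeasure T) :=
    integrable_convOn (integrable_kernelOp hΛ T) hw
  obtain ⟨g, hgc, hga, hg0⟩ := h.initial p.1 p.2 hp
  simp only [← mulOp_apply] at hga hg0
  have hwi : Integrable (fun s => inner ℝ (w s) p.2 + inner ℝ (f s) p.1) (timeMeasure T) :=
    (hw.inner_const p.2).add (Integrable.inner_const hf p.1)
  have hci : Integrable (fun s => inner ℝ (convOn (kernelOp Λ T) T w s) p.1) (timeMeasure T) :=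
    hcw.inner_const p.1
  rw [← hg0]
  refine ae_eq_add_primitive hT (((mulOp M).integrable_comp hw).inner_const p.1) (hwi.sub hci)
    hgc hga fun φ hφ hφc hφT => ?_
  have h1 := h.equation p.1 p.2 hp φ hφ hφc hφT
  simp only [← mulOp_apply] at h1
  have h2 : ∫ t in Ioo 0 T, φ t * inner ℝ (truncConv Λ w t) p.1 =
      ∫ t in Ioo 0 T, φ t * inner ℝ (convOn (kernelOp Λ T) T w t) p.1 :=
    setIntegral_congr_fun measurableSet_Ioo fun t ht => by rw [convOn_kernelOp hcausal ht]
  have h3 := integral_sub (integrable_test_mul hφ.continuous hφc hwi)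
    (integrable_test_mul hφ.continuous hφc hci)
  simp only [mul_sub]
  rw [h3]
  rw [h2] at h1
  linarith

/-- Weak solutions are unique: the difference of two of them satisfies the integrated homogeneous
equation. -/
lemma IsWeakSolution.ae_eq {c : ℝ} (hM : IsSymmCoercive c (mulOp M)) {u : ℝ → H} (hT : 0 < T)
    (h : IsWeakSolution T M Λ f u₀ w) (h' : IsWeakSolution T M Λ f u₀ u)
    (hΛ : ∀ i j, LocallyIntegrable (fun t => Λ t i j) volume) (hcausal : IsCausal Λ)
    (hpos : IsPositiveKernel (kernelOp Λ T) T) (hf : IntegrableOn f (Ioo 0 T)) :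
    ∀ᵐ t ∂timeMeasure T, w t = u t := by
  have hK := integrable_kernelOp hΛ T
  have hwi : Integrable w (timeMeasure T) := MemLp.integrable le_top h.memLp
  have hui : Integrable u (timeMeasure T) := MemLp.integrable le_top h'.memLp
  have key := eq_zero_of_integrated_equation (w := fun t => w t - u t)
    isSkewAdjointGraph_maxwellGraph hM hK (kernelOp_eq_zero_of_neg hcausal T) hpos (hwi.sub hui)
    fun p hp => by
      filter_upwards [h.integrated hT hΛ hcausal hf hp, h'.integrated hT hΛ hcausal hf hp,
        ae_restrict_mem measurableSet_Ioo] with t h1 h2 ht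
      have hle : timeMeasure t ≤ timeMeasure T :=
        Measure.restrict_mono (Ioo_subset_Ioo_right ht.2.le) le_rfl
      have hi : ∀ {y : ℝ → H}, Integrable y (timeMeasure T) → Integrable (fun s =>
          inner ℝ (y s) p.2 + inner ℝ (f s) p.1 - inner ℝ (convOn (kernelOp Λ T) T y s) p.1)
          (timeMeasure t) := fun hy =>
        (((hy.inner_const p.2).add (Integrable.inner_const hf p.1)).sub
          ((integrable_convOn hK hy).inner_const p.1)).mono_measure hle
      rw [map_sub, inner_sub_left, h1, h2, add_sub_add_left_eq_sub,
        ← integral_sub (hi hwi) (hi hui)]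
      refine integral_congr_ae (Filter.Eventually.of_forall fun s => ?_)
      simp only [convOn_sub hK h.memLp h'.memLp, inner_sub_left]
      ring
  filter_upwards [key] with t ht
  exact sub_eq_zero.1 ht

end WeakSolution

end DispersiveMaxwell

end

theorem theorem1 (c : ℝ) (hc : 0 < c) :
    ∃ C : ℝ, 0 < C ∧
      ∀ (T : ℝ) (_hT : 0 < T)
        (ε μ : Matrix (Fin 3) (Fin 3) (Linf ℝ)) (_hε : IsElliptic c ε) (_hμ : IsElliptic c μ)
        (Λ : ℝ → Matrix Idx Idx (Linf ℝ)) (ΛHat : ℝ → Matrix Idx Idx (Linf ℂ))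
        (_hΛ : ∀ i j, LocallyIntegrable (fun t => Λ t i j) volume)
        (_hΛHat : ∀ i j, LocallyIntegrable (fun ξ => ΛHat ξ i j) volume)
        (_hFourier : ∀ i j, IsTimeFourier (fun t => Λ t i j) (fun ξ => ΛHat ξ i j))
        (_hcausal : IsCausal Λ) (_hpassive : IsPassive ΛHat)
        (u₀ : H) (f : ℝ → H) (_hf : IntegrableOn f (Ioo 0 T) volume),
        ∃ u : ℝ → H,
          IsWeakSolution T (blockM ε μ) Λ f u₀ u ∧
          (∀ w : ℝ → H, IsWeakSolution T (blockM ε μ) Λ f u₀ w →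
            ∀ᵐ t ∂(volume.restrict (Ioo 0 T)), w t = u t) ∧
          ∀ᵐ t ∂(volume.restrict (Ioo 0 T)),
            inner ℝ (mulField (blockM ε μ) (u t)) (u t) ≤
              (Real.sqrt (inner ℝ (mulField (blockM ε μ) u₀) u₀)
                + C * ∫ s in (0 : ℝ)..t, ‖f s‖) ^ 2 := by
  refine ⟨2 / √c, div_pos two_pos (Real.sqrt_pos.2 hc), ?_⟩
  intro T hT ε μ hε hμ Λ ΛHat hΛ hΛHat hFourier hcausal hpassive u₀ f hf
  have hM := isSymmCoercive_mulOp hc hε hμ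
  have hpos := isPositiveKernel_kernelOp hΛ hΛHat hFourier hpassive T
  obtain ⟨u, huc, hu0, hueq, hen⟩ := exists_continuous_solution isSkewAdjointGraph_maxwellGraph hM
    (integrable_kernelOp hΛ T) (kernelOp_eq_zero_of_neg hcausal T) hT hpos u₀ hf
  simp only [mulOp_apply] at hueq hen
  have hsol : IsWeakSolution T (blockM ε μ) Λ f u₀ u :=
    { memLp := memLp_top_of_continuous huc T
      equation := fun v w hvw φ hφ hφc hφT => by
        rw [← hueq (v, w) hvw φ hφ hφc hφT]
        congr 1
        exact setIntegral_congr_fun measurableSet_Ioo fun t ht => by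
          simp only [convOn_kernelOp hcausal ht]
      initial := fun v w _ => by
        refine ⟨fun t => inner ℝ (mulField (blockM ε μ) (u t)) v, ?_,
          Filter.Eventually.of_forall fun t => rfl, by simp only [hu0]⟩
        simp only [← mulOp_apply]
        exact (((mulOp _).continuous.comp huc).inner continuous_const).continuousOn }
  refine ⟨u, hsol, fun w hw => hw.ae_eq hM hT hsol hΛ hcausal hpos hf, ?_⟩
  filter_upwards [ae_restrict_mem measurableSet_Ioo] with t ht
  have h1 := hen t (Ioo_subset_Icc_self ht)
  have h2 : 0 ≤ inner ℝ (mulField (blockM ε μ) (u t)) (u t) := by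
    rw [← mulOp_apply]
    exact (mul_nonneg hc.le (sq_nonneg _)).trans (hM.coercive (u t))
  rw [intervalIntegral.integral_of_le ht.1.le, integral_Ioc_eq_integral_Ioo]
  calc inner ℝ (mulField (blockM ε μ) (u t)) (u t)
      = √(inner ℝ (mulField (blockM ε μ) (u t)) (u t)) ^ 2 := (Real.sq_sqrt h2).symm
    _ ≤ _ := by gcongr
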